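/- **Setting.** Let $\mathcal X,\mathcal A$ be finite non-empty sets and $H\ge 1$. An episode consists of steps $h=0,\dots,H-1$: the initial state $x_0\in\mathcal X$ is drawn from a fixed distribution $\rho$; after action $a_h\in\mathcal A$ in state $x_h$, an outcome $(r_{h+1},x_{h+1})\in\{0,1\}\times\mathcal X$ is drawn from a categorical distribution $\mathcal P_{h,x_h,a_h}$; the episode terminates after step $H-1$ (so $x_H$ plays no role). The MDP $\mathcal M=(\mathcal P_{h,x,a})_{h,x,a}$ is random: the $\mathcal P_{h,x,a}$, for all $h\in\{0,\dots,H-1\}$, $x\in\mathcal X$, $a\in\mathcal A$, are independent with $\mathcal P_{h,x,a}\sim\mathrm{Dirichlet}(\alpha^0_{h,x,a})$, where $\alpha^0_{h,x,a}\in(0,\infty)^{2|\mathcal X|}$ and $\mathbf 1^{T}\alpha^0_{h,x,a}=\beta$ for all $(h,x,a)$. For a policy $\pi$ (a map from pairs $(h,x)$ to distributions over $\mathcal A$) let $V^{\pi}_{\mathcal M,0}(x)=\mathbb E_{\mathcal M,\pi}[\sum_{h=0}^{H-1}r_{h+1}\mid x_0=x]$ and $V^*_{\mathcal M,0}(x)=\max_\pi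 V^\pi_{\mathcal M,0}(x)$. **Algorithm (tabular Wasserstein TD, $\mathsf{WTD}$),** with parameters $\bar\theta\in\mathbb R$, $\sigma,\sigma_0>0$ and prior weight $\sigma^2/\sigma_0^2=\beta$. In episode $l=1,2,\dots$, let $\mathcal D_{h,x,a}$ be the multiset of all outcomes observed in episodes $1,\dots,l-1$ after action $a$ in state $x$ at step $h$, and $n(h,x,a)=|\mathcal D_{h,x,a}|$. The agent draws independent $z_{h,x,a}\sim\mathcal N(0,1)$ (independently of the past), sets $Q^l_H=0$ and, for $h=H-1,\dots,0$, $$Q^l_h(x,a)=\frac{\sum_{(r,x')\in\mathcal D_{h,x,a}}\bigl(r+\max_{a'}Q^l_{h+1}(x',a')\bigr)+\beta\bar\theta}{n(h,x,a)+\beta}+\frac{\sqrt{n(h,x,a)}\,\sigma+\beta\sigma_0}{n(h,x,a)+\beta}\,z_{h,x,a},$$ and plays the episode with the greedy policy $\pi^l_h(x)\in\arg\max_a Q^l_h(x,a)$ (ties, which have probability zero, are broken by any measurable rule). Its Bayesian regret is $$\mathrm{BayesRegret}(\mathsf{WTD},L)=\mathbb E\Bigl[\sum_{l=1}^{L}\bigl(V^*_{\mathcal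 M,0}(x_0^l)-V^{\pi^l}_{\mathcal M,0}(x_0^l)\bigr)\Bigr],$$ where $x_0^l$ is the initial state of episode $l$ and the expectation is over the prior, the algorithm and the environment. **Theorem.** Let $\beta\ge 3$, and let the algorithm be applied with $\sigma^2=3H^2$, $\bar\theta=H$ and $\sigma^2/\sigma_0^2=\beta$. Then, for every number of episodes $L\in\mathbb N$, with $\log_+(x)=\max\{1,\log x\}$, $$\mathrm{BayesRegret}(\mathsf{WTD},L)\le 5H^2\sqrt{\beta|\mathcal X||\mathcal A|L\,\log_+\bigl(2|\mathcal X||\mathcal A|HL\bigr)}\;\log_+\Bigl(1+\frac{L}{|\mathcal X||\mathcal A|}\Bigr),$$ and the right-hand side is $\widetilde O\bigl(H^2\sqrt{|\mathcal X||\mathcal A|L}\bigr)$: for fixed $\beta$ there are constants $C$ and $k$, depending only on $\beta$, such that it is at most $C\,H^2\sqrt{|\mathcal X||\mathcal A|L}\,\log_+(|\mathcal X||\mathcal A|HL)^k$ for all $|\mathcal X|,|\mathcal A|,H,L$. -/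

import Mathlib

open MeasureTheory ProbabilityTheory

namespace WTD

noncomputable section

/-! ### The environment: finite-horizon, time-inhomogeneous MDPs with binary rewards -/

/-- An outcome of a transition: the binary reward (`true` is reward `1`) and the next state. At the
last step the episode terminates and the state component plays no role. -/
abbrev Outcome (X : Type*) := Bool × X

/-- The real value of a binary reward. -/
def rew (r : Bool) : ℝ := if r then 1 else 0

/-- The unknown part of the MDP: for every step, state and action, a categorical distribution over
the `2|X|` outcomes. -/
abbrev Model (H : ℕ) (X A : Type*) [Fintype X] :=
  Fin H × X × A → stdSimplex ℝ (Outcome X)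

/-- A (stochastic, step-dependent) policy. -/
abbrev Policy (H : ℕ) (X A : Type*) [Fintype A] := Fin H → X → stdSimplex ℝ A

/-- A deterministic policy. -/
abbrev DetPolicy (H : ℕ) (X A : Type*) := Fin H → X → A

/-- A deterministic policy, seen as a stochastic one. -/
def DetPolicy.toPolicy {H : ℕ} {X A : Type*} [Fintype A] [DecidableEq A]
    (π : DetPolicy H X A) : Policy H X A :=
  fun h x => stdSimplex.vertex (π h x)

/-- What happens at each step after the initial state is given: the action `a_h` taken and the
outcome `(r_{h+1}, x_{h+1})` observed. -/
abbrev Trajectory (H : ℕ) (X A : Type*) := Fin H → A × Outcome X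

/-- An episode: the initial state `x_0` and the trajectory that starts there. -/
abbrev Episode (H : ℕ) (X A : Type*) := X × Trajectory H X A

namespace Episode

variable {H : ℕ} {X A : Type*}

/-- The state `x_h`. -/
def state (e : Episode H X A) (h : Fin H) : X :=
  (Fin.cons e.1 (fun t : Fin H => (e.2 t).2.2) : Fin (H + 1) → X) h.castSucc

/-- The action `a_h`. -/
def action (e : Episode H X A) (h : Fin H) : A := (e.2 h).1

/-- The outcome `(r_{h+1}, x_{h+1})`. -/
def outcome (e : Episode H X A) (h : Fin H) : Outcome X := (e.2 h).2

/-- The sum of the rewards. -/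
def totalReward (e : Episode H X A) : ℝ := ∑ h, rew (e.outcome h).1

end Episode

section Environment

variable {H : ℕ} {X A : Type*} [Fintype X] [Fintype A]

/-- The conditional probability, given the initial state, of an episode in the MDP `M` under the
policy `π`. -/
def episodeProb (M : Model H X A) (π : Policy H X A) (e : Episode H X A) : ℝ :=
  ∏ h, π h (e.state h) (e.action h) * M (h, e.state h, e.action h) (e.outcome h)

/-- `V^π_{M,0}(x)`: the expected sum of rewards of an episode that starts in `x`. -/
def value (M : Model H X A) (π : Policy H X A) (x : X) : ℝ :=
  ∑ τ : Trajectory H X A, episodeProb M π (x, τ) * Episode.totalReward (x, τ)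

/-- `V^*_{M,0}(x)`: the optimal value over all policies. -/
def optValue (M : Model H X A) (x : X) : ℝ := ⨆ π : Policy H X A, value M π x

end Environment

/-! ### The Dirichlet prior -/

/-- The Dirichlet distribution with parameters `α i > 0`, as the law of the vector of proportions
`g i / ∑ j, g j` of independent variables `g i ∼ Gamma(α i, 1)`. These proportions lie in the
simplex almost surely, and `comap` views their law as a measure on the simplex. -/
def dirichlet {ι : Type*} [Fintype ι] (α : ι → ℝ) : Measure (stdSimplex ℝ ι) :=
  Measure.comap (fun p : stdSimplex ℝ ι => (p : ι → ℝ))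
    (Measure.map (fun g : ι → ℝ => fun i => g i / ∑ j, g j)
      (Measure.pi fun i => gammaMeasure (α i) 1))

/-- The prior over MDPs: the outcome distributions are independent Dirichlet. -/
def prior {H : ℕ} {X A : Type*} [Fintype X] [Fintype A]
    (α : Fin H × X × A → Outcome X → ℝ) : Measure (Model H X A) :=
  Measure.pi fun i => dirichlet (α i)

/-! ### The agent: tabular Wasserstein TD -/

/-- The parameters of the algorithm: the prior of each action value is `N(θbar, σ₀²)`, and `σ` is
the scale of the noise in the learning target. -/
structure Params where
  θbar : ℝ
  σ : ℝ
  σ₀ : ℝ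

/-- The weight `σ² / σ₀²` of the regularization to the prior. -/
def Params.weight (p : Params) : ℝ := p.σ ^ 2 / p.σ₀ ^ 2

section Agent

variable {H n : ℕ} {X A : Type*} [DecidableEq X] [DecidableEq A]

/-- The past episodes in which action `a` was taken in state `x` at step `h`. They index the data
set `D_{h,x,a}`, in which repeated outcomes are kept. -/
def visits (hist : Fin n → Episode H X A) (h : Fin H) (x : X) (a : A) : Finset (Fin n) :=
  {j | (hist j).state h = x ∧ (hist j).action h = a}

/-- The updated mean parameter `ν(h, x, a)`; `Qnext` is the sampled value function at `h + 1`. -/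
def nu (p : Params) (hist : Fin n → Episode H X A) (Qnext : X → A → ℝ)
    (h : Fin H) (x : X) (a : A) : ℝ :=
  ((∑ j ∈ visits hist h x a,
      (rew ((hist j).outcome h).1 + ⨆ a' : A, Qnext ((hist j).outcome h).2 a'))
    + p.weight * p.θbar) / ((visits hist h x a).card + p.weight)

/-- The updated standard deviation parameter `m(h, x, a)`. -/
def m (p : Params) (hist : Fin n → Episode H X A) (h : Fin H) (x : X) (a : A) : ℝ :=
  (Real.sqrt (visits hist h x a).card * p.σ + p.weight * p.σ₀)
    / ((visits hist h x a).card + p.weight)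

/-- The sampled value functions `Q_0, …, Q_H`, computed backwards from `Q_H = 0` by
`Q_h(x, a) = ν(h, x, a) + m(h, x, a) z_{h,x,a}`. -/
def sampledQ (p : Params) (hist : Fin n → Episode H X A) (z : Fin H × X × A → ℝ) :
    Fin (H + 1) → X → A → ℝ :=
  Fin.reverseInduction (motive := fun _ => X → A → ℝ) (fun _ _ => 0)
    (fun h Qnext x a => nu p hist Qnext h x a + m p hist h x a * z (h, x, a))

/-- The greedy policy of the sampled value functions, where `sel` selects a maximizing action. -/
def greedy (p : Params) (sel : (A → ℝ) → A) (hist : Fin n → Episode H X A)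
    (z : Fin H × X × A → ℝ) : DetPolicy H X A :=
  fun h x => sel (sampledQ p hist z h.castSucc x)

/-- The indices `z_{h,x,a}` of one episode: independent standard Gaussians. -/
def noise (H : ℕ) (X A : Type*) [Fintype X] [Fintype A] : Measure (Fin H × X × A → ℝ) :=
  Measure.pi fun _ => gaussianReal 0 1

/-- The conditional probability, given the past episodes, that the agent follows `π` in the next
episode. -/
def policyProb [Fintype X] [Fintype A] (p : Params) (sel : (A → ℝ) → A)
    (hist : Fin n → Episode H X A) (π : DetPolicy H X A) : ℝ :=
  (noise H X A).real {z | greedy p sel hist z = π}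

end Agent

/-! ### The interaction and the Bayesian regret -/

section Regret

variable {H L : ℕ} {X A : Type*} [Fintype X] [Fintype A] [DecidableEq X] [DecidableEq A]

/-- A run of `L` episodes: the policy followed in each episode and the episode itself. -/
abbrev Run (L H : ℕ) (X A : Type*) := Fin L → DetPolicy H X A × Episode H X A

/-- The episodes of a run that precede episode `l`. -/
def Run.past (w : Run L H X A) (l : Fin L) : Fin (l : ℕ) → Episode H X A :=
  fun j => (w (j.castLE l.isLt.le)).2

/-- The probability of a run in the MDP `M`: in each episode, the agent draws its policy given the
past episodes, the initial state is drawn from `ρ`, and the policy interacts with `M`. -/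
def runProb (ρ : stdSimplex ℝ X) (p : Params) (sel : (A → ℝ) → A) (M : Model H X A)
    (w : Run L H X A) : ℝ :=
  ∏ l, policyProb p sel (w.past l) (w l).1 * ρ (w l).2.1
    * episodeProb M (w l).1.toPolicy (w l).2

/-- The regret of a run: the sum over its episodes of `V^*_{M,0}(x_0) - V^π_{M,0}(x_0)`. -/
def runRegret (M : Model H X A) (w : Run L H X A) : ℝ :=
  ∑ l, (optValue M (w l).2.1 - value M (w l).1.toPolicy (w l).2.1)

/-- The expected regret over `L` episodes in the MDP `M`. -/
def expectedRegret (ρ : stdSimplex ℝ X) (p : Params) (sel : (A → ℝ) → A) (L : ℕ)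
    (M : Model H X A) : ℝ :=
  ∑ w : Run L H X A, runProb ρ p sel M w * runRegret M w

/-- The Bayesian regret over `L` episodes: the expected regret, averaged over the prior. -/
def bayesRegret (α : Fin H × X × A → Outcome X → ℝ) (ρ : stdSimplex ℝ X) (p : Params)
    (sel : (A → ℝ) → A) (L : ℕ) : ℝ :=
  ∫ M, expectedRegret ρ p sel L M ∂(prior α)

end Regret

/-- `log₊ x = max {1, log x}`. -/
def logPlus (x : ℝ) : ℝ := max 1 (Real.log x)

/-- The regret bound, for `nX` states and `nA` actions. -/
def regretBound (β : ℝ) (nX nA H L : ℕ) : ℝ :=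
  5 * (H : ℝ) ^ 2 * Real.sqrt (β * nX * nA * L * logPlus (2 * nX * nA * H * L))
    * logPlus (1 + L / (nX * nA))

end

end WTD

open MeasureTheory ProbabilityTheory

namespace WTD

noncomputable section

/-! ### Convex functions of Gaussian variables -/

/-! Condition on the past episodes. By conjugacy the posterior is again a product of Dirichlet laws,
with the counts added to the parameters (`exists_integral_runProb`), so it suffices to bound the
posterior expected regret of one episode and to sum.

Optimism. For increasing convex 1-Lipschitz utilities, the expectation under a Dirichlet vector of a
function with values in `[0, s]` is dominated by a Gaussian with at least the same mean and variance
at least `3 s² / A`, where `A = ∑ α` (`dirichlet_le_gaussian`). The reason is the Pólya urn: a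
Dirichlet law is the mixture of its one-observation posteriors, whose means differ from its own by a
centred variable of range at most `s / (A + 1)`. Such a variable is dominated by a Gaussian
(`sum_le_gaussian`), and `1/(A+1) + 1/(A+1)² ≤ 1/A` keeps the accumulated variance within its
budget. The value at step 0 is convex, increasing and 1-Lipschitz in each single update of the
backward recursion, so the updates of the posterior model can be exchanged for the sampled ones one
index at a time, in order of increasing step (`mixed_le_mixed_insert`). During an exchange the later
values are still those of the model, so one reward plus the next value lies in `[0, H]`; this is
what `θbar = H` and `σ² = 3H²` are made for. Hence the posterior mean of the optimal value is at
most the mean sampled value (`integral_optValue_le`).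

Estimation. An index contains its step, so an episode visits it at most once, and the posterior
expected value of a policy is its value in the mean model (`integral_value`). The performance
difference identity `sum_bellmanGap` writes the sampled value minus that value as an expected sum of
Bellman gaps along the greedy policy. In each gap the data cancel; the noise and the prior's share
of the update remain. They are bounded by a `bonus` depending on the number of visits, plus the
excess of the noise over a truncation level `T` (`bellmanGap_sampledV_le`).

Summation. The bonuses collected add up to a `potential` that depends on the visit counts alone.
Cauchy-Schwarz and concavity of the logarithm bound it deterministically (`potential_bonus_le`). A
suitable `T` makes the excess negligible, and when `L` is too small for the prior terms to be
absorbed, the trivial bound `L H` suffices. -/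

lemma lipschitz_abs_le {u : ℝ → ℝ} (hl : LipschitzWith 1 u) (x y : ℝ) : |u x - u y| ≤ |x - y| := by
  have := hl.dist_le_mul x y
  simpa [Real.dist_eq] using this

lemma integrable_id_gaussian : Integrable (fun x : ℝ => x) (gaussianReal 0 1) :=
  by
  simpa [Function.id_def] using memLp_one_iff_integrable.mp (memLp_id_gaussianReal (μ := 0) (v := 1) 1)

lemma integrable_lipschitz_gaussian {u : ℝ → ℝ} (hl : LipschitzWith 1 u) (y a : ℝ) :
    Integrable (fun x => u (y + a * x)) (gaussianReal 0 1) := by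
  have hc : Continuous fun x => u (y + a * x) := hl.continuous.comp (by fun_prop)
  refine Integrable.mono' (g := fun x => |u y| + |a| * |x|)
    ((integrable_const _).add (integrable_id_gaussian.abs.const_mul _)) hc.aestronglyMeasurable
    (Filter.Eventually.of_forall fun x => ?_)
  have h := lipschitz_abs_le hl (y + a * x) y
  have h2 : |u (y + a * x)| ≤ |u y| + |u (y + a * x) - u y| := by
    have := abs_add_le (u y) (u (y + a * x) - u y)
    simpa using this
  simp only [add_sub_cancel_left, abs_mul] at h
  simpa using h2.trans (by linarith)

lemma integral_gaussian_neg (f : ℝ → ℝ) :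
    ∫ x, f (-x) ∂gaussianReal 0 1 = ∫ x, f x ∂gaussianReal 0 1 := by
  have h : (gaussianReal 0 1).map (fun x : ℝ => -x) = gaussianReal 0 1 := by
    simpa using gaussianReal_map_neg (μ := 0) (v := 1)
  conv_rhs => rw [← h]
  exact ((MeasurableEquiv.neg ℝ).measurableEmbedding.integral_map f).symm

/-- Averaging a function with its reflection does not change its Gaussian integral. -/
lemma integral_gaussian_symm {u : ℝ → ℝ} (hl : LipschitzWith 1 u) (y a : ℝ) :
    ∫ x, u (y + a * x) ∂gaussianReal 0 1
      = ∫ x, (u (y + a * x) + u (y - a * x)) / 2 ∂gaussianReal 0 1 := by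
  have h1 := integral_gaussian_neg fun x => u (y + a * x)
  have h2 : Integrable (fun x => u (y - a * x)) (gaussianReal 0 1) := by
    simpa [sub_eq_add_neg] using integrable_lipschitz_gaussian hl y (-a)
  rw [integral_div, integral_add (integrable_lipschitz_gaussian hl y a) h2]
  have : ∫ x, u (y - a * x) ∂gaussianReal 0 1 = ∫ x, u (y + a * x) ∂gaussianReal 0 1 := by
    rw [← h1]; congr 1; ext x; congr 1; ring
  rw [this]; ring

/-- The even part of a convex function is monotone in the distance to the centre. -/
lemma convex_symm_le {u : ℝ → ℝ} (hu : ConvexOn ℝ Set.univ u) (y : ℝ) {s t : ℝ} (h : |s| ≤ t) :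
    u (y + s) + u (y - s) ≤ u (y + t) + u (y - t) := by
  rcases (abs_nonneg s).trans h |>.eq_or_lt with h0 | h0
  · have : s = 0 := abs_eq_zero.mp (le_antisymm (h0 ▸ h) (abs_nonneg s))
    simp [this, ← h0]
  obtain ⟨h1, h2⟩ := abs_le.mp h
  have ha : 0 ≤ (t + s) / (2 * t) := div_nonneg (by linarith) (by linarith)
  have hb : 0 ≤ (t - s) / (2 * t) := div_nonneg (by linarith) (by linarith)
  have hab : (t + s) / (2 * t) + (t - s) / (2 * t) = 1 := by field_simp; ring
  have k1 := hu.2 (Set.mem_univ (y + t)) (Set.mem_univ (y - t)) ha hb hab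
  have k2 := hu.2 (Set.mem_univ (y + t)) (Set.mem_univ (y - t)) hb ha (by linarith)
  simp only [smul_eq_mul] at k1 k2
  have e1 : (t + s) / (2 * t) * (y + t) + (t - s) / (2 * t) * (y - t) = y + s := by
    field_simp; ring
  have e2 : (t - s) / (2 * t) * (y + t) + (t + s) / (2 * t) * (y - t) = y - s := by
    field_simp; ring
  rw [e1] at k1; rw [e2] at k2
  have e3 : (t - s) / (2 * t) = 1 - (t + s) / (2 * t) := by linarith
  rw [e3] at k1 k2
  linarith

/-- After symmetrization the integrand is the even part of `u` about `y`, which grows with the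
distance from `y`; a larger scale moves every point further out. -/
lemma integral_gaussian_mono {u : ℝ → ℝ} (hu : ConvexOn ℝ Set.univ u) (hl : LipschitzWith 1 u)
    (y : ℝ) {a b : ℝ} (ha : 0 ≤ a) (hab : a ≤ b) :
    ∫ x, u (y + a * x) ∂gaussianReal 0 1 ≤ ∫ x, u (y + b * x) ∂gaussianReal 0 1 := by
  rw [integral_gaussian_symm hl, integral_gaussian_symm hl]
  have hi : ∀ c, Integrable (fun x => (u (y + c * x) + u (y - c * x)) / 2) (gaussianReal 0 1) :=
    fun c => ((integrable_lipschitz_gaussian hl y c).add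
      (by simpa [sub_eq_add_neg] using integrable_lipschitz_gaussian hl y (-c))).div_const 2
  refine integral_mono (hi a) (hi b) fun x => ?_
  have h : |a * x| ≤ |b * x| := by
    rw [abs_mul, abs_mul, abs_of_nonneg ha, abs_of_nonneg (ha.trans hab)]
    exact mul_le_mul_of_nonneg_right hab (abs_nonneg x)
  have := convex_symm_le hu y h
  have e : u (y + |b * x|) + u (y - |b * x|) = u (y + b * x) + u (y - b * x) := by
    rcases abs_choice (b * x) with h | h <;> rw [h]
    simp only [sub_neg_eq_add, ← sub_eq_add_neg]; ring
  dsimp only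
  linarith

lemma le_integral_gaussian {u : ℝ → ℝ} (hu : ConvexOn ℝ Set.univ u) (hl : LipschitzWith 1 u)
    (y : ℝ) {b : ℝ} (hb : 0 ≤ b) : u y ≤ ∫ x, u (y + b * x) ∂gaussianReal 0 1 := by
  simpa using integral_gaussian_mono hu hl y le_rfl hb

/-- Independent Gaussians convolve to a Gaussian with the variances added. This merges the noise of
successive urn draws into one variable. -/
lemma integral_gaussian_add {u : ℝ → ℝ} (hl : LipschitzWith 1 u) (y a b : ℝ) :
    ∫ x', ∫ x, u (y + a * x + b * x') ∂gaussianReal 0 1 ∂gaussianReal 0 1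
      = ∫ x, u (y + Real.sqrt (a ^ 2 + b ^ 2) * x) ∂gaussianReal 0 1 := by
  have hmap : ∀ c : ℝ, (gaussianReal 0 1).map (fun x => c * x) = gaussianReal 0 (NNReal.mk (c ^ 2) (sq_nonneg c)) := by
    intro c; simpa using gaussianReal_map_const_mul (μ := 0) (v := 1) c
  have hconv : ((gaussianReal 0 1).map (fun x => b * x)) ∗ ((gaussianReal 0 1).map (fun x => a * x))
      = (gaussianReal 0 1).map (fun x => Real.sqrt (a ^ 2 + b ^ 2) * x) := by
    rw [hmap, hmap, hmap, gaussianReal_conv_gaussianReal]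
    congr 1
    · simp
    · apply NNReal.eq
      simp only [NNReal.coe_add, NNReal.coe_mk]
      rw [Real.sq_sqrt (by positivity)]; ring
  have hcu : ∀ c : ℝ, Continuous fun x => u (y + c * x) := fun c => hl.continuous.comp (by fun_prop)
  have huy : Continuous fun x => u (y + x) := hl.continuous.comp (by fun_prop)
  have e1 : ∫ x, u (y + Real.sqrt (a ^ 2 + b ^ 2) * x) ∂gaussianReal 0 1
      = ∫ x, u (y + x) ∂((gaussianReal 0 1).map (fun x => Real.sqrt (a ^ 2 + b ^ 2) * x)) := by
    rw [integral_map (by fun_prop) huy.aestronglyMeasurable]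
  have hint : Integrable (fun x => u (y + x))
      ((gaussianReal 0 1).map (fun x => Real.sqrt (a ^ 2 + b ^ 2) * x)) := by
    rw [integrable_map_measure huy.aestronglyMeasurable (by fun_prop)]
    exact integrable_lipschitz_gaussian hl y _
  rw [e1, ← hconv, integral_conv (by rw [hconv]; exact hint)]
  rw [integral_map (by fun_prop)]
  · congr 1; ext x'
    rw [integral_map (by fun_prop)]
    · congr 1; ext x; congr 1; ring
    · exact (hl.continuous.comp (by fun_prop)).aestronglyMeasurable
  · refine StronglyMeasurable.aestronglyMeasurable ?_
    refine StronglyMeasurable.integral_prod_right (f := fun x y' : ℝ => u (y + (x + y'))) ?_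
    exact (hl.continuous.comp (by fun_prop : Continuous fun p : ℝ × ℝ => y + (p.1 + p.2))).stronglyMeasurable

lemma integral_abs_gaussian : ∫ x, |x| ∂gaussianReal 0 1 = 2 / Real.sqrt (2 * Real.pi) := by
  rw [integral_gaussianReal_eq_integral_smul (by norm_num)]
  have h : ∀ x : ℝ, gaussianPDFReal 0 1 x • |x|
      = (fun y : ℝ => (Real.sqrt (2 * Real.pi))⁻¹ * (y ^ (1 : ℝ) * Real.exp (-(1 / 2) * y ^ (2 : ℝ)))) |x| := by
    intro x
    simp only [gaussianPDFReal, smul_eq_mul, Real.rpow_one, NNReal.coe_one, Real.rpow_two, sq_abs]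
    rw [sub_zero, mul_one, mul_one, show -x ^ 2 / 2 = -(1 / 2) * x ^ 2 by ring]; ring
  simp_rw [h]
  rw [integral_comp_abs (f := fun y : ℝ =>
    (Real.sqrt (2 * Real.pi))⁻¹ * (y ^ (1 : ℝ) * Real.exp (-(1 / 2) * y ^ (2 : ℝ)))),
    integral_const_mul, integral_rpow_mul_exp_neg_mul_rpow (by norm_num) (by norm_num) (by norm_num)]
  norm_num
  field_simp

/-- Calibrates the factor `√3`: since `E|Z| = √(2/π)`, any factor at least `√(π/2)` would do. -/
lemma one_le_sqrt_three_mul_abs_gaussian : 1 ≤ Real.sqrt 3 * ∫ x, |x| ∂gaussianReal 0 1 := by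
  rw [integral_abs_gaussian]
  have hp : 0 < Real.sqrt (2 * Real.pi) := Real.sqrt_pos.mpr (by positivity)
  rw [← mul_div_assoc, le_div_iff₀ hp, one_mul]
  apply Real.sqrt_le_iff.mpr ⟨by positivity, ?_⟩
  rw [mul_pow, Real.sq_sqrt (by norm_num)]
  linarith [Real.pi_le_four]

/-- A symmetric two-point variable is dominated by a Gaussian variable. -/
lemma two_point_le_gaussian {w : ℝ → ℝ} (hw : ConvexOn ℝ Set.univ w) (hl : LipschitzWith 1 w)
    (y : ℝ) {d : ℝ} (hd : 0 ≤ d) :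
    (w (y + d) + w (y - d)) / 2 ≤ ∫ x, w (y + Real.sqrt 3 * d * x) ∂gaussianReal 0 1 := by
  set τ := Real.sqrt 3 * d with hτ
  have hτ0 : 0 ≤ τ := by positivity
  rw [integral_gaussian_symm hl]
  set g : ℝ → ℝ := fun r => (w (y + τ * r) + w (y - τ * r)) / 2 with hg
  have hgc : ConvexOn ℝ Set.univ g := by
    refine ⟨convex_univ, fun a _ b _ s t hs ht hst => ?_⟩
    have k1 := hw.2 (Set.mem_univ (y + τ * a)) (Set.mem_univ (y + τ * b)) hs ht hst
    have k2 := hw.2 (Set.mem_univ (y - τ * a)) (Set.mem_univ (y - τ * b)) hs ht hst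
    simp only [smul_eq_mul] at k1 k2 ⊢
    have e1 : s * (y + τ * a) + t * (y + τ * b) = y + τ * (s * a + t * b) := by
      linear_combination y * hst
    have e2 : s * (y - τ * a) + t * (y - τ * b) = y - τ * (s * a + t * b) := by
      linear_combination y * hst
    rw [e1] at k1; rw [e2] at k2
    simp only [hg]; linarith
  have hgcont : Continuous g := by
    have := hl.continuous
    simp only [hg]; fun_prop
  have hgi : ∀ x : ℝ, g |x| = g x := by
    intro x; rcases abs_choice x with h | h <;> rw [h]
    simp only [hg, mul_neg, sub_neg_eq_add, ← sub_eq_add_neg]; ring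
  have hint : Integrable g (gaussianReal 0 1) :=
    ((integrable_lipschitz_gaussian hl y τ).add
      (by simpa [sub_eq_add_neg] using integrable_lipschitz_gaussian hl y (-τ))).div_const 2
  -- Jensen for the even part: replacing `|Z|` by its mean leaves two points at distance `τ E|Z| ≥
  -- d` from the centre.
  have hJ : g (∫ x, |x| ∂gaussianReal 0 1) ≤ ∫ x, g |x| ∂gaussianReal 0 1 :=
    hgc.map_integral_le hgcont.continuousOn isClosed_univ (Filter.Eventually.of_forall fun _ => Set.mem_univ _)
      integrable_id_gaussian.abs (by simpa only [Function.comp_def, hgi] using hint)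
  simp_rw [hgi] at hJ
  refine le_trans ?_ hJ
  have h1 : |d| ≤ τ * ∫ x, |x| ∂gaussianReal 0 1 := by
    rw [abs_of_nonneg hd, hτ]
    have := mul_le_mul_of_nonneg_left one_le_sqrt_three_mul_abs_gaussian hd
    linarith
  have := convex_symm_le hw y h1
  simp only [hg]; linarith

/-- A finitely supported centred variable of range at most `d` is dominated by `N(0, 3d²)`. -/
lemma sum_le_gaussian {ι : Type*} [Fintype ι] {w : ℝ → ℝ} (hw : ConvexOn ℝ Set.univ w)
    (hl : LipschitzWith 1 w) (q e : ι → ℝ) (hq : ∀ i, 0 ≤ q i) (hq1 : ∑ i, q i = 1)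
    (he : ∑ i, q i * e i = 0) {d : ℝ} (hd : ∀ i j, |e i - e j| ≤ d) (y : ℝ) :
    ∑ i, q i * w (y + e i) ≤ ∫ x, w (y + Real.sqrt 3 * d * x) ∂gaussianReal 0 1 := by
  have hne : Nonempty ι := by
    by_contra h
    rw [not_nonempty_iff] at h
    simp at hq1
  have hd0 : 0 ≤ d := (abs_nonneg _).trans (hd hne.some hne.some)
  refine le_trans ?_ (two_point_le_gaussian hw hl y hd0)
  -- Jensen over an independent copy `e j`, whose mean is zero. The difference `e i - e j` has a
  -- symmetric law, which makes the even part of `w` available.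
  have step1 : ∀ i, w (y + e i) ≤ ∑ j, q j * w (y + (e i - e j)) := by
    intro i
    have := hw.map_sum_le (t := Finset.univ) (w := q) (p := fun j => y + (e i - e j))
      (fun j _ => hq j) hq1 (fun _ _ => Set.mem_univ _)
    simp only [smul_eq_mul] at this
    refine le_trans (le_of_eq ?_) this
    congr 1
    simp only [mul_add, mul_sub, Finset.sum_add_distrib, Finset.sum_sub_distrib, ← Finset.sum_mul,
      hq1, he]
    ring
  have step2 : ∑ i, q i * w (y + e i) ≤ ∑ i, ∑ j, q i * q j * w (y + (e i - e j)) := by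
    refine Finset.sum_le_sum fun i _ => ?_
    simp only [mul_assoc, ← Finset.mul_sum]
    exact mul_le_mul_of_nonneg_left (step1 i) (hq i)
  have step3 : ∑ i, ∑ j, q i * q j * w (y + (e i - e j))
      = ∑ i, ∑ j, q i * q j * ((w (y + (e i - e j)) + w (y - (e i - e j))) / 2) := by
    have : ∑ i, ∑ j, q i * q j * w (y + (e i - e j))
        = ∑ i, ∑ j, q i * q j * w (y - (e i - e j)) := by
      rw [Finset.sum_comm]
      refine Finset.sum_congr rfl fun i _ => Finset.sum_congr rfl fun j _ => ?_
      rw [mul_comm (q j)]; congr 2; ring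
    have h2 : ∑ i, ∑ j, q i * q j * ((w (y + (e i - e j)) + w (y - (e i - e j))) / 2)
        = (∑ i, ∑ j, q i * q j * w (y + (e i - e j))
          + ∑ i, ∑ j, q i * q j * w (y - (e i - e j))) / 2 := by
      simp only [← Finset.sum_add_distrib, Finset.sum_div]
      refine Finset.sum_congr rfl fun i _ => Finset.sum_congr rfl fun j _ => ?_
      ring
    rw [h2, ← this]; ring
  -- By symmetry each difference may be pushed out to the extreme points `±d`.
  have step4 : ∑ i, ∑ j, q i * q j * ((w (y + (e i - e j)) + w (y - (e i - e j))) / 2)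
      ≤ ∑ i, ∑ j, q i * q j * ((w (y + d) + w (y - d)) / 2) := by
    refine Finset.sum_le_sum fun i _ => Finset.sum_le_sum fun j _ => ?_
    refine mul_le_mul_of_nonneg_left ?_ (mul_nonneg (hq i) (hq j))
    have := convex_symm_le hw y (hd i j)
    linarith
  calc _ ≤ _ := step2
    _ = _ := step3
    _ ≤ _ := step4
    _ = _ := by
      simp only [← Finset.sum_mul, ← Finset.mul_sum, hq1]; ring

lemma convexOn_integral_gaussian {u : ℝ → ℝ} (hu : ConvexOn ℝ Set.univ u) (hl : LipschitzWith 1 u)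
    (a : ℝ) : ConvexOn ℝ Set.univ fun y => ∫ x, u (y + a * x) ∂gaussianReal 0 1 := by
  refine ⟨convex_univ, fun y _ y' _ s t hs ht hst => ?_⟩
  simp only [smul_eq_mul]
  rw [← integral_const_mul, ← integral_const_mul, ← integral_add
    ((integrable_lipschitz_gaussian hl y a).const_mul s)
    ((integrable_lipschitz_gaussian hl y' a).const_mul t)]
  refine integral_mono (integrable_lipschitz_gaussian hl _ a)
    (((integrable_lipschitz_gaussian hl y a).const_mul s).add
    ((integrable_lipschitz_gaussian hl y' a).const_mul t)) fun x => ?_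
  have := hu.2 (Set.mem_univ (y + a * x)) (Set.mem_univ (y' + a * x)) hs ht hst
  simp only [smul_eq_mul] at this
  refine le_trans (le_of_eq ?_) this
  congr 1
  linear_combination (-a * x) * hst

lemma lipschitz_integral_gaussian {u : ℝ → ℝ} (hl : LipschitzWith 1 u)
    (a : ℝ) : LipschitzWith 1 fun y => ∫ x, u (y + a * x) ∂gaussianReal 0 1 := by
  refine LipschitzWith.of_dist_le_mul fun y y' => ?_
  rw [Real.dist_eq, ← integral_sub (integrable_lipschitz_gaussian hl y a)
    (integrable_lipschitz_gaussian hl y' a)]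
  have hb := norm_integral_le_of_norm_le_const (μ := gaussianReal 0 1) (C := dist y y')
    (f := fun x => u (y + a * x) - u (y' + a * x)) (Filter.Eventually.of_forall fun x => ?_)
  · simpa using hb
  have := lipschitz_abs_le hl (y + a * x) (y' + a * x)
  simpa [Real.dist_eq] using this

/-! ### The excess of a Gaussian maximum over a threshold -/

lemma integrable_excess_gaussian (T : ℝ) :
    Integrable (fun x : ℝ => max (|x| - T) 0) (gaussianReal 0 1) :=
  (integrable_id_gaussian.abs.sub (integrable_const T)).sup (integrable_const 0)

/-- Exponential tilting at rate `T`: for `T ≥ 1` the excess is at most `e^(T(|x| - T) - 1)`, and the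
moment generating function turns this into `(2/e) e^(-T²/2)`. -/
lemma integral_excess_gaussian_le {T : ℝ} (hT : 1 ≤ T) :
    ∫ x, max (|x| - T) 0 ∂gaussianReal 0 1 ≤ Real.exp (-T ^ 2 / 2) := by
  have hm : ∀ t : ℝ, ∫ x, Real.exp (t * x) ∂gaussianReal 0 1 = Real.exp (t ^ 2 / 2) := by
    intro t
    have := congrFun (mgf_fun_id_gaussianReal (μ := 0) (v := 1)) t
    simpa [mgf] using this
  have hi : ∀ t : ℝ, Integrable (fun x => Real.exp (t * x)) (gaussianReal 0 1) :=
    fun t => integrable_exp_mul_gaussianReal t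
  have hpt : ∀ x : ℝ, max (|x| - T) 0
      ≤ Real.exp (-T ^ 2 - 1) * (Real.exp (T * x) + Real.exp (-T * x)) := by
    intro x
    have h1 : |x| - T ≤ Real.exp (T * (|x| - T) - 1) := by
      rcases le_or_gt (|x| - T) 0 with h | h
      · exact h.trans (Real.exp_pos _).le
      · have := Real.add_one_le_exp (T * (|x| - T) - 1)
        nlinarith
    have h2 : Real.exp (T * (|x| - T) - 1) = Real.exp (-T ^ 2 - 1) * Real.exp (T * |x|) := by
      rw [← Real.exp_add]; congr 1; ring
    have h3 : Real.exp (T * |x|) ≤ Real.exp (T * x) + Real.exp (-T * x) := by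
      rcases abs_choice x with h | h <;> rw [h]
      · linarith [Real.exp_pos (-T * x)]
      · rw [mul_neg, neg_mul]; linarith [Real.exp_pos (T * x)]
    refine max_le ?_ (by positivity)
    rw [h2] at h1
    exact h1.trans (mul_le_mul_of_nonneg_left h3 (Real.exp_pos _).le)
  refine (integral_mono (integrable_excess_gaussian T)
    (((hi T).add (hi (-T))).const_mul _) hpt).trans ?_
  have : ∫ x, Real.exp (-T ^ 2 - 1) * (Real.exp (T * x) + Real.exp (-T * x)) ∂gaussianReal 0 1
      = Real.exp (-T ^ 2 - 1) * (2 * Real.exp (T ^ 2 / 2)) := by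
    rw [integral_const_mul, integral_add (hi T) (hi (-T)), hm, hm]; ring_nf
  refine this.le.trans ?_
  have e : Real.exp (-T ^ 2 - 1) * (2 * Real.exp (T ^ 2 / 2))
      = (2 * Real.exp (-1)) * Real.exp (-T ^ 2 / 2) := by
    rw [mul_left_comm, ← Real.exp_add, mul_assoc, ← Real.exp_add]; congr 2; ring
  rw [e]
  refine mul_le_of_le_one_left (Real.exp_pos _).le ?_
  have h2 : (2 : ℝ) ≤ Real.exp 1 := by linarith [Real.add_one_le_exp (1 : ℝ)]
  rw [Real.exp_neg, ← div_eq_mul_inv, div_le_one (Real.exp_pos 1)]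
  exact h2

lemma norm_excess_le {ι : Type*} [Fintype ι] {T : ℝ} (z : ι → ℝ) (hT : 0 ≤ T) :
    max (‖z‖ - T) 0 ≤ ∑ i, max (|z i| - T) 0 := by
  have hs : 0 ≤ ∑ i, max (|z i| - T) 0 := Finset.sum_nonneg fun i _ => le_max_right _ _
  refine max_le ?_ hs
  rw [sub_le_iff_le_add]
  refine (pi_norm_le_iff_of_nonneg (by linarith)).mpr fun i => ?_
  have h1 := Finset.single_le_sum (f := fun i => max (|z i| - T) 0)
    (fun i _ => le_max_right _ _) (Finset.mem_univ i)
  have h2 := le_max_left (|z i| - T) 0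
  simp only [Real.norm_eq_abs] at *
  linarith

lemma integrable_eval_gaussian {ι : Type*} [Fintype ι] (i : ι) {f : ℝ → ℝ}
    (hf : Integrable f (gaussianReal 0 1)) :
    Integrable (fun z : ι → ℝ => f (z i)) (Measure.pi fun _ : ι => gaussianReal 0 1) :=
  (measurePreserving_eval (fun _ : ι => gaussianReal 0 1) i).integrable_comp_of_integrable hf

/-- A union bound: the excess of the maximum is at most the sum of the excesses of the coordinates.
-/
lemma integral_norm_excess_le {ι : Type*} [Fintype ι] {T : ℝ} (hT : 1 ≤ T) :
    Integrable (fun z : ι → ℝ => max (‖z‖ - T) 0) (Measure.pi fun _ : ι => gaussianReal 0 1) ∧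
    ∫ z : ι → ℝ, max (‖z‖ - T) 0 ∂(Measure.pi fun _ : ι => gaussianReal 0 1)
      ≤ Fintype.card ι * Real.exp (-T ^ 2 / 2) := by
  have hi : ∀ i : ι, Integrable (fun z : ι → ℝ => max (|z i| - T) 0)
      (Measure.pi fun _ : ι => gaussianReal 0 1) := fun i =>
    integrable_eval_gaussian i (integrable_excess_gaussian T)
  have hI := integrable_finsetSum Finset.univ fun i _ => hi i
  have hInt : Integrable (fun z : ι → ℝ => max (‖z‖ - T) 0)
      (Measure.pi fun _ : ι => gaussianReal 0 1) := by
    refine hI.mono' ?_ (Filter.Eventually.of_forall fun z => ?_)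
    · exact Continuous.aestronglyMeasurable (by fun_prop)
    · rw [Real.norm_of_nonneg (le_max_right _ _)]
      exact norm_excess_le z (by linarith)
  refine ⟨hInt, (integral_mono hInt hI fun z => norm_excess_le z (by linarith)).trans ?_⟩
  rw [integral_finsetSum _ fun i _ => hi i]
  have : ∀ i : ι, ∫ z : ι → ℝ, max (|z i| - T) 0 ∂(Measure.pi fun _ : ι => gaussianReal 0 1)
      ≤ Real.exp (-T ^ 2 / 2) := by
    intro i
    have hmp := measurePreserving_eval (fun _ : ι => gaussianReal 0 1) i
    have h := integral_map (μ := Measure.pi fun _ : ι => gaussianReal 0 1)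
      hmp.measurable.aemeasurable (f := fun x : ℝ => max (|x| - T) 0)
      (Continuous.aestronglyMeasurable (by fun_prop))
    rw [hmp.map_eq] at h
    exact h ▸ integral_excess_gaussian_le hT
  calc _ ≤ ∑ _i : ι, Real.exp (-T ^ 2 / 2) := Finset.sum_le_sum fun i _ => this i
    _ = _ := by simp

/-! ### Densities of product measures -/

open scoped ENNReal

/-- Densities multiply over independent coordinates, which is checked on boxes. The constants `c i`
carry the normalization, so that each reweighted factor can be named as a multiple of a probability
measure. -/
lemma pi_withDensity {ι E : Type*} [Fintype ι] [MeasurableSpace E] (μ ν : ι → Measure E)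
    [∀ i, IsProbabilityMeasure (μ i)] [∀ i, IsProbabilityMeasure (ν i)] (w : ι → E → ℝ≥0∞)
    (hw : ∀ i, Measurable (w i)) (c : ι → ℝ≥0∞) (hc : ∀ i, c i ≠ ∞)
    (h : ∀ i, (μ i).withDensity (w i) = c i • ν i) :
    (Measure.pi μ).withDensity (fun x => ∏ i, w i (x i)) = (∏ i, c i) • Measure.pi ν := by
  have hf : ∀ i, IsFiniteMeasure (c i • ν i) := fun i => Measure.smul_finite _ (hc i)
  have h1 : Measure.pi (fun i => c i • ν i) = (∏ i, c i) • Measure.pi ν := by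
    refine Measure.pi_eq fun s _ => ?_
    simp [Measure.pi_pi, Finset.prod_mul_distrib]
  rw [← h1]
  refine (Measure.pi_eq fun s hs => ?_).symm
  rw [withDensity_apply _ (MeasurableSet.univ_pi hs), ← lintegral_indicator (MeasurableSet.univ_pi hs)]
  have h2 : ∀ x : ι → E, (Set.univ.pi s).indicator (fun x => ∏ i, w i (x i)) x
      = ∏ i, (s i).indicator (w i) (x i) := by
    intro x
    by_cases hx : x ∈ Set.univ.pi s
    · rw [Set.indicator_of_mem hx]
      exact Finset.prod_congr rfl fun i _ => (Set.indicator_of_mem (hx i trivial) _).symm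
    · rw [Set.indicator_of_notMem hx]
      simp only [Set.mem_univ_pi, not_forall] at hx
      obtain ⟨i, hi⟩ := hx
      exact (Finset.prod_eq_zero (Finset.mem_univ i) (Set.indicator_of_notMem hi _)).symm
  simp_rw [h2]
  have hmeas : ∀ i, Measurable ((s i).indicator (w i)) := fun i => (hw i).indicator (hs i)
  have hind := iIndepFun_pi (μ := μ) (X := fun i => (s i).indicator (w i))
    (fun i => (hmeas i).aemeasurable)
  rw [lintegral_prod_eq_prod_lintegral_of_indepFun Finset.univ
    (fun i (x : ι → E) => (s i).indicator (w i) (x i)) hind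
    (fun i => (hmeas i).comp (measurable_pi_apply i))]
  refine Finset.prod_congr rfl fun i _ => ?_
  rw [← h i, withDensity_apply _ (hs i), ← lintegral_indicator (hs i)]
  exact (measurePreserving_eval μ i).lintegral_comp (hmeas i)

lemma pi_withDensity_eval {ι E : Type*} [Fintype ι] [DecidableEq ι] [MeasurableSpace E]
    (μ : ι → Measure E) [∀ i, IsProbabilityMeasure (μ i)] (i : ι) (ν : Measure E)
    [IsProbabilityMeasure ν] {w : E → ℝ≥0∞} (hw : Measurable w) {c : ℝ≥0∞} (hc : c ≠ ∞)
    (h : (μ i).withDensity w = c • ν) :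
    (Measure.pi μ).withDensity (fun x => w (x i)) = c • Measure.pi (Function.update μ i ν) := by
  have hp : ∀ j, IsProbabilityMeasure (Function.update μ i ν j) := by
    intro j
    by_cases hj : j = i
    · subst hj; simpa
    · rw [Function.update_of_ne hj]; infer_instance
  have := pi_withDensity μ (Function.update μ i ν) (fun j => if j = i then w else fun _ => 1)
    (fun j => by split_ifs; exacts [hw, measurable_const]) (fun j => if j = i then c else 1)
    (fun j => by split_ifs; exacts [hc, ENNReal.one_ne_top]) (fun j => by
      by_cases hj : j = i
      · subst hj; simpa using h
      · simp only [hj, if_false, Function.update_of_ne hj, one_smul]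
        exact withDensity_one)
  simpa [ite_apply] using this

/-! ### Gamma and Dirichlet distributions -/

lemma ae_pos_gammaMeasure (a r : ℝ) : ∀ᵐ x ∂gammaMeasure a r, 0 < x := by
  rw [gammaMeasure, ae_withDensity_iff (by exact (measurable_gammaPDFReal a r).ennreal_ofReal)]
  have h0 : ∀ᵐ x : ℝ, x ≠ 0 := by simp [ae_iff]
  filter_upwards [h0] with x hx h
  by_contra hx'
  exact h (gammaPDF_of_neg (lt_of_le_of_ne (not_lt.mp hx') hx))

lemma measurable_gammaPDF (a r : ℝ) : Measurable (gammaPDF a r) :=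
  (measurable_gammaPDFReal a r).ennreal_ofReal

/-- The extra factor `x` raises the power by one, and `Γ(a + 1) = a Γ(a)` gives the constant. -/
lemma gammaMeasure_withDensity_id {a : ℝ} (ha : 0 < a) :
    (gammaMeasure a 1).withDensity (fun x => ENNReal.ofReal x)
      = ENNReal.ofReal a • gammaMeasure (a + 1) 1 := by
  rw [gammaMeasure, gammaMeasure, ← withDensity_mul _ (measurable_gammaPDF _ _)
    ENNReal.measurable_ofReal, ← withDensity_smul _ (measurable_gammaPDF _ _)]
  congr 1
  ext x
  simp only [Pi.mul_apply, Pi.smul_apply, smul_eq_mul, gammaPDF, gammaPDFReal]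
  split_ifs with hx
  · rw [← ENNReal.ofReal_mul (by positivity), ← ENNReal.ofReal_mul ha.le]
    congr 1
    rw [Real.Gamma_add_one ha.ne']
    rcases hx.eq_or_lt with rfl | hx
    · simp [Real.zero_rpow ha.ne']
    · have : x ^ (a + 1 - 1) = x ^ (a - 1) * x := by
        rw [← Real.rpow_add_one hx.ne']; congr 1; ring
      rw [this]
      have := (Real.Gamma_pos_of_pos ha).ne'
      simp only [Real.one_rpow]
      field_simp
  · simp

/-- Tilting changes the rate from `1` to `1 + t`, which is a mere rescaling. Proportions ignore a
common scale, and this is how they are seen to be independent of the sum. -/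
lemma gammaMeasure_withDensity_exp {a : ℝ} (ha : 0 < a) {t : ℝ} (ht : 0 ≤ t) :
    (gammaMeasure a 1).withDensity (fun x => ENNReal.ofReal (Real.exp (-t * x)))
      = ENNReal.ofReal ((1 + t) ^ (-a)) • (gammaMeasure a 1).map (fun x => (1 + t)⁻¹ * x) := by
  have hc : 0 < 1 + t := by linarith
  have hmeas : Measurable fun x : ℝ => (1 + t)⁻¹ * x := by fun_prop
  ext s hs
  rw [withDensity_apply _ hs, Measure.smul_apply, Measure.map_apply hmeas hs, gammaMeasure,
    setLIntegral_withDensity_eq_setLIntegral_mul _ (measurable_gammaPDF _ _) (by fun_prop) hs,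
    withDensity_apply _ (hmeas hs), ← lintegral_indicator hs, ← lintegral_indicator (hmeas hs)]
  conv_rhs => rw [← Real.smul_map_volume_mul_left (a := 1 + t) hc.ne']
  rw [lintegral_smul_measure, lintegral_map ((measurable_gammaPDF _ _).indicator (hmeas hs))
    (by fun_prop), smul_eq_mul, smul_eq_mul, ← lintegral_const_mul _ (by
      exact (((measurable_gammaPDF _ _).indicator (hmeas hs)).comp (by fun_prop))),
    ← lintegral_const_mul _ (by
      exact (((measurable_gammaPDF _ _).indicator (hmeas hs)).comp (by fun_prop)).const_mul _)]
  congr 1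
  ext x
  have hmem : (1 + t) * x ∈ (fun x => (1 + t)⁻¹ * x) ⁻¹' s ↔ x ∈ s := by
    simp [← mul_assoc, inv_mul_cancel₀ hc.ne']
  by_cases hx : x ∈ s
  · rw [Set.indicator_of_mem hx, Set.indicator_of_mem (hmem.mpr hx)]
    simp only [Pi.mul_apply, gammaPDF, gammaPDFReal]
    rw [← ENNReal.ofReal_mul (abs_nonneg (1 + t)), ← ENNReal.ofReal_mul (Real.rpow_nonneg hc.le _),
      ← ENNReal.ofReal_mul' (Real.exp_pos _).le, abs_of_pos hc]
    congr 1
    rcases lt_or_ge x 0 with hx0 | hx0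
    · rw [if_neg (not_le.mpr hx0), if_neg (not_le.mpr (mul_neg_of_pos_of_neg hc hx0))]; simp
    · rw [if_pos hx0, if_pos (by positivity), Real.mul_rpow hc.le hx0]
      have h1 : Real.exp (-(1 * ((1 + t) * x))) = Real.exp (-(1 * x)) * Real.exp (-t * x) := by
        rw [← Real.exp_add]; congr 1; ring
      have h2 : (1 + t) ^ (-a) * ((1 + t) * (1 + t) ^ (a - 1)) = 1 := by
        rw [← Real.rpow_one_add' hc.le (by linarith), ← Real.rpow_add hc]
        simp
      rw [h1]
      linear_combination (-(1 ^ a / Real.Gamma a * x ^ (a - 1) * (Real.exp (-(1 * x))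
        * Real.exp (-t * x)))) * h2
  · rw [Set.indicator_of_notMem hx, Set.indicator_of_notMem (fun h => hx (hmem.mp h))]; simp

section Dirichlet

variable {ι : Type*} [Fintype ι] [Nonempty ι]

lemma div_sum_mem_stdSimplex {g : ι → ℝ} (h : ∀ i, 0 < g i) :
    (fun i => g i / ∑ j, g j) ∈ stdSimplex ℝ ι :=
  ⟨fun i => div_nonneg (h i).le (Finset.sum_nonneg fun j _ => (h j).le),
    by rw [← Finset.sum_div, div_self (Finset.sum_pos (fun j _ => h j) Finset.univ_nonempty).ne']⟩

/-- The vector of proportions of a positive vector. -/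
def proportions (g : ι → ℝ) : stdSimplex ℝ ι :=
  open Classical in
  if h : ∀ i, 0 < g i then ⟨fun i => g i / ∑ j, g j, div_sum_mem_stdSimplex h⟩
  else Classical.arbitrary _

omit [Fintype ι] [Nonempty ι] in
lemma measurableSet_pos [Countable ι] : MeasurableSet {g : ι → ℝ | ∀ i, 0 < g i} := by
  rw [Set.ofPred_forall]
  exact MeasurableSet.iInter fun i => measurableSet_lt measurable_const (measurable_pi_apply i)

lemma proportions_coe {g : ι → ℝ} (h : ∀ i, 0 < g i) (i : ι) :
    proportions g i = g i / ∑ j, g j := by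
  rw [proportions, dif_pos h]; rfl

lemma measurable_proportions : Measurable (proportions (ι := ι)) := by
  classical
  refine Measurable.dite (f := fun g : {g : ι → ℝ | ∀ i, 0 < g i} =>
    (⟨fun i => g.1 i / ∑ j, g.1 j, div_sum_mem_stdSimplex g.2⟩ : stdSimplex ℝ ι))
    (g := fun _ => Classical.arbitrary _) ?_ measurable_const measurableSet_pos
  refine Measurable.subtype_mk ?_
  refine measurable_pi_lambda _ fun i => ?_
  exact Measurable.div ((measurable_pi_apply i).comp measurable_subtype_coe)
    (Finset.measurable_sum _ fun j _ => (measurable_pi_apply j).comp measurable_subtype_coe)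

lemma proportions_mul {c : ℝ} (hc : 0 < c) (g : ι → ℝ) :
    proportions (fun i => c * g i) = proportions g := by
  have h : (∀ i, 0 < c * g i) ↔ ∀ i, 0 < g i := by simp [hc]
  by_cases hg : ∀ i, 0 < g i
  · ext i
    rw [proportions_coe hg, proportions_coe (h.mpr hg), ← Finset.mul_sum, mul_div_mul_left _ _ hc.ne']
  · rw [proportions, proportions, dif_neg hg, dif_neg (fun h' => hg (h.mp h'))]

/-- The law of independent Gamma variables. -/
abbrev gammas (α : ι → ℝ) : Measure (ι → ℝ) := Measure.pi fun i => gammaMeasure (α i) 1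

omit [Nonempty ι] in
lemma isProbabilityMeasure_gammas {α : ι → ℝ} (hα : ∀ i, 0 < α i) :
    IsProbabilityMeasure (gammas α) := by
  have := fun i => isProbabilityMeasure_gammaMeasure (hα i) one_pos
  infer_instance

omit [Nonempty ι] in
lemma ae_pos_gammas {α : ι → ℝ} (hα : ∀ i, 0 < α i) : ∀ᵐ g ∂gammas α, ∀ i, 0 < g i := by
  have := fun i => isProbabilityMeasure_gammaMeasure (hα i) one_pos
  rw [ae_all_iff]
  intro i
  exact (measurePreserving_eval (fun i => gammaMeasure (α i) 1) i).quasiMeasurePreserving.ae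
    (ae_pos_gammaMeasure (α i) 1)

lemma dirichlet_eq_map {α : ι → ℝ} (hα : ∀ i, 0 < α i) :
    dirichlet α = (gammas α).map proportions := by
  have hemb : MeasurableEmbedding (fun p : stdSimplex ℝ ι => (p : ι → ℝ)) :=
    MeasurableEmbedding.subtype_coe (isClosed_stdSimplex (𝕜 := ℝ) (ι := ι)).measurableSet
  have hm : Measurable fun g : ι → ℝ => fun i => g i / ∑ j, g j := by
    refine measurable_pi_lambda _ fun i => ?_
    exact (measurable_pi_apply i).div (Finset.measurable_sum _ fun j _ => measurable_pi_apply j)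
  ext s hs
  rw [dirichlet, hemb.comap_apply, Measure.map_apply hm (hemb.measurableSet_image.mpr hs),
    Measure.map_apply measurable_proportions hs]
  refine measure_congr ?_
  filter_upwards [ae_pos_gammas hα] with g hg
  have e : (fun i => g i / ∑ j, g j) = (proportions g : ι → ℝ) := by
    ext i; exact (proportions_coe hg i).symm
  apply propext
  change (fun i => g i / ∑ j, g j) ∈ _ ↔ proportions g ∈ s
  rw [e]
  exact Subtype.val_injective.mem_set_image

lemma isProbabilityMeasure_dirichlet {α : ι → ℝ} (hα : ∀ i, 0 < α i) :
    IsProbabilityMeasure (dirichlet α) := by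
  have := isProbabilityMeasure_gammas hα
  rw [dirichlet_eq_map hα]
  exact Measure.isProbabilityMeasure_map measurable_proportions.aemeasurable

omit [Nonempty ι] in
lemma gammas_withDensity_exp {α : ι → ℝ} (hα : ∀ i, 0 < α i) {t : ℝ} (ht : 0 ≤ t) :
    (gammas α).withDensity (fun g => ENNReal.ofReal (Real.exp (-t * ∑ i, g i)))
      = ENNReal.ofReal ((1 + t) ^ (-∑ i, α i)) •
        (gammas α).map (fun g i => (1 + t)⁻¹ * g i) := by
  have := fun i => isProbabilityMeasure_gammaMeasure (hα i) one_pos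
  have hm : Measurable fun x : ℝ => (1 + t)⁻¹ * x := by fun_prop
  have := fun i => Measure.isProbabilityMeasure_map (μ := gammaMeasure (α i) 1) hm.aemeasurable
  have hc : 0 < 1 + t := by linarith
  have h := pi_withDensity (fun i => gammaMeasure (α i) 1)
    (fun i => (gammaMeasure (α i) 1).map (fun x => (1 + t)⁻¹ * x))
    (fun _ x => ENNReal.ofReal (Real.exp (-t * x))) (fun _ => by fun_prop)
    (fun i => ENNReal.ofReal ((1 + t) ^ (-α i))) (fun _ => ENNReal.ofReal_ne_top)
    (fun i => gammaMeasure_withDensity_exp (hα i) ht)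
  rw [← Measure.pi_map_pi (fun i => hm.aemeasurable)] at h
  rw [← ENNReal.ofReal_prod_of_nonneg (fun i _ => by positivity), ← Real.rpow_sum_of_pos hc,
    Finset.sum_neg_distrib] at h
  rw [← h]
  congr 1
  ext g
  rw [← ENNReal.ofReal_prod_of_nonneg (fun i _ => by positivity), ← Real.exp_sum, Finset.mul_sum]

lemma lintegral_exp_neg_mul {s : ℝ} (hs : 0 < s) :
    ∫⁻ t in Set.Ioi (0 : ℝ), ENNReal.ofReal (Real.exp (-t * s)) = ENNReal.ofReal (1 / s) := by
  have h := integral_exp_mul_Ioi (a := -s) (by linarith) 0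
  have hi := integrableOn_exp_mul_Ioi (a := -s) (by linarith) 0
  have e : ∀ t : ℝ, Real.exp (-t * s) = Real.exp (-s * t) := fun t => by congr 1; ring
  simp_rw [e]
  rw [← ofReal_integral_eq_lintegral_ofReal hi
    (Filter.Eventually.of_forall fun t => (Real.exp_pos _).le), h]
  simp [neg_div_neg_eq]

/-- The sum and the proportions of independent Gamma variables are independent: the case of the
reciprocal of the sum, with the constant left implicit. -/
lemma lintegral_inv_sum_gammas {α : ι → ℝ} (hα : ∀ i, 0 < α i) {f : stdSimplex ℝ ι → ℝ≥0∞}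
    (hf : Measurable f) :
    ∫⁻ g, f (proportions g) * ENNReal.ofReal (1 / ∑ i, g i) ∂gammas α
      = (∫⁻ t in Set.Ioi (0 : ℝ), ENNReal.ofReal ((1 + t) ^ (-∑ i, α i)))
        * ∫⁻ p, f p ∂dirichlet α := by
  have hP := isProbabilityMeasure_gammas hα
  have hfp : Measurable fun g : ι → ℝ => f (proportions g) := hf.comp measurable_proportions
  have hS : Measurable fun g : ι → ℝ => ∑ i, g i :=
    Finset.measurable_sum _ fun j _ => measurable_pi_apply j
  -- `1/s = ∫ e^(-t s) dt` over `t > 0`; for each `t` the tilt only rescales the Gamma vector, so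
  -- the integral of `f` over the proportions factors out.
  have h1 : ∫⁻ g, f (proportions g) * ENNReal.ofReal (1 / ∑ i, g i) ∂gammas α
      = ∫⁻ g, (∫⁻ t in Set.Ioi (0 : ℝ),
        f (proportions g) * ENNReal.ofReal (Real.exp (-t * ∑ i, g i))) ∂gammas α := by
    refine lintegral_congr_ae ?_
    filter_upwards [ae_pos_gammas hα] with g hg
    rw [lintegral_const_mul _ (by fun_prop),
      lintegral_exp_neg_mul (Finset.sum_pos (fun j _ => hg j) Finset.univ_nonempty)]
  rw [h1, lintegral_lintegral_swap (f := fun (g : ι → ℝ) (t : ℝ) =>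
    f (proportions g) * ENNReal.ofReal (Real.exp (-t * ∑ i, g i)))]
  · rw [← lintegral_mul_const _ (by fun_prop)]
    refine setLIntegral_congr_fun measurableSet_Ioi fun t ht => ?_
    have ht : 0 < t := ht
    have hc : 0 < (1 + t)⁻¹ := by positivity
    have hd : Measurable fun g : ι → ℝ => ENNReal.ofReal (Real.exp (-t * ∑ i, g i)) := by fun_prop
    have h2 := lintegral_withDensity_eq_lintegral_mul (gammas α) hd hfp
    rw [gammas_withDensity_exp hα ht.le, lintegral_smul_measure, lintegral_map hfp (by fun_prop)] at h2
    simp_rw [proportions_mul hc] at h2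
    rw [dirichlet_eq_map hα, lintegral_map hf measurable_proportions]
    rw [← smul_eq_mul, h2]
    refine lintegral_congr fun g => ?_
    simp [mul_comm]
  · exact (Measurable.mul (hfp.comp measurable_fst) (by fun_prop)).aemeasurable

variable [DecidableEq ι]

omit [Nonempty ι] in
lemma gammas_withDensity_eval {α : ι → ℝ} (hα : ∀ i, 0 < α i) (o : ι) :
    (gammas α).withDensity (fun g => ENNReal.ofReal (g o))
      = ENNReal.ofReal (α o) • gammas (α + Pi.single o 1) := by
  have := fun i => isProbabilityMeasure_gammaMeasure (hα i) one_pos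
  have := isProbabilityMeasure_gammaMeasure (a := α o + 1) (by linarith [hα o]) one_pos
  rw [pi_withDensity_eval (fun i => gammaMeasure (α i) 1) o (gammaMeasure (α o + 1) 1)
    ENNReal.measurable_ofReal ENNReal.ofReal_ne_top (gammaMeasure_withDensity_id (hα o))]
  congr 2
  ext i : 1
  by_cases h : i = o
  · subst h; simp
  · simp [h]

omit [Fintype ι] [Nonempty ι] in
lemma add_single_pos {α : ι → ℝ} (hα : ∀ i, 0 < α i) (o i : ι) :
    0 < (α + Pi.single o 1 : ι → ℝ) i := by
  have h : (0 : ℝ) ≤ (Pi.single o 1 : ι → ℝ) i := by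
    by_cases h : i = o
    · subst h; simp
    · simp [h]
  have := hα i
  simp only [Pi.add_apply]; linarith

omit [Nonempty ι] [DecidableEq ι] in
lemma measurable_coord (o : ι) : Measurable fun p : stdSimplex ℝ ι => p o :=
  (measurable_pi_apply o).comp measurable_subtype_coe

/-- A coordinate is `g o / ∑ g`. Weighting by `g o` raises the shape of that Gamma variable by one,
and the factor `1 / ∑ g` contributes only a constant. -/
lemma lintegral_dirichlet_mul {α : ι → ℝ} (hα : ∀ i, 0 < α i) (o : ι) {f : stdSimplex ℝ ι → ℝ≥0∞}
    (hf : Measurable f) :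
    ∫⁻ p, f p * ENNReal.ofReal (p o) ∂dirichlet α
      = ENNReal.ofReal (α o / ∑ i, α i) * ∫⁻ p, f p ∂dirichlet (α + Pi.single o 1) := by
  -- This constant depends only on the total after the increment, so it is the same for every
  -- coordinate.
  set C := ∫⁻ t in Set.Ioi (0 : ℝ), ENNReal.ofReal ((1 + t) ^ (-(∑ i, α i + 1))) with hC
  have key : ∀ (o : ι) {f : stdSimplex ℝ ι → ℝ≥0∞}, Measurable f →
      ∫⁻ p, f p * ENNReal.ofReal (p o) ∂dirichlet α
        = ENNReal.ofReal (α o) * C * ∫⁻ p, f p ∂dirichlet (α + Pi.single o 1) := by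
    intro o f hf
    have hfp : Measurable fun g : ι → ℝ => f (proportions g) := hf.comp measurable_proportions
    have hS : Measurable fun g : ι → ℝ => ∑ i, g i :=
      Finset.measurable_sum _ fun j _ => measurable_pi_apply j
    have hS' : Measurable fun g : ι → ℝ => ENNReal.ofReal (1 / ∑ i, g i) :=
      (measurable_const.div hS).ennreal_ofReal
    rw [dirichlet_eq_map hα, lintegral_map (f := fun p => f p * ENNReal.ofReal (p o))
      (hf.mul (measurable_coord o).ennreal_ofReal) measurable_proportions]
    have h1 : ∫⁻ g, f (proportions g) * ENNReal.ofReal (proportions g o) ∂gammas α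
        = ∫⁻ g, (f (proportions g) * ENNReal.ofReal (1 / ∑ i, g i))
          ∂(gammas α).withDensity (fun g => ENNReal.ofReal (g o)) := by
      rw [lintegral_withDensity_eq_lintegral_mul _ (f := fun g : ι → ℝ => ENNReal.ofReal (g o)) (by fun_prop)
        (g := fun g => f (proportions g) * ENNReal.ofReal (1 / ∑ i, g i)) (hfp.mul hS')]
      refine lintegral_congr_ae ?_
      filter_upwards [ae_pos_gammas hα] with g hg
      rw [proportions_coe hg, div_eq_mul_one_div, ENNReal.ofReal_mul (hg o).le, Pi.mul_apply]
      ring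
    rw [h1, gammas_withDensity_eval hα, lintegral_smul_measure,
      lintegral_inv_sum_gammas (add_single_pos hα o) hf, smul_eq_mul, mul_assoc]
    congr 3
    simp [Finset.sum_add_distrib]
  have hA : 0 < ∑ i, α i := Finset.sum_pos (fun i _ => hα i) Finset.univ_nonempty
  -- The coordinates sum to one, which determines `C` without evaluating the integral.
  have hone : ENNReal.ofReal (∑ i, α i) * C = 1 := by
    have := isProbabilityMeasure_dirichlet hα
    have := fun o => isProbabilityMeasure_dirichlet (add_single_pos hα o)
    have h : ∑ o, ∫⁻ p, 1 * ENNReal.ofReal (p o) ∂dirichlet α = 1 := by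
      simp only [one_mul]
      rw [← lintegral_finsetSum _ fun o _ => (measurable_coord o).ennreal_ofReal]
      have : ∀ p : stdSimplex ℝ ι, ∑ o, ENNReal.ofReal (p o) = 1 := by
        intro p
        rw [← ENNReal.ofReal_sum_of_nonneg fun i _ => stdSimplex.zero_le p i, stdSimplex.sum_eq_one]
        simp
      simp [this]
    simp_rw [key _ measurable_const] at h
    simp only [lintegral_const, measure_univ, mul_one] at h
    rw [← Finset.sum_mul, ← ENNReal.ofReal_sum_of_nonneg fun i _ => (hα i).le] at h
    exact h
  rw [key o hf]
  congr 1
  rw [ENNReal.ofReal_div_of_pos hA, div_eq_mul_inv, ← ENNReal.eq_inv_of_mul_eq_one_left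
    (a := C) (by rw [mul_comm]; exact hone)]

/-- Conjugacy: weighting a Dirichlet distribution by a coordinate increments that parameter. -/
lemma dirichlet_withDensity {α : ι → ℝ} (hα : ∀ i, 0 < α i) (o : ι) :
    (dirichlet α).withDensity (fun p => ENNReal.ofReal (p o))
      = ENNReal.ofReal (α o / ∑ i, α i) • dirichlet (α + Pi.single o 1) := by
  ext s hs
  rw [withDensity_apply _ hs, Measure.smul_apply, smul_eq_mul, ← lintegral_indicator_one hs,
    ← lintegral_dirichlet_mul hα o (measurable_one.indicator hs), ← lintegral_indicator hs]
  refine lintegral_congr fun p => ?_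
  by_cases h : p ∈ s <;> simp [h]

end Dirichlet

/-! ### Moments of the Dirichlet distribution -/

section DirichletMoments

variable {ι : Type*} [Fintype ι]

lemma integrable_simplex {f : stdSimplex ℝ ι → ℝ} (hf : Continuous f)
    (μ : Measure (stdSimplex ℝ ι)) [IsFiniteMeasure μ] : Integrable f μ :=
  hf.integrable_of_hasCompactSupport (HasCompactSupport.of_compactSpace f)

@[fun_prop]
lemma continuous_coord (o : ι) : Continuous fun p : stdSimplex ℝ ι => p o :=
  (continuous_apply o).comp continuous_subtype_val

lemma continuous_expectation (V : ι → ℝ) :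
    Continuous fun p : stdSimplex ℝ ι => ∑ o, p o * V o :=
  continuous_finsetSum _ fun o _ => (continuous_coord o).mul continuous_const

/-- The mean of `V` under the normalization of `α`. -/
def normMean (α V : ι → ℝ) : ℝ := (∑ o, α o * V o) / ∑ o, α o

variable [Nonempty ι] [DecidableEq ι]

lemma integral_dirichlet_mul {α : ι → ℝ} (hα : ∀ i, 0 < α i) (o : ι) (f : stdSimplex ℝ ι → ℝ) :
    ∫ p, f p * p o ∂dirichlet α
      = (α o / ∑ i, α i) * ∫ p, f p ∂dirichlet (α + Pi.single o 1) := by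
  have h := integral_withDensity_eq_integral_toReal_smul (μ := dirichlet α)
    (f := fun p : stdSimplex ℝ ι => ENNReal.ofReal (p o)) (measurable_coord o).ennreal_ofReal
    (Filter.Eventually.of_forall fun _ => ENNReal.ofReal_lt_top) f
  rw [dirichlet_withDensity hα, integral_smul_measure] at h
  have hA : 0 ≤ α o / ∑ i, α i := div_nonneg (hα o).le (Finset.sum_nonneg fun i _ => (hα i).le)
  rw [ENNReal.toReal_ofReal hA, smul_eq_mul] at h
  rw [h]
  refine integral_congr_ae (Filter.Eventually.of_forall fun p => ?_)
  simp only [smul_eq_mul]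
  rw [ENNReal.toReal_ofReal (stdSimplex.zero_le p o), mul_comm]

/-- One draw of the Pólya urn: insert `1 = ∑ p o` and apply conjugacy to each term. -/
lemma integral_dirichlet_eq_sum {α : ι → ℝ} (hα : ∀ i, 0 < α i) {f : stdSimplex ℝ ι → ℝ}
    (hf : Continuous f) :
    ∫ p, f p ∂dirichlet α
      = ∑ o, (α o / ∑ i, α i) * ∫ p, f p ∂dirichlet (α + Pi.single o 1) := by
  have := isProbabilityMeasure_dirichlet hα
  simp_rw [← integral_dirichlet_mul hα]
  rw [← integral_finsetSum _ fun o _ => integrable_simplex (f := fun p => f p * p o) (by fun_prop) _]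
  refine integral_congr_ae (Filter.Eventually.of_forall fun p => ?_)
  simp only
  rw [← Finset.mul_sum, stdSimplex.sum_eq_one, mul_one]

lemma integral_dirichlet_coord {α : ι → ℝ} (hα : ∀ i, 0 < α i) (o : ι) :
    ∫ p : stdSimplex ℝ ι, p o ∂dirichlet α = α o / ∑ i, α i := by
  have := isProbabilityMeasure_dirichlet (add_single_pos hα o)
  simpa using integral_dirichlet_mul hα o fun _ => 1

lemma integral_dirichlet_expectation {α : ι → ℝ} (hα : ∀ i, 0 < α i) (V : ι → ℝ) :
    ∫ p : stdSimplex ℝ ι, ∑ o, p o * V o ∂dirichlet α = normMean α V := by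
  have := isProbabilityMeasure_dirichlet hα
  rw [integral_finsetSum _ fun o _ => integrable_simplex (f := fun p => p o * V o) (by fun_prop) _]
  simp_rw [integral_mul_const, integral_dirichlet_coord hα]
  rw [normMean, Finset.sum_div]
  exact Finset.sum_congr rfl fun o _ => by ring

omit [Nonempty ι] in
lemma sum_add_single (α : ι → ℝ) (o : ι) :
    ∑ i, (α + Pi.single o 1 : ι → ℝ) i = ∑ i, α i + 1 := by
  simp [Finset.sum_add_distrib]

lemma normMean_add_single {α : ι → ℝ} (hα : ∀ i, 0 < α i) (V : ι → ℝ) (o : ι) :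
    normMean (α + Pi.single o 1) V
      = normMean α V + (V o - normMean α V) / (∑ i, α i + 1) := by
  have hA : 0 < ∑ i, α i := Finset.sum_pos (fun i _ => hα i) Finset.univ_nonempty
  rw [normMean, normMean, sum_add_single]
  have : ∑ i, (α + Pi.single o 1 : ι → ℝ) i * V i = ∑ i, α i * V i + V o := by
    simp [add_mul, Finset.sum_add_distrib, Pi.single_apply]
  rw [this]
  field_simp
  ring

/-- Conjugacy turns the second moment into first moments after one draw. Constants are dropped: the
bound feeds a remainder of which only the decay in `∑ α` matters. -/
lemma integral_sq_deviation_le {α : ι → ℝ} (hα : ∀ i, 0 < α i) {V : ι → ℝ} {s : ℝ}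
    (hV : ∀ o, 0 ≤ V o ∧ V o ≤ s) :
    ∫ p : stdSimplex ℝ ι, (∑ o, p o * V o - normMean α V) ^ 2 ∂dirichlet α
      ≤ s ^ 2 / ∑ i, α i := by
  have := isProbabilityMeasure_dirichlet hα
  have hA : 0 < ∑ i, α i := Finset.sum_pos (fun i _ => hα i) Finset.univ_nonempty
  set A := ∑ i, α i with hAdef
  set μ := normMean α V with hμ
  have hμsum : ∑ o, α o * V o = A * μ := by
    rw [hμ, normMean, ← hAdef]; field_simp
  have hc := continuous_expectation V
  have h1 : ∫ p : stdSimplex ℝ ι, (∑ o, p o * V o) * (∑ o, p o * V o) ∂dirichlet α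
      = ∑ o, α o / A * V o * (μ + (V o - μ) / (A + 1)) := by
    have e : ∀ p : stdSimplex ℝ ι, (∑ o, p o * V o) * (∑ o, p o * V o)
        = ∑ o, (((∑ o, p o * V o) * V o) * p o) := by
      intro p
      rw [Finset.mul_sum]
      exact Finset.sum_congr rfl fun o _ => by ring
    simp_rw [e]
    rw [integral_finsetSum _ fun o _ => integrable_simplex
      (f := fun p => (∑ o, p o * V o) * V o * p o) (by fun_prop) _]
    refine Finset.sum_congr rfl fun o _ => ?_
    rw [integral_dirichlet_mul hα o fun p => (∑ o, p o * V o) * V o, integral_mul_const,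
      integral_dirichlet_expectation (add_single_pos hα o), normMean_add_single hα]
    ring
  have h2 : ∫ p : stdSimplex ℝ ι, (∑ o, p o * V o - μ) ^ 2 ∂dirichlet α
      = ∑ o, α o / A * V o * (μ + (V o - μ) / (A + 1)) - μ ^ 2 := by
    have e : ∀ p : stdSimplex ℝ ι, (∑ o, p o * V o - μ) ^ 2
        = (∑ o, p o * V o) * (∑ o, p o * V o) - (2 * μ * (∑ o, p o * V o) - μ ^ 2) := by
      intro p; ring
    simp_rw [e]
    rw [integral_sub (integrable_simplex (by fun_prop) _) (integrable_simplex (by fun_prop) _), h1,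
      integral_sub (integrable_simplex (by fun_prop) _) (integrable_const _),
      integral_const_mul, integral_dirichlet_expectation hα]
    simp only [integral_const, probReal_univ, one_smul, ← hμ]
    ring
  have h3 : ∑ o, α o / A * V o * (μ + (V o - μ) / (A + 1))
      = (∑ o, α o * V o ^ 2) / (A * (A + 1)) + A * μ ^ 2 / (A + 1) := by
    have e : ∀ o, α o / A * V o * (μ + (V o - μ) / (A + 1))
        = α o * V o ^ 2 / (A * (A + 1)) + α o * V o * (μ / (A + 1)) := by
      intro o; field_simp; ring
    simp_rw [e]
    rw [Finset.sum_add_distrib, ← Finset.sum_div, ← Finset.sum_mul, hμsum]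
    ring
  rw [h2, h3]
  have h4 : ∑ o, α o * V o ^ 2 ≤ A * s ^ 2 := by
    rw [hAdef, Finset.sum_mul]
    refine Finset.sum_le_sum fun o _ => mul_le_mul_of_nonneg_left ?_ (hα o).le
    exact pow_le_pow_left₀ (hV o).1 (hV o).2 2
  have h5 : (∑ o, α o * V o ^ 2) / (A * (A + 1)) ≤ s ^ 2 / A := by
    rw [div_le_div_iff₀ (by positivity) hA]
    nlinarith [mul_nonneg (mul_nonneg hA.le hA.le) (sq_nonneg s), mul_nonneg hA.le (sq_nonneg s),
      mul_le_mul_of_nonneg_right h4 hA.le]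
  have h6 : A * μ ^ 2 / (A + 1) ≤ μ ^ 2 := by
    rw [div_le_iff₀ (by positivity)]; nlinarith [sq_nonneg μ]
  linarith

lemma integral_abs_deviation_le {α : ι → ℝ} (hα : ∀ i, 0 < α i) {V : ι → ℝ} {s : ℝ}
    (hV : ∀ o, 0 ≤ V o ∧ V o ≤ s) :
    ∫ p : stdSimplex ℝ ι, |∑ o, p o * V o - normMean α V| ∂dirichlet α
      ≤ s / Real.sqrt (∑ i, α i) := by
  have := isProbabilityMeasure_dirichlet hα
  have hA : 0 < ∑ i, α i := Finset.sum_pos (fun i _ => hα i) Finset.univ_nonempty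
  have hs : 0 ≤ s := (hV (Classical.arbitrary ι)).1.trans (hV _).2
  have hc : Continuous fun p : stdSimplex ℝ ι => |∑ o, p o * V o - normMean α V| :=
    ((continuous_expectation V).sub continuous_const).abs
  have hJ : (∫ p : stdSimplex ℝ ι, |∑ o, p o * V o - normMean α V| ∂dirichlet α) ^ 2
      ≤ ∫ p : stdSimplex ℝ ι, |∑ o, p o * V o - normMean α V| ^ 2 ∂dirichlet α :=
    (even_two.convexOn_pow (𝕜 := ℝ)).map_integral_le (continuous_pow 2).continuousOn isClosed_univ
      (Filter.Eventually.of_forall fun _ => Set.mem_univ _) (integrable_simplex hc _)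
      (integrable_simplex (hc.pow 2) _)
  simp_rw [sq_abs] at hJ
  have := hJ.trans (integral_sq_deviation_le hα hV)
  refine le_of_sq_le_sq ?_ (by positivity)
  rwa [div_pow, Real.sq_sqrt hA.le]

end DirichletMoments

/-! ### Gaussian variables dominate Dirichlet expectations -/

section DirichletGaussian

variable {ι : Type*} [Fintype ι] [Nonempty ι] [DecidableEq ι]

/-- Induction over `k` draws of the Pólya urn. Each draw shifts the mean by a centred bounded
variable, which is traded for an independent Gaussian; the last summand pays for the deviation left
when the draws stop. -/
lemma dirichlet_le_gaussian_add {u : ℝ → ℝ} (hu : ConvexOn ℝ Set.univ u) (hl : LipschitzWith 1 u)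
    {V : ι → ℝ} {s : ℝ} (hV : ∀ o, 0 ≤ V o ∧ V o ≤ s) (k : ℕ) :
    ∀ α : ι → ℝ, (∀ i, 0 < α i) →
      ∫ p : stdSimplex ℝ ι, u (∑ o, p o * V o) ∂dirichlet α
        ≤ ∫ x, u (normMean α V + Real.sqrt 3 * (s / Real.sqrt (∑ i, α i)) * x) ∂gaussianReal 0 1
          + s / Real.sqrt (∑ i, α i + k) := by
  have hs : 0 ≤ s := (hV (Classical.arbitrary ι)).1.trans (hV _).2
  have huc : Continuous fun p : stdSimplex ℝ ι => u (∑ o, p o * V o) :=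
    hl.continuous.comp (continuous_expectation V)
  induction k with
  | zero =>
    intro α hα
    have := isProbabilityMeasure_dirichlet hα
    -- With no draws, the expectation is replaced by its mean at the cost of the mean absolute
    -- deviation.
    have h1 : ∫ p : stdSimplex ℝ ι, u (∑ o, p o * V o) ∂dirichlet α
        ≤ ∫ p : stdSimplex ℝ ι, (u (normMean α V) + |∑ o, p o * V o - normMean α V|)
          ∂dirichlet α := by
      have hc : Continuous fun p : stdSimplex ℝ ι => |∑ o, p o * V o - normMean α V| :=
        ((continuous_expectation V).sub continuous_const).abs
      refine integral_mono (integrable_simplex huc _)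
        (integrable_simplex (continuous_const.add hc) _) fun p => ?_
      have := lipschitz_abs_le hl (∑ o, p o * V o) (normMean α V)
      have := (abs_le.mp this).2
      dsimp only; linarith
    rw [integral_add (integrable_const _) (integrable_simplex (by fun_prop) _)] at h1
    have h2 := integral_abs_deviation_le hα hV
    have h3 := le_integral_gaussian hu hl (normMean α V)
      (b := Real.sqrt 3 * (s / Real.sqrt (∑ i, α i))) (by positivity)
    simp only [integral_const, probReal_univ, one_smul] at h1
    simp only [Nat.cast_zero, add_zero]
    linarith
  | succ k ih =>
    intro α hα
    have hA : 0 < ∑ i, α i := Finset.sum_pos (fun i _ => hα i) Finset.univ_nonempty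
    set A := ∑ i, α i with hAdef
    set μ := normMean α V with hμ
    have hμsum : ∑ o, α o * V o = A * μ := by
      rw [hμ, normMean, ← hAdef]; field_simp
    have hq1 : ∑ o, α o / A = 1 := by rw [← Finset.sum_div, div_self hA.ne']
    rw [integral_dirichlet_eq_sum hα huc, ← hAdef]
    set c := Real.sqrt 3 * (s / Real.sqrt (A + 1)) with hc
    have h1 : ∀ o, ∫ p : stdSimplex ℝ ι, u (∑ o, p o * V o) ∂dirichlet (α + Pi.single o 1)
        ≤ ∫ x, u (μ + (V o - μ) / (A + 1) + c * x) ∂gaussianReal 0 1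
          + s / Real.sqrt (A + (k + 1 : ℕ)) := by
      intro o
      have := ih _ (add_single_pos hα o)
      rw [normMean_add_single hα, sum_add_single] at this
      have e : A + 1 + (k : ℝ) = A + ((k + 1 : ℕ) : ℝ) := by push_cast; ring
      rwa [← hAdef, ← hμ, e] at this
    have h2 : ∑ o, α o / A * ∫ x, u (μ + (V o - μ) / (A + 1) + c * x) ∂gaussianReal 0 1
        ≤ ∫ x', ∫ x, u (μ + Real.sqrt 3 * (s / (A + 1)) * x' + c * x)
          ∂gaussianReal 0 1 ∂gaussianReal 0 1 := by
      refine sum_le_gaussian (convexOn_integral_gaussian hu hl c) (lipschitz_integral_gaussian hl c)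
        (fun o => α o / A) (fun o => (V o - μ) / (A + 1)) (fun o => div_nonneg (hα o).le hA.le) hq1
        ?_ ?_ μ
      · have e : ∀ o, α o / A * ((V o - μ) / (A + 1))
            = (α o * V o) * (1 / (A * (A + 1))) - α o * (μ / (A * (A + 1))) := by
          intro o; field_simp
        simp_rw [e]
        rw [Finset.sum_sub_distrib, ← Finset.sum_mul, ← Finset.sum_mul, hμsum, ← hAdef]
        field_simp; ring
      · intro o o'
        rw [← sub_div, abs_div, abs_of_pos (by linarith : 0 < A + 1)]
        gcongr
        rw [abs_le]
        constructor <;> linarith [(hV o).1, (hV o).2, (hV o').1, (hV o').2]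
    have h3 : ∫ x', ∫ x, u (μ + Real.sqrt 3 * (s / (A + 1)) * x' + c * x)
          ∂gaussianReal 0 1 ∂gaussianReal 0 1
        ≤ ∫ x, u (μ + Real.sqrt 3 * (s / Real.sqrt A) * x) ∂gaussianReal 0 1 := by
      have e := integral_gaussian_add hl μ c (Real.sqrt 3 * (s / (A + 1)))
      simp_rw [add_right_comm μ (c * _)] at e
      rw [e]
      refine integral_gaussian_mono hu hl μ (Real.sqrt_nonneg _) ?_
      apply Real.sqrt_le_iff.mpr ⟨by positivity, ?_⟩
      rw [hc]
      simp only [mul_pow, div_pow]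
      rw [Real.sq_sqrt (by norm_num), Real.sq_sqrt hA.le, Real.sq_sqrt (by linarith)]
      -- The variance budget: the Gaussian for the updated parameters together with the one for the
      -- draw fits into the Gaussian for `A`.
      have : 1 / (A + 1) + 1 / (A + 1) ^ 2 ≤ 1 / A := by
        rw [div_add_div _ _ (by positivity) (by positivity), div_le_div_iff₀ (by positivity) hA]
        nlinarith [hA]
      calc 3 * (s ^ 2 / (A + 1)) + 3 * (s ^ 2 / (A + 1) ^ 2)
          = 3 * s ^ 2 * (1 / (A + 1) + 1 / (A + 1) ^ 2) := by ring
        _ ≤ 3 * s ^ 2 * (1 / A) := by gcongr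
        _ = _ := by ring
    calc ∑ o, α o / A * ∫ p : stdSimplex ℝ ι, u (∑ o, p o * V o) ∂dirichlet (α + Pi.single o 1)
        ≤ ∑ o, α o / A * (∫ x, u (μ + (V o - μ) / (A + 1) + c * x) ∂gaussianReal 0 1
          + s / Real.sqrt (A + (k + 1 : ℕ))) :=
          Finset.sum_le_sum fun o _ => mul_le_mul_of_nonneg_left (h1 o) (div_nonneg (hα o).le hA.le)
      _ = ∑ o, α o / A * ∫ x, u (μ + (V o - μ) / (A + 1) + c * x) ∂gaussianReal 0 1
          + s / Real.sqrt (A + (k + 1 : ℕ)) := by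
          simp_rw [mul_add]
          rw [Finset.sum_add_distrib, ← Finset.sum_mul, hq1, one_mul]
      _ ≤ ∫ x, u (μ + Real.sqrt 3 * (s / Real.sqrt A) * x) ∂gaussianReal 0 1
          + s / Real.sqrt (A + (k + 1 : ℕ)) := add_le_add_left (h2.trans h3) _

/-- Stochastic optimism: for convex increasing utilities, a Gaussian variable of mean at least
`normMean α V` and standard deviation at least `√3 s / √(∑ α)` dominates the expectation of
`V : ι → [0, s]` under a Dirichlet distribution. -/
theorem dirichlet_le_gaussian {u : ℝ → ℝ} (hu : ConvexOn ℝ Set.univ u) (hl : LipschitzWith 1 u)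
    (hmono : Monotone u) {α : ι → ℝ} (hα : ∀ i, 0 < α i) {V : ι → ℝ} {s : ℝ}
    (hV : ∀ o, 0 ≤ V o ∧ V o ≤ s) {μ σ : ℝ} (hμ : normMean α V ≤ μ)
    (hσ : Real.sqrt 3 * (s / Real.sqrt (∑ i, α i)) ≤ σ) :
    ∫ p : stdSimplex ℝ ι, u (∑ o, p o * V o) ∂dirichlet α
      ≤ ∫ x, u (μ + σ * x) ∂gaussianReal 0 1 := by
  have hs : 0 ≤ s := (hV (Classical.arbitrary ι)).1.trans (hV _).2
  have h1 : ∫ p : stdSimplex ℝ ι, u (∑ o, p o * V o) ∂dirichlet α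
      ≤ ∫ x, u (normMean α V + Real.sqrt 3 * (s / Real.sqrt (∑ i, α i)) * x) ∂gaussianReal 0 1 := by
    -- The number of draws is arbitrary, so the leftover deviation disappears in the limit.
    have hlim : Filter.Tendsto (fun k : ℕ => s / Real.sqrt (∑ i, α i + k)) Filter.atTop (nhds 0) := by
      refine Filter.Tendsto.const_div_atTop ?_ s
      refine Real.tendsto_sqrt_atTop.comp ?_
      exact Filter.tendsto_atTop_add_const_left _ _ tendsto_natCast_atTop_atTop
    have := (tendsto_const_nhds (x := ∫ x, u (normMean α V
      + Real.sqrt 3 * (s / Real.sqrt (∑ i, α i)) * x) ∂gaussianReal 0 1)).add hlim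
    rw [add_zero] at this
    exact ge_of_tendsto' this fun k => dirichlet_le_gaussian_add hu hl hV k α hα
  refine h1.trans ((integral_gaussian_mono hu hl _ (by positivity) hσ).trans ?_)
  refine integral_mono (integrable_lipschitz_gaussian hl _ _) (integrable_lipschitz_gaussian hl _ _)
    fun x => hmono (by linarith)

end DirichletGaussian

/-! ### Posterior distributions of the model -/

section Posterior

variable {H : ℕ} {X A : Type*} [Fintype X] [Fintype A]

omit [Fintype A] in
@[fun_prop]
lemma continuous_model_coord (i : Fin H × X × A) (o : Outcome X) :
    Continuous fun M : Model H X A => M i o :=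
  (continuous_coord o).comp (continuous_apply i)

variable [Nonempty X]

lemma isProbabilityMeasure_prior {α : Fin H × X × A → Outcome X → ℝ} (hα : ∀ i o, 0 < α i o) :
    IsProbabilityMeasure (prior α) := by
  have := fun i => isProbabilityMeasure_dirichlet (hα i)
  rw [prior]
  infer_instance

lemma integrable_model {α : Fin H × X × A → Outcome X → ℝ} (hα : ∀ i o, 0 < α i o)
    {f : Model H X A → ℝ} (hf : Continuous f) : Integrable f (prior α) := by
  have := isProbabilityMeasure_prior hα
  exact hf.integrable_of_hasCompactSupport (HasCompactSupport.of_compactSpace f)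

/-- The model whose outcome distributions are the normalized parameters. -/
def meanModel (α : Fin H × X × A → Outcome X → ℝ) (hα : ∀ i o, 0 < α i o) : Model H X A :=
  fun i => ⟨fun o => α i o / ∑ o', α i o', div_sum_mem_stdSimplex (hα i)⟩

omit [Fintype A] in
lemma meanModel_apply {α : Fin H × X × A → Outcome X → ℝ} (hα : ∀ i o, 0 < α i o)
    (i : Fin H × X × A) (o : Outcome X) : meanModel α hα i o = α i o / ∑ o', α i o' := rfl

variable [DecidableEq X] [DecidableEq A]

omit [Fintype X] [Fintype A] [Nonempty X] in
lemma add_single_single_pos {α : Fin H × X × A → Outcome X → ℝ} (hα : ∀ i o, 0 < α i o)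
    (j : Fin H × X × A) (o' : Outcome X) (i : Fin H × X × A) (o : Outcome X) :
    0 < (α + Pi.single j (Pi.single o' 1) : Fin H × X × A → Outcome X → ℝ) i o := by
  by_cases h : i = j
  · subst h; simpa using add_single_pos (hα i) o' o
  · simpa [h] using hα i o

lemma integral_prior_mul {α : Fin H × X × A → Outcome X → ℝ} (hα : ∀ i o, 0 < α i o)
    (i : Fin H × X × A) (o : Outcome X) (f : Model H X A → ℝ) :
    ∫ M, f M * M i o ∂prior α
      = (α i o / ∑ o', α i o') * ∫ M, f M ∂prior (α + Pi.single i (Pi.single o 1)) := by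
  have := fun i => isProbabilityMeasure_dirichlet (hα i)
  have hp := isProbabilityMeasure_dirichlet (add_single_pos (hα i) o)
  have h := integral_withDensity_eq_integral_toReal_smul (μ := prior α)
    (f := fun M : Model H X A => ENNReal.ofReal (M i o))
    (continuous_model_coord i o).measurable.ennreal_ofReal
    (Filter.Eventually.of_forall fun _ => ENNReal.ofReal_lt_top) f
  have hd := pi_withDensity_eval (fun i => dirichlet (α i)) i (dirichlet (α i + Pi.single o 1))
    (measurable_coord o).ennreal_ofReal ENNReal.ofReal_ne_top (dirichlet_withDensity (hα i) o)
  have hu : Function.update (fun i => dirichlet (α i)) i (dirichlet (α i + Pi.single o 1))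
      = fun j => dirichlet ((α + Pi.single i (Pi.single o 1) : Fin H × X × A → Outcome X → ℝ) j) := by
    ext j : 1
    by_cases hj : j = i
    · subst hj; simp
    · simp [hj]
  rw [hu] at hd
  rw [prior, hd, integral_smul_measure] at h
  have hA : 0 ≤ α i o / ∑ o', α i o' :=
    div_nonneg (hα i o).le (Finset.sum_nonneg fun o _ => (hα i o).le)
  rw [ENNReal.toReal_ofReal hA, smul_eq_mul] at h
  rw [prior, prior, h]
  refine integral_congr_ae (Filter.Eventually.of_forall fun M => ?_)
  simp only [smul_eq_mul]
  rw [ENNReal.toReal_ofReal (stdSimplex.zero_le (M i) o), mul_comm]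

omit [Fintype X] [Fintype A] [Nonempty X] in
lemma add_sum_single_pos {κ : Type*} {α : Fin H × X × A → Outcome X → ℝ} (hα : ∀ i o, 0 < α i o)
    (s : Finset κ) (i : κ → Fin H × X × A) (o : κ → Outcome X) :
    ∀ j o', 0 < (α + ∑ k ∈ s, Pi.single (i k) (Pi.single (o k) 1) :
      Fin H × X × A → Outcome X → ℝ) j o' := by
  classical
  induction s using Finset.induction_on with
  | empty => simpa using hα
  | insert k s hk ih =>
    rw [Finset.sum_insert hk, add_comm (Pi.single _ _), ← add_assoc]
    exact add_single_single_pos ih _ _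

/-- Weighting the prior by the likelihood of observations gives a multiple of the posterior. -/
lemma exists_integral_prior_prod {κ : Type*} {α : Fin H × X × A → Outcome X → ℝ}
    (hα : ∀ i o, 0 < α i o) (s : Finset κ) (i : κ → Fin H × X × A) (o : κ → Outcome X) :
    ∃ K : ℝ, 0 ≤ K ∧ ∀ f : Model H X A → ℝ, ∫ M, f M * ∏ k ∈ s, M (i k) (o k) ∂prior α
      = K * ∫ M, f M ∂prior (α + ∑ k ∈ s, Pi.single (i k) (Pi.single (o k) 1)) := by
  classical
  induction s using Finset.induction_on with
  | empty => exact ⟨1, zero_le_one, fun f => by simp⟩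
  | insert k s hk ih =>
    obtain ⟨K, hK, h⟩ := ih
    set α' := α + ∑ k ∈ s, Pi.single (i k) (Pi.single (o k) 1) with hα'
    have hpos : ∀ j o', 0 < α' j o' := add_sum_single_pos hα s i o
    refine ⟨K * (α' (i k) (o k) / ∑ o', α' (i k) o'), mul_nonneg hK
      (div_nonneg (hpos _ _).le (Finset.sum_nonneg fun o _ => (hpos _ o).le)), fun f => ?_⟩
    simp_rw [Finset.prod_insert hk, ← mul_assoc]
    rw [h fun M => f M * M (i k) (o k), integral_prior_mul hpos, Finset.sum_insert hk,
      add_comm (Pi.single _ _), ← add_assoc, mul_assoc]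

/-- An observation changes the parameters at its own index only, so observations at distinct indices
contribute their prior means independently. -/
lemma integral_prior_prod {κ : Type*} {i : κ → Fin H × X × A} (hi : Function.Injective i)
    (o : κ → Outcome X) (s : Finset κ) :
    ∀ α : Fin H × X × A → Outcome X → ℝ, (∀ i o, 0 < α i o) →
      ∫ M : Model H X A, ∏ k ∈ s, M (i k) (o k) ∂prior α
        = ∏ k ∈ s, (α (i k) (o k) / ∑ o', α (i k) o') := by
  classical
  induction s using Finset.induction_on with
  | empty =>
    intro α hα
    have := isProbabilityMeasure_prior hα
    simp
  | insert k s hk ih =>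
    intro α hα
    simp_rw [Finset.prod_insert hk, mul_comm _ (∏ _ ∈ s, _)]
    rw [integral_prior_mul hα (i k) (o k) fun M => ∏ k ∈ s, M (i k) (o k),
      ih _ (add_single_single_pos hα _ _), mul_comm]
    congr 1
    refine Finset.prod_congr rfl fun l hl => ?_
    have : i l ≠ i k := fun h => hk (hi h ▸ hl)
    simp [this]

/-- Within an episode, every state-action pair carries its own step, so the expected probability
of an episode is its probability in the mean model. -/
lemma integral_episodeProb {α : Fin H × X × A → Outcome X → ℝ} (hα : ∀ i o, 0 < α i o)
    (π : Policy H X A) (e : Episode H X A) :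
    ∫ M, episodeProb M π e ∂prior α = episodeProb (meanModel α hα) π e := by
  simp_rw [episodeProb, Finset.prod_mul_distrib]
  rw [integral_const_mul, integral_prior_prod (i := fun h => (h, e.state h, e.action h))
    (fun h h' hh => by simpa using (Prod.ext_iff.mp hh).1) e.outcome _ α hα]
  rfl

omit [Nonempty X] [DecidableEq X] [DecidableEq A] in
@[fun_prop]
lemma continuous_episodeProb (π : Policy H X A) (e : Episode H X A) :
    Continuous fun M : Model H X A => episodeProb M π e := by
  unfold episodeProb; fun_prop

omit [Nonempty X] [DecidableEq X] [DecidableEq A] in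
@[fun_prop]
lemma continuous_value (π : Policy H X A) (x : X) :
    Continuous fun M : Model H X A => value M π x := by
  unfold value; fun_prop

lemma integral_value {α : Fin H × X × A → Outcome X → ℝ} (hα : ∀ i o, 0 < α i o)
    (π : Policy H X A) (x : X) :
    ∫ M, value M π x ∂prior α = value (meanModel α hα) π x := by
  unfold value
  rw [integral_finsetSum _ fun τ _ => integrable_model hα (by fun_prop)]
  simp_rw [integral_mul_const, integral_episodeProb hα]

variable {n : ℕ}

/-- The number of times that each outcome was observed. -/
def outcomeCount (hist : Fin n → Episode H X A) (i : Fin H × X × A) (o : Outcome X) : ℝ :=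
  ∑ j ∈ visits hist i.1 i.2.1 i.2.2, if (hist j).outcome i.1 = o then 1 else 0

omit [Fintype X] [Fintype A] [Nonempty X] in
lemma outcomeCount_nonneg (hist : Fin n → Episode H X A) (i : Fin H × X × A) (o : Outcome X) :
    0 ≤ outcomeCount hist i o :=
  Finset.sum_nonneg fun _ _ => by split_ifs <;> norm_num

omit [Fintype A] [Nonempty X] in
lemma sum_outcomeCount_mul (hist : Fin n → Episode H X A) (i : Fin H × X × A)
    (V : Outcome X → ℝ) :
    ∑ o, outcomeCount hist i o * V o
      = ∑ j ∈ visits hist i.1 i.2.1 i.2.2, V ((hist j).outcome i.1) := by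
  simp_rw [outcomeCount, Finset.sum_mul]
  rw [Finset.sum_comm]
  simp

omit [Fintype A] [Nonempty X] in
lemma sum_outcomeCount (hist : Fin n → Episode H X A) (i : Fin H × X × A) :
    ∑ o, outcomeCount hist i o = (visits hist i.1 i.2.1 i.2.2).card := by
  simpa using sum_outcomeCount_mul hist i fun _ => 1

omit [Fintype X] [Fintype A] [Nonempty X] in
-- One unit increment for each episode and step: the form in which repeated conjugacy delivers the
-- posterior parameters.
lemma outcomeCount_eq_sum_single (hist : Fin n → Episode H X A) :
    outcomeCount hist = ∑ k : Fin n × Fin H,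
      Pi.single (k.2, (hist k.1).state k.2, (hist k.1).action k.2)
        (Pi.single ((hist k.1).outcome k.2) 1) := by
  ext ⟨h, x, a⟩ o
  rw [outcomeCount, visits, Finset.sum_filter, Finset.sum_apply, Finset.sum_apply,
    Fintype.sum_prod_type]
  refine Finset.sum_congr rfl fun j _ => ?_
  rw [Finset.sum_eq_single h]
  · by_cases hxa : (hist j).state h = x ∧ (hist j).action h = a
    · obtain ⟨rfl, rfl⟩ := hxa
      simp [Pi.single_apply, eq_comm]
    · rw [if_neg hxa, Pi.single_eq_of_ne, Pi.zero_apply]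
      intro he
      simp only [Prod.mk.injEq, true_and] at he
      exact hxa ⟨he.1.symm, he.2.symm⟩
  · intro h' _ hh
    rw [Pi.single_eq_of_ne, Pi.zero_apply]
    intro he
    exact hh (Prod.mk.inj he).1.symm
  · simp

/-- The parameters of the posterior distribution. -/
def postParam (α : Fin H × X × A → Outcome X → ℝ) (hist : Fin n → Episode H X A) :
    Fin H × X × A → Outcome X → ℝ :=
  α + outcomeCount hist

omit [Fintype X] [Fintype A] [Nonempty X] in
lemma postParam_pos {α : Fin H × X × A → Outcome X → ℝ} (hα : ∀ i o, 0 < α i o)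
    (hist : Fin n → Episode H X A) : ∀ i o, 0 < postParam α hist i o := fun i o =>
  add_pos_of_pos_of_nonneg (hα i o) (outcomeCount_nonneg hist i o)

omit [Fintype A] [Nonempty X] in
lemma sum_postParam (α : Fin H × X × A → Outcome X → ℝ)
    (hist : Fin n → Episode H X A) (i : Fin H × X × A) :
    ∑ o, postParam α hist i o = ∑ o, α i o + (visits hist i.1 i.2.1 i.2.2).card := by
  simp [postParam, Finset.sum_add_distrib, sum_outcomeCount]

omit [Fintype A] [Nonempty X] in
lemma sum_postParam_mul (α : Fin H × X × A → Outcome X → ℝ)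
    (hist : Fin n → Episode H X A) (i : Fin H × X × A) (V : Outcome X → ℝ) :
    ∑ o, postParam α hist i o * V o
      = ∑ o, α i o * V o + ∑ j ∈ visits hist i.1 i.2.1 i.2.2, V ((hist j).outcome i.1) := by
  simp [postParam, add_mul, Finset.sum_add_distrib, sum_outcomeCount_mul]

/-- The posterior distribution given a history of episodes, under any policies. -/
lemma exists_integral_posterior {α : Fin H × X × A → Outcome X → ℝ} (hα : ∀ i o, 0 < α i o)
    (hist : Fin n → Episode H X A) (π : Fin n → Policy H X A) :
    ∃ K : ℝ, (0 : ℝ) ≤ K ∧ ∀ f : Model H X A → ℝ,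
      ∫ M, f M * ∏ j, episodeProb M (π j) (hist j) ∂prior α
        = K * ∫ M, f M ∂prior (postParam α hist) := by
  obtain ⟨K, hK, h⟩ := exists_integral_prior_prod hα (Finset.univ : Finset (Fin n × Fin H))
    (fun k => (k.2, (hist k.1).state k.2, (hist k.1).action k.2))
    (fun k => (hist k.1).outcome k.2)
  rw [← outcomeCount_eq_sum_single] at h
  -- The probabilities of the actions do not involve the model and join the constant.
  refine ⟨(∏ j, ∏ h, π j h ((hist j).state h) ((hist j).action h)) * K, mul_nonneg
    (Finset.prod_nonneg fun j _ => Finset.prod_nonneg fun h _ => stdSimplex.zero_le _ _) hK,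
    fun f => ?_⟩
  rw [mul_assoc, postParam, ← h, ← integral_const_mul]
  congr 1
  ext M
  simp_rw [episodeProb, Finset.prod_mul_distrib, Fintype.prod_prod_type]
  ring

end Posterior

/-! ### Dynamic programming -/

section Bellman

variable {H : ℕ} {X A : Type*}

lemma state_cons_zero (x : X) (τ : Trajectory (H + 1) X A) :
    Episode.state ((x, τ) : Episode (H + 1) X A) 0 = x := rfl

lemma state_cons_succ (x : X) (a : A) (o : Outcome X) (τ : Trajectory H X A) (h : Fin H) :
    Episode.state ((x, Fin.cons (a, o) τ) : Episode (H + 1) X A) h.succ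
      = Episode.state ((o.2, τ) : Episode H X A) h := by
  simp only [Episode.state, ← Fin.succ_castSucc, Fin.cons_succ]
  cases h.castSucc using Fin.cases <;> simp

lemma sum_trajectory_succ [Fintype X] [Fintype A] (F : Trajectory (H + 1) X A → ℝ) :
    ∑ τ, F τ = ∑ a, ∑ o, ∑ τ : Trajectory H X A,
      F (Fin.cons (α := fun _ => A × Outcome X) (a, o) τ) := by
  rw [← (Fin.consEquiv fun _ : Fin (H + 1) => A × Outcome X).sum_comp, Fintype.sum_prod_type,
    Fintype.sum_prod_type]
  rfl

lemma rew_nonneg (r : Bool) : 0 ≤ rew r := by unfold rew; split_ifs <;> norm_num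

lemma rew_le_one (r : Bool) : rew r ≤ 1 := by unfold rew; split_ifs <;> norm_num

variable [Fintype X] [Fintype A]

/-- The model of the steps after the first. -/
def tailModel (M : Model (H + 1) X A) : Model H X A := fun i => M (i.1.succ, i.2)

lemma episodeProb_cons (M : Model (H + 1) X A) (π : Policy (H + 1) X A) (x : X) (a : A)
    (o : Outcome X) (τ : Trajectory H X A) :
    episodeProb M π ((x, Fin.cons (a, o) τ) : Episode (H + 1) X A)
      = π 0 x a * M (0, x, a) o
        * episodeProb (tailModel M) (fun h => π h.succ) ((o.2, τ) : Episode H X A) := by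
  simp only [episodeProb, Fin.prod_univ_succ, state_cons_zero, state_cons_succ]
  rfl

lemma sum_episodeProb (M : Model H X A) (π : Policy H X A) (x : X) :
    ∑ τ : Trajectory H X A, episodeProb M π (x, τ) = 1 := by
  induction H generalizing x with
  | zero => simp [episodeProb]
  | succ H ih =>
    rw [sum_trajectory_succ]
    simp_rw [episodeProb_cons, ← Finset.mul_sum, ih, mul_one, ← Finset.mul_sum,
      stdSimplex.sum_eq_one, mul_one]
    exact stdSimplex.sum_eq_one _

/-- The common first-step recursion behind `value_succ` and `sum_bellmanGap`, for functionals that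
split into a first-step term and a functional of the remaining episode. -/
lemma sum_episodeProb_succ (M : Model (H + 1) X A) (π : Policy (H + 1) X A) (x : X)
    (G : Trajectory (H + 1) X A → ℝ) (g : A → Outcome X → ℝ) (G' : Episode H X A → ℝ)
    (hG : ∀ a o τ, G (Fin.cons (a, o) τ) = g a o + G' (o.2, τ)) :
    ∑ τ, episodeProb M π (x, τ) * G τ
      = ∑ a, ∑ o, π 0 x a * M (0, x, a) o * (g a o + ∑ τ : Trajectory H X A,
        episodeProb (tailModel M) (fun h => π h.succ) (o.2, τ) * G' (o.2, τ)) := by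
  rw [sum_trajectory_succ]
  refine Finset.sum_congr rfl fun a _ => Finset.sum_congr rfl fun o _ => ?_
  simp_rw [hG, episodeProb_cons, mul_assoc, ← Finset.mul_sum, mul_add, Finset.sum_add_distrib,
    ← Finset.sum_mul, sum_episodeProb]
  ring

lemma value_succ (M : Model (H + 1) X A) (π : Policy (H + 1) X A) (x : X) :
    value M π x = ∑ a, ∑ o, π 0 x a * M (0, x, a) o
      * (rew o.1 + value (tailModel M) (fun h => π h.succ) o.2) := by
  refine sum_episodeProb_succ M π x _ (fun _ o => rew o.1) Episode.totalReward fun a o τ => ?_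
  simp only [Episode.totalReward, Episode.outcome, Fin.sum_univ_succ]
  rfl

/-- The Bellman error of the value functions `V` at a state and an action. -/
def bellmanGap (M : Model H X A) (V : Fin (H + 1) → X → ℝ) (h : Fin H) (x : X) (a : A) : ℝ :=
  V h.castSucc x - ∑ o, M (h, x, a) o * (rew o.1 + V h.succ o.2)

/-- The performance difference identity. -/
lemma sum_bellmanGap (M : Model H X A) (π : Policy H X A) (V : Fin (H + 1) → X → ℝ)
    (hV : V (Fin.last H) = 0) (x : X) :
    ∑ τ : Trajectory H X A, episodeProb M π (x, τ)
        * ∑ h, bellmanGap M V h (Episode.state (x, τ) h) (Episode.action (x, τ) h)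
      = V 0 x - value M π x := by
  induction H generalizing x with
  | zero =>
    have : V 0 x = 0 := congrFun hV x
    simp [this, value, Episode.totalReward]
  | succ H ih =>
    have key := sum_episodeProb_succ M π x
      (fun τ => ∑ h, bellmanGap M V h (Episode.state (x, τ) h) (Episode.action (x, τ) h))
      (fun a _ => bellmanGap M V 0 x a)
      (fun e => ∑ h, bellmanGap (tailModel M) (fun t => V t.succ) h (e.state h) (e.action h))
      (fun a o τ => by
        simp only [Fin.sum_univ_succ, state_cons_zero, state_cons_succ]
        rfl)
    rw [key]
    have hV' : (fun t : Fin (H + 1) => V t.succ) (Fin.last H) = 0 := by simpa using hV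
    simp_rw [ih (tailModel M) (fun h => π h.succ) (fun t => V t.succ) hV']
    rw [value_succ]
    have h1 : ∀ a, ∑ o, π 0 x a * M (0, x, a) o * (bellmanGap M V 0 x a
          + (V (Fin.succ 0) o.2 - value (tailModel M) (fun h => π h.succ) o.2))
        = π 0 x a * V 0 x - ∑ o, π 0 x a * M (0, x, a) o
          * (rew o.1 + value (tailModel M) (fun h => π h.succ) o.2) := by
      intro a
      have e : ∀ o : Outcome X, π 0 x a * M (0, x, a) o * (bellmanGap M V 0 x a
          + (V (Fin.succ 0) o.2 - value (tailModel M) (fun h => π h.succ) o.2))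
          = M (0, x, a) o * (π 0 x a * bellmanGap M V 0 x a)
            + π 0 x a * (M (0, x, a) o * (rew o.1 + V (Fin.succ 0) o.2))
            - π 0 x a * M (0, x, a) o
          * (rew o.1 + value (tailModel M) (fun h => π h.succ) o.2) := by
        intro o; ring
      simp_rw [e]
      rw [Finset.sum_sub_distrib, Finset.sum_add_distrib, ← Finset.sum_mul, ← Finset.mul_sum,
        stdSimplex.sum_eq_one]
      simp only [bellmanGap, Fin.castSucc_zero]
      ring
    rw [Finset.sum_congr rfl fun a _ => h1 a, Finset.sum_sub_distrib, ← Finset.sum_mul,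
      stdSimplex.sum_eq_one, one_mul]

lemma episodeProb_nonneg (M : Model H X A) (π : Policy H X A) (e : Episode H X A) :
    0 ≤ episodeProb M π e :=
  Finset.prod_nonneg fun _ _ => mul_nonneg (stdSimplex.zero_le _ _) (stdSimplex.zero_le _ _)

lemma value_nonneg (M : Model H X A) (π : Policy H X A) (x : X) : 0 ≤ value M π x :=
  Finset.sum_nonneg fun _ _ => mul_nonneg (episodeProb_nonneg _ _ _)
    (Finset.sum_nonneg fun _ _ => rew_nonneg _)

lemma value_le (M : Model H X A) (π : Policy H X A) (x : X) : value M π x ≤ H := by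
  calc value M π x ≤ ∑ τ : Trajectory H X A, episodeProb M π (x, τ) * H := by
        refine Finset.sum_le_sum fun τ _ => mul_le_mul_of_nonneg_left ?_ (episodeProb_nonneg _ _ _)
        calc Episode.totalReward (x, τ) ≤ ∑ _h : Fin H, (1 : ℝ) :=
              Finset.sum_le_sum fun _ _ => rew_le_one _
          _ = H := by simp
    _ = H := by rw [← Finset.sum_mul, sum_episodeProb, one_mul]

lemma value_le_optValue (M : Model H X A) (π : Policy H X A) (x : X) :
    value M π x ≤ optValue M x :=
  le_ciSup (f := fun π => value M π x) ⟨H, by rintro _ ⟨π, rfl⟩; exact value_le M π x⟩ π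

lemma optValue_nonneg (M : Model H X A) (x : X) : 0 ≤ optValue M x :=
  Real.iSup_nonneg fun π => value_nonneg M π x

lemma optValue_le_card (M : Model H X A) (x : X) : optValue M x ≤ H :=
  Real.iSup_le (fun π => value_le M π x) (Nat.cast_nonneg H)

/-- By `sum_bellmanGap`, `V` exceeds the value of any policy by an expected sum of gaps, so
nonnegative gaps handle all policies at once. -/
lemma optValue_le_of_bellmanGap_nonneg [Nonempty A] (M : Model H X A) (V : Fin (H + 1) → X → ℝ)
    (hV : V (Fin.last H) = 0) (hgap : ∀ h x a, 0 ≤ bellmanGap M V h x a) (x : X) :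
    optValue M x ≤ V 0 x := by
  refine ciSup_le fun π => ?_
  have := sum_bellmanGap M π V hV x
  have h0 : 0 ≤ ∑ τ : Trajectory H X A, episodeProb M π (x, τ)
      * ∑ h, bellmanGap M V h (Episode.state (x, τ) h) (Episode.action (x, τ) h) :=
    Finset.sum_nonneg fun τ _ => mul_nonneg (episodeProb_nonneg _ _ _)
      (Finset.sum_nonneg fun h _ => hgap _ _ _)
  linarith

/-- The supremum may run over uncountably many policies; each value is continuous in the model, so
the supremum is lower semicontinuous. -/
lemma measurable_optValue (x : X) : Measurable fun M : Model H X A => optValue M x :=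
  (lowerSemicontinuous_ciSup (f := fun (π : Policy H X A) (M : Model H X A) => value M π x)
    (fun M => ⟨H, by rintro _ ⟨π, rfl⟩; exact value_le M π x⟩)
    fun π => (continuous_value π x).lowerSemicontinuous).measurable

end Bellman

/-! ### Backward recursions with affine updates -/

section Affine

variable {H : ℕ} {X A : Type*} [Fintype X]

/-- The action values of the backward recursion `Q_h(x, a) = c + ∑ w(x') max Q_{h+1}(x', ·)`. -/
def affineQ (c : Fin H × X × A → ℝ) (w : Fin H × X × A → X → ℝ) : Fin (H + 1) → X → A → ℝ :=
  Fin.reverseInduction (motive := fun _ => X → A → ℝ) (fun _ _ => 0)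
    (fun h Q x a => c (h, x, a) + ∑ x', w (h, x, a) x' * ⨆ a', Q x' a')

/-- The state values of the backward recursion. -/
def affineV (c : Fin H × X × A → ℝ) (w : Fin H × X × A → X → ℝ) (t : Fin (H + 1)) (x : X) : ℝ :=
  ⨆ a, affineQ c w t x a

lemma affineQ_last (c : Fin H × X × A → ℝ) (w : Fin H × X × A → X → ℝ) (x : X) (a : A) :
    affineQ c w (Fin.last H) x a = 0 := by
  rw [affineQ, Fin.reverseInduction_last]

lemma affineQ_castSucc (c : Fin H × X × A → ℝ) (w : Fin H × X × A → X → ℝ) (h : Fin H) (x : X)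
    (a : A) :
    affineQ c w h.castSucc x a = c (h, x, a) + ∑ x', w (h, x, a) x' * affineV c w h.succ x' := by
  rw [affineQ, Fin.reverseInduction_castSucc]
  rfl

/-- The recursion runs backwards, so its value at `t` sees only the data of steps at or after `t`.
-/
lemma affineQ_congr {c c' : Fin H × X × A → ℝ} {w w' : Fin H × X × A → X → ℝ} (t : Fin (H + 1))
    (hc : ∀ i, t ≤ i.1.castSucc → c i = c' i) (hw : ∀ i, t ≤ i.1.castSucc → w i = w' i) :
    affineQ c w t = affineQ c' w' t := by
  induction t using Fin.reverseInduction with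
  | last => ext x a; simp [affineQ_last]
  | cast h ih =>
    have hle : h.castSucc ≤ h.succ := h.castSucc_lt_succ.le
    have := ih (fun i hi => hc i (hle.trans hi)) (fun i hi => hw i (hle.trans hi))
    ext x a
    rw [affineQ_castSucc, affineQ_castSucc, hc _ le_rfl, hw _ le_rfl]
    simp only [affineV, this]

lemma affineV_congr {c c' : Fin H × X × A → ℝ} {w w' : Fin H × X × A → X → ℝ} (t : Fin (H + 1))
    (hc : ∀ i, t ≤ i.1.castSucc → c i = c' i) (hw : ∀ i, t ≤ i.1.castSucc → w i = w' i) :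
    affineV c w t = affineV c' w' t := by
  ext x
  simp only [affineV, affineQ_congr t hc hw]

/-- The update at one index may be replaced by its value. -/
lemma affineQ_update [DecidableEq X] [DecidableEq A] (c : Fin H × X × A → ℝ)
    (w : Fin H × X × A → X → ℝ) (i : Fin H × X × A) (t : Fin (H + 1)) :
    affineQ (Function.update c i (c i + ∑ x', w i x' * affineV c w i.1.succ x'))
      (Function.update w i 0) t = affineQ c w t := by
  induction t using Fin.reverseInduction with
  | last => ext x a; simp [affineQ_last]
  | cast h ih =>
    ext x a
    rw [affineQ_castSucc, affineQ_castSucc]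
    by_cases hi : (h, x, a) = i
    · subst hi; simp
    · rw [Function.update_of_ne hi, Function.update_of_ne hi]
      congr 1
      refine Finset.sum_congr rfl fun x' _ => ?_
      congr 1
      change ⨆ a, affineQ _ _ _ x' a = _
      rw [ih]
      rfl

variable [Fintype A] [Nonempty A]

omit [Nonempty A] in
lemma le_iSup_fintype (f : A → ℝ) (a : A) : f a ≤ ⨆ a, f a :=
  le_ciSup (Set.finite_range f).bddAbove a

omit [Nonempty A] in
lemma affineQ_le_affineV (c : Fin H × X × A → ℝ) (w : Fin H × X × A → X → ℝ) (t : Fin (H + 1))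
    (x : X) (a : A) : affineQ c w t x a ≤ affineV c w t x :=
  le_iSup_fintype (affineQ c w t x) a

omit [Fintype A] in
lemma affineV_last (c : Fin H × X × A → ℝ) (w : Fin H × X × A → X → ℝ) :
    affineV c w (Fin.last H) = 0 := by
  ext x; simp [affineV, affineQ_last]

omit [Nonempty A] in
lemma affineQ_mono {c c' : Fin H × X × A → ℝ} {w : Fin H × X × A → X → ℝ} (hw : ∀ i x, 0 ≤ w i x)
    (hc : c ≤ c') (t : Fin (H + 1)) (x : X) (a : A) : affineQ c w t x a ≤ affineQ c' w t x a := by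
  induction t using Fin.reverseInduction generalizing x a with
  | last => simp [affineQ_last]
  | cast h ih =>
    rw [affineQ_castSucc, affineQ_castSucc]
    refine add_le_add (hc _) (Finset.sum_le_sum fun x' _ => mul_le_mul_of_nonneg_left ?_ (hw _ _))
    exact ciSup_mono (Set.finite_range _).bddAbove fun a => ih x' a

omit [Nonempty A] in
lemma affineV_mono {c c' : Fin H × X × A → ℝ} {w : Fin H × X × A → X → ℝ} (hw : ∀ i x, 0 ≤ w i x)
    (hc : c ≤ c') (t : Fin (H + 1)) (x : X) : affineV c w t x ≤ affineV c' w t x :=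
  ciSup_mono (Set.finite_range _).bddAbove fun a => affineQ_mono hw hc t x a

/-- Nonnegative combinations and maxima preserve convexity. The recursion is also positively
homogeneous in `c`, so `s + r = 1` is not needed. -/
lemma affineQ_convex {c c' : Fin H × X × A → ℝ} {w : Fin H × X × A → X → ℝ}
    (hw : ∀ i x, 0 ≤ w i x) {s r : ℝ} (hs : 0 ≤ s) (hr : 0 ≤ r) (t : Fin (H + 1)) (x : X) (a : A) :
    affineQ (fun i => s * c i + r * c' i) w t x a
      ≤ s * affineQ c w t x a + r * affineQ c' w t x a := by
  induction t using Fin.reverseInduction generalizing x a with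
  | last => simp [affineQ_last]
  | cast h ih =>
    rw [affineQ_castSucc, affineQ_castSucc, affineQ_castSucc]
    have : ∀ x', w (h, x, a) x' * affineV (fun i => s * c i + r * c' i) w h.succ x'
        ≤ s * (w (h, x, a) x' * affineV c w h.succ x')
          + r * (w (h, x, a) x' * affineV c' w h.succ x') := by
      intro x'
      have h1 : affineV (fun i => s * c i + r * c' i) w h.succ x'
          ≤ s * affineV c w h.succ x' + r * affineV c' w h.succ x' :=
        ciSup_le fun a' => (ih x' a').trans (add_le_add
          (mul_le_mul_of_nonneg_left (affineQ_le_affineV _ _ _ _ _) hs)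
          (mul_le_mul_of_nonneg_left (affineQ_le_affineV _ _ _ _ _) hr))
      refine (mul_le_mul_of_nonneg_left h1 (hw _ _)).trans (le_of_eq ?_)
      ring
    have := Finset.sum_le_sum fun x' (_ : x' ∈ Finset.univ) => this x'
    rw [Finset.sum_add_distrib, ← Finset.mul_sum, ← Finset.mul_sum] at this
    linarith

lemma affineV_convex {c c' : Fin H × X × A → ℝ} {w : Fin H × X × A → X → ℝ}
    (hw : ∀ i x, 0 ≤ w i x) {s r : ℝ} (hs : 0 ≤ s) (hr : 0 ≤ r) (t : Fin (H + 1)) (x : X) :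
    affineV (fun i => s * c i + r * c' i) w t x ≤ s * affineV c w t x + r * affineV c' w t x :=
  ciSup_le fun a' => (affineQ_convex hw hs hr t x a').trans (add_le_add
    (mul_le_mul_of_nonneg_left (affineQ_le_affineV _ _ _ _ _) hs)
    (mul_le_mul_of_nonneg_left (affineQ_le_affineV _ _ _ _ _) hr))

/-- The condition on `c` covers two kinds of index: one whose constant moves by `δ` but whose
weights vanish, and one with the same constant and weights of mass at most one. The perturbation
therefore does not accumulate over the steps, which gives Lipschitz constant `1`. -/
lemma affineQ_le_add {c c' : Fin H × X × A → ℝ} {w : Fin H × X × A → X → ℝ}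
    (hw : ∀ i x, 0 ≤ w i x) {δ : ℝ} (hδ : 0 ≤ δ) (hc : ∀ i, c i + δ * ∑ x, w i x ≤ c' i + δ)
    (t : Fin (H + 1)) (x : X) (a : A) :
    affineQ c w t x a ≤ affineQ c' w t x a + δ := by
  induction t using Fin.reverseInduction generalizing x a with
  | last => simpa [affineQ_last] using hδ
  | cast h ih =>
    rw [affineQ_castSucc, affineQ_castSucc]
    have : ∀ x', w (h, x, a) x' * affineV c w h.succ x'
        ≤ w (h, x, a) x' * affineV c' w h.succ x' + δ * w (h, x, a) x' := by
      intro x'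
      have h1 : affineV c w h.succ x' ≤ affineV c' w h.succ x' + δ :=
        ciSup_le fun a' => (ih x' a').trans (add_le_add_left (affineQ_le_affineV _ _ _ _ _) δ)
      refine (mul_le_mul_of_nonneg_left h1 (hw _ _)).trans (le_of_eq ?_)
      ring
    have := Finset.sum_le_sum fun x' (_ : x' ∈ Finset.univ) => this x'
    rw [Finset.sum_add_distrib, ← Finset.mul_sum] at this
    linarith [hc (h, x, a)]

lemma affineV_le_add {c c' : Fin H × X × A → ℝ} {w : Fin H × X × A → X → ℝ}
    (hw : ∀ i x, 0 ≤ w i x) {δ : ℝ} (hδ : 0 ≤ δ) (hc : ∀ i, c i + δ * ∑ x, w i x ≤ c' i + δ)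
    (t : Fin (H + 1)) (x : X) : affineV c w t x ≤ affineV c' w t x + δ :=
  ciSup_le fun a' => (affineQ_le_add hw hδ hc t x a').trans
    (add_le_add_left (affineQ_le_affineV _ _ _ _ _) δ)

omit [Fintype A] in
lemma affineQ_le {c : Fin H × X × A → ℝ} {w : Fin H × X × A → X → ℝ}
    (hw : ∀ i x, 0 ≤ w i x) (hw1 : ∀ i, ∑ x, w i x ≤ 1) {C : ℝ} (hC : 0 ≤ C) (hc : ∀ i, c i ≤ C)
    (t : Fin (H + 1)) (x : X) (a : A) : affineQ c w t x a ≤ ((H : ℝ) - (t : ℕ)) * C := by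
  induction t using Fin.reverseInduction generalizing x a with
  | last => simp [affineQ_last]
  | cast h ih =>
    rw [affineQ_castSucc]
    have hpos : (0 : ℝ) ≤ ((H : ℝ) - (h.succ : ℕ)) * C := by
      refine mul_nonneg (sub_nonneg.mpr ?_) hC
      exact_mod_cast h.succ.is_le
    have : ∀ x', w (h, x, a) x' * affineV c w h.succ x'
        ≤ w (h, x, a) x' * (((H : ℝ) - (h.succ : ℕ)) * C) :=
      fun x' => mul_le_mul_of_nonneg_left (ciSup_le fun a' => ih x' a') (hw _ _)
    have := Finset.sum_le_sum fun x' (_ : x' ∈ Finset.univ) => this x'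
    rw [← Finset.sum_mul] at this
    have h2 := mul_le_mul_of_nonneg_right (hw1 (h, x, a)) hpos
    have h3 : ((h.succ : ℕ) : ℝ) = (h.castSucc : ℕ) + 1 := by simp
    rw [h3] at h2 this
    linarith [hc (h, x, a)]

omit [Fintype A] in
lemma affineV_le {c : Fin H × X × A → ℝ} {w : Fin H × X × A → X → ℝ}
    (hw : ∀ i x, 0 ≤ w i x) (hw1 : ∀ i, ∑ x, w i x ≤ 1) {C : ℝ} (hC : 0 ≤ C) (hc : ∀ i, c i ≤ C)
    (t : Fin (H + 1)) (x : X) : affineV c w t x ≤ ((H : ℝ) - (t : ℕ)) * C :=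
  ciSup_le fun a => affineQ_le hw hw1 hC hc t x a

lemma le_affineQ {c : Fin H × X × A → ℝ} {w : Fin H × X × A → X → ℝ}
    (hw : ∀ i x, 0 ≤ w i x) (hw1 : ∀ i, ∑ x, w i x ≤ 1) {C : ℝ} (hC : 0 ≤ C) (hc : ∀ i, -C ≤ c i)
    (t : Fin (H + 1)) (x : X) (a : A) : -(((H : ℝ) - (t : ℕ)) * C) ≤ affineQ c w t x a := by
  induction t using Fin.reverseInduction generalizing x a with
  | last => simp [affineQ_last]
  | cast h ih =>
    rw [affineQ_castSucc]
    have hpos : (0 : ℝ) ≤ ((H : ℝ) - (h.succ : ℕ)) * C := by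
      refine mul_nonneg (sub_nonneg.mpr ?_) hC
      exact_mod_cast h.succ.is_le
    have : ∀ x', w (h, x, a) x' * -(((H : ℝ) - (h.succ : ℕ)) * C)
        ≤ w (h, x, a) x' * affineV c w h.succ x' :=
      fun x' => mul_le_mul_of_nonneg_left ((ih x' (Classical.arbitrary A)).trans
        (affineQ_le_affineV _ _ _ _ _)) (hw _ _)
    have := Finset.sum_le_sum fun x' (_ : x' ∈ Finset.univ) => this x'
    rw [← Finset.sum_mul] at this
    have h2 := mul_le_mul_of_nonneg_right (hw1 (h, x, a)) hpos
    have h3 : ((h.succ : ℕ) : ℝ) = (h.castSucc : ℕ) + 1 := by simp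
    rw [h3] at h2 this
    linarith [hc (h, x, a)]

lemma le_affineV {c : Fin H × X × A → ℝ} {w : Fin H × X × A → X → ℝ}
    (hw : ∀ i x, 0 ≤ w i x) (hw1 : ∀ i, ∑ x, w i x ≤ 1) {C : ℝ} (hC : 0 ≤ C) (hc : ∀ i, -C ≤ c i)
    (t : Fin (H + 1)) (x : X) : -(((H : ℝ) - (t : ℕ)) * C) ≤ affineV c w t x :=
  (le_affineQ hw hw1 hC hc t x (Classical.arbitrary A)).trans (affineQ_le_affineV _ _ _ _ _)

lemma abs_affineV_le {c : Fin H × X × A → ℝ} {w : Fin H × X × A → X → ℝ}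
    (hw : ∀ i x, 0 ≤ w i x) (hw1 : ∀ i, ∑ x, w i x ≤ 1) {C : ℝ} (hC : 0 ≤ C) (hc : ∀ i, |c i| ≤ C)
    (t : Fin (H + 1)) (x : X) : |affineV c w t x| ≤ H * C := by
  have h1 := affineV_le hw hw1 hC (fun i => (abs_le.mp (hc i)).2) t x
  have h2 := le_affineV hw hw1 hC (fun i => (abs_le.mp (hc i)).1) t x
  have h3 : (0 : ℝ) ≤ (t : ℕ) * C := by positivity
  rw [abs_le]
  constructor <;> linarith

lemma continuous_iSup_fintype {Ω : Type*} [TopologicalSpace Ω] {f : Ω → A → ℝ}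
    (hf : ∀ a, Continuous fun ω => f ω a) : Continuous fun ω => ⨆ a, f ω a := by
  simp_rw [← Finset.sup'_univ_eq_ciSup]
  exact Continuous.finset_sup'_apply _ fun a _ => hf a

lemma continuous_affineQ {Ω : Type*} [TopologicalSpace Ω] {c : Ω → Fin H × X × A → ℝ}
    {w : Ω → Fin H × X × A → X → ℝ} (hc : ∀ i, Continuous fun ω => c ω i)
    (hw : ∀ i x, Continuous fun ω => w ω i x) (t : Fin (H + 1)) (x : X) (a : A) :
    Continuous fun ω => affineQ (c ω) (w ω) t x a := by
  induction t using Fin.reverseInduction generalizing x a with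
  | last => simpa only [affineQ_last] using continuous_const
  | cast h ih =>
    simp_rw [affineQ_castSucc]
    exact (hc _).add (continuous_finsetSum _ fun x' _ =>
      (hw _ _).mul (continuous_iSup_fintype fun a' => ih x' a'))

lemma continuous_affineV {Ω : Type*} [TopologicalSpace Ω] {c : Ω → Fin H × X × A → ℝ}
    {w : Ω → Fin H × X × A → X → ℝ} (hc : ∀ i, Continuous fun ω => c ω i)
    (hw : ∀ i x, Continuous fun ω => w ω i x) (t : Fin (H + 1)) (x : X) :
    Continuous fun ω => affineV (c ω) (w ω) t x :=
  continuous_iSup_fintype fun a => continuous_affineQ hc hw t x a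

/-! #### The value as a function of one update -/

variable [DecidableEq X] [DecidableEq A] (c : Fin H × X × A → ℝ) {w : Fin H × X × A → X → ℝ}
  (i : Fin H × X × A) (t : Fin (H + 1)) (x : X)

omit [Fintype X] [Fintype A] [Nonempty A] in
lemma update_zero_nonneg (hw : ∀ i x, 0 ≤ w i x) (j : Fin H × X × A) (x : X) :
    0 ≤ Function.update w i 0 j x := by
  by_cases h : j = i
  · subst h; simp
  · rw [Function.update_of_ne h]; exact hw j x

omit [Nonempty A] in
lemma monotone_affineV_update (hw : ∀ i x, 0 ≤ w i x) :
    Monotone fun y => affineV (Function.update c i y) (Function.update w i 0) t x := fun _ _ h =>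
  affineV_mono (update_zero_nonneg i hw)
    (update_le_update_iff.mpr ⟨h, fun _ _ => le_rfl⟩) t x

lemma convexOn_affineV_update (hw : ∀ i x, 0 ≤ w i x) :
    ConvexOn ℝ Set.univ fun y => affineV (Function.update c i y) (Function.update w i 0) t x := by
  refine ⟨convex_univ, fun y _ y' _ s r hs hr hsr => ?_⟩
  have h := affineV_convex (c := Function.update c i y) (c' := Function.update c i y')
    (update_zero_nonneg i hw) hs hr t x
  have e : (fun j => s * Function.update c i y j + r * Function.update c i y' j)
      = Function.update c i (s * y + r * y') := by
    ext j
    by_cases hj : j = i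
    · subst hj; simp
    · simp only [Function.update_of_ne hj]; rw [← add_mul, hsr, one_mul]
  rw [e] at h
  exact h

lemma lipschitz_affineV_update (hw : ∀ i x, 0 ≤ w i x) (hw1 : ∀ i, ∑ x, w i x ≤ 1) :
    LipschitzWith 1 fun y => affineV (Function.update c i y) (Function.update w i 0) t x := by
  have key : ∀ y y', affineV (Function.update c i y) (Function.update w i 0) t x
      ≤ affineV (Function.update c i y') (Function.update w i 0) t x + |y - y'| := by
    intro y y'
    refine affineV_le_add (update_zero_nonneg i hw) (abs_nonneg _) (fun j => ?_) t x
    by_cases hj : j = i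
    · subst hj
      simp only [Function.update_self, Pi.zero_apply, Finset.sum_const_zero, mul_zero, add_zero]
      linarith [le_abs_self (y - y')]
    · simp only [Function.update_of_ne hj]
      have := mul_le_mul_of_nonneg_left (hw1 j) (abs_nonneg (y - y'))
      linarith
  refine LipschitzWith.of_dist_le_mul fun y y' => ?_
  simp only [Real.dist_eq, NNReal.coe_one, one_mul]
  rw [abs_le]
  have h1 := key y y'
  have h2 := key y' y
  rw [abs_sub_comm] at h2
  constructor <;> linarith

end Affine

/-! ### Resampling one coordinate of a product measure -/

lemma integral_eq_of_measurePreserving {Ω Ω' : Type*} [MeasurableSpace Ω] [MeasurableSpace Ω']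
    {μ : Measure Ω} {ν : Measure Ω'} {φ : Ω → Ω'} (hφ : MeasurePreserving φ μ ν) {f : Ω' → ℝ}
    (hf : AEStronglyMeasurable f ν) : ∫ y, f y ∂ν = ∫ x, f (φ x) ∂μ := by
  rw [← hφ.map_eq] at hf ⊢
  exact integral_map hφ.measurable.aemeasurable hf

lemma measurable_update_prod {ι E : Type*} [DecidableEq ι] [MeasurableSpace E] (i : ι) :
    Measurable fun p : (ι → E) × E => Function.update p.1 i p.2 := by
  refine measurable_pi_lambda _ fun j => ?_
  by_cases hj : j = i
  · subst hj; simpa using measurable_snd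
  · simp only [Function.update_of_ne hj]
    exact (measurable_pi_apply j).comp measurable_fst

lemma measurePreserving_update {ι E : Type*} [Fintype ι] [DecidableEq ι] [MeasurableSpace E]
    (μ : ι → Measure E) [∀ i, IsProbabilityMeasure (μ i)] (i : ι) :
    MeasurePreserving (fun p : (ι → E) × E => Function.update p.1 i p.2)
      ((Measure.pi μ).prod (μ i)) (Measure.pi μ) where
  measurable := measurable_update_prod i
  map_eq := by
    refine (Measure.pi_eq fun s hs => ?_).symm
    rw [Measure.map_apply (measurable_update_prod i) (MeasurableSet.univ_pi hs)]
    have e : (fun p : (ι → E) × E => Function.update p.1 i p.2) ⁻¹' Set.univ.pi s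
        = (Set.univ.pi (Function.update s i Set.univ)) ×ˢ s i := by
      ext p
      simp only [Set.mem_preimage, Set.mem_pi, Set.mem_univ, forall_true_left, Set.mem_prod]
      constructor
      · intro h
        refine ⟨fun j => ?_, by simpa using h i⟩
        by_cases hj : j = i
        · subst hj; simp
        · simpa [hj] using h j
      · rintro ⟨h1, h2⟩ j
        by_cases hj : j = i
        · subst hj; simpa using h2
        · simpa [hj] using h1 j
    rw [e, Measure.prod_prod, Measure.pi_pi, ← Finset.mul_prod_erase _ _ (Finset.mem_univ i),
      ← Finset.mul_prod_erase Finset.univ (fun j => μ j (s j)) (Finset.mem_univ i)]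
    simp only [Function.update_self, measure_univ, one_mul]
    rw [mul_comm]
    congr 1
    refine Finset.prod_congr rfl fun j hj => ?_
    rw [Function.update_of_ne (Finset.ne_of_mem_erase hj)]

/-- Integrals over a product can be compared by resampling one coordinate. -/
lemma integral_pi_le_of_update {ι E : Type*} [Fintype ι] [DecidableEq ι] [MeasurableSpace E]
    (μ : ι → Measure E) [∀ i, IsProbabilityMeasure (μ i)] (i : ι) {f g : (ι → E) → ℝ}
    (hf : Integrable f (Measure.pi μ)) (hg : Integrable g (Measure.pi μ))
    (h : ∀ x, ∫ y, f (Function.update x i y) ∂μ i ≤ ∫ y, g (Function.update x i y) ∂μ i) :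
    ∫ x, f x ∂Measure.pi μ ≤ ∫ x, g x ∂Measure.pi μ := by
  have hmp := measurePreserving_update μ i
  have key : ∀ {f : (ι → E) → ℝ}, Integrable f (Measure.pi μ) →
      Integrable (fun p : (ι → E) × E => f (Function.update p.1 i p.2))
        ((Measure.pi μ).prod (μ i)) ∧
      ∫ x, f x ∂Measure.pi μ = ∫ x, ∫ y, f (Function.update x i y) ∂μ i ∂Measure.pi μ := by
    intro f hf
    have hi : Integrable (fun p : (ι → E) × E => f (Function.update p.1 i p.2))
        ((Measure.pi μ).prod (μ i)) := hmp.integrable_comp_of_integrable hf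
    refine ⟨hi, ?_⟩
    rw [integral_eq_of_measurePreserving hmp hf.aestronglyMeasurable, integral_prod _ hi]
  rw [(key hf).2, (key hg).2]
  exact integral_mono (key hf).1.integral_prod_left (key hg).1.integral_prod_left h

/-! ### Stochastic optimism of the sampled value functions -/

section Optimism

variable {H n : ℕ} {X A : Type*} [Fintype X]

/-- The expected reward of an outcome distribution. -/
def meanReward (q : stdSimplex ℝ (Outcome X)) : ℝ := ∑ o, q o * rew o.1

/-- The distribution of the next state. -/
def nextState (q : stdSimplex ℝ (Outcome X)) (x : X) : ℝ := ∑ r, q (r, x)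

lemma sum_outcome_eq (q : stdSimplex ℝ (Outcome X)) (V : X → ℝ) :
    ∑ o, q o * (rew o.1 + V o.2) = meanReward q + ∑ x, nextState q x * V x := by
  simp_rw [mul_add, Finset.sum_add_distrib, meanReward, nextState, Finset.sum_mul]
  congr 1
  rw [Fintype.sum_prod_type, Finset.sum_comm]

lemma nextState_nonneg (q : stdSimplex ℝ (Outcome X)) (x : X) : 0 ≤ nextState q x :=
  Finset.sum_nonneg fun _ _ => stdSimplex.zero_le _ _

lemma sum_nextState (q : stdSimplex ℝ (Outcome X)) : ∑ x, nextState q x = 1 := by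
  unfold nextState
  rw [Finset.sum_comm, ← Fintype.sum_prod_type, stdSimplex.sum_eq_one]

lemma meanReward_nonneg (q : stdSimplex ℝ (Outcome X)) : 0 ≤ meanReward q :=
  Finset.sum_nonneg fun _ _ => mul_nonneg (stdSimplex.zero_le _ _) (rew_nonneg _)

lemma meanReward_le_one (q : stdSimplex ℝ (Outcome X)) : meanReward q ≤ 1 := by
  rw [← stdSimplex.sum_eq_one q]
  exact Finset.sum_le_sum fun o _ => mul_le_of_le_one_right (stdSimplex.zero_le _ _) (rew_le_one _)

lemma continuous_meanReward : Continuous (meanReward (X := X)) := continuous_expectation _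

lemma continuous_nextState (x : X) : Continuous fun q : stdSimplex ℝ (Outcome X) => nextState q x :=
  continuous_finsetSum _ fun r _ => continuous_coord (r, x)

variable [DecidableEq X] [DecidableEq A] (p : Params) (hist : Fin n → Episode H X A)

/-- The number of visits to an index. -/
abbrev visitCount (i : Fin H × X × A) : ℕ := (visits hist i.1 i.2.1 i.2.2).card

/-- The sampled update at an index, without the values of the next states. -/
def sampleReward (i : Fin H × X × A) (ζ : ℝ) : ℝ :=
  (∑ j ∈ visits hist i.1 i.2.1 i.2.2, rew ((hist j).outcome i.1).1 + p.weight * p.θbar)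
    / (visitCount hist i + p.weight) + m p hist i.1 i.2.1 i.2.2 * ζ

/-- The weights of the next states in the sampled update. -/
def sampleNext (i : Fin H × X × A) (x : X) : ℝ :=
  (∑ j ∈ visits hist i.1 i.2.1 i.2.2, if ((hist j).outcome i.1).2 = x then 1 else 0)
    / (visitCount hist i + p.weight)

omit [Fintype X] in
lemma sampleNext_nonneg (hw : 0 ≤ p.weight) (i : Fin H × X × A) (x : X) :
    0 ≤ sampleNext p hist i x :=
  div_nonneg (Finset.sum_nonneg fun _ _ => by split_ifs <;> norm_num) (by positivity)

lemma sum_sampleNext_mul (i : Fin H × X × A) (V : X → ℝ) :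
    ∑ x, sampleNext p hist i x * V x
      = (∑ j ∈ visits hist i.1 i.2.1 i.2.2, V ((hist j).outcome i.1).2)
        / (visitCount hist i + p.weight) := by
  simp_rw [sampleNext, div_mul_eq_mul_div, ← Finset.sum_div, Finset.sum_mul]
  rw [Finset.sum_comm]
  simp

/-- The mass is `n / (n + β)`; the prior target holds the rest. -/
lemma sum_sampleNext_le_one (hw : 0 < p.weight) (i : Fin H × X × A) :
    ∑ x, sampleNext p hist i x ≤ 1 := by
  have := sum_sampleNext_mul p hist i fun _ => 1
  simp only [mul_one, Finset.sum_const, nsmul_eq_mul] at this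
  rw [this, div_le_one (by positivity)]
  linarith

/-- Grouping the data by next state brings the agent's update into the same affine form as the
Bellman recursion of a model. -/
lemma sampledQ_eq_affineQ (z : Fin H × X × A → ℝ) :
    sampledQ p hist z = affineQ (fun i => sampleReward p hist i (z i)) (sampleNext p hist) := by
  funext t
  induction t using Fin.reverseInduction with
  | last => simp [sampledQ, affineQ]
  | cast h ih =>
    ext x a
    rw [affineQ_castSucc, sum_sampleNext_mul, sampledQ, Fin.reverseInduction_castSucc]
    change nu p hist (sampledQ p hist z h.succ) h x a + _ = _
    rw [ih, nu, sampleReward, Finset.sum_add_distrib]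
    simp only [affineV]
    ring

variable [Fintype A] [Nonempty A]

/-- The sampled state values. -/
def sampledV (z : Fin H × X × A → ℝ) : Fin (H + 1) → X → ℝ :=
  affineV (fun i => sampleReward p hist i (z i)) (sampleNext p hist)

lemma continuous_sampledQ (t : Fin (H + 1)) (x : X) (a : A) :
    Continuous fun z => sampledQ p hist z t x a := by
  simp_rw [sampledQ_eq_affineQ]
  refine continuous_affineQ (c := fun (z : Fin H × X × A → ℝ) i => sampleReward p hist i (z i))
    (w := fun _ => sampleNext p hist) (fun i => ?_) (fun i x => continuous_const) t x a
  unfold sampleReward; fun_prop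

lemma continuous_sampledV (t : Fin (H + 1)) (x : X) :
    Continuous fun z => sampledV p hist z t x := by
  refine continuous_affineV (c := fun (z : Fin H × X × A → ℝ) i => sampleReward p hist i (z i))
    (w := fun _ => sampleNext p hist) (fun i => ?_) (fun i x => continuous_const) t x
  unfold sampleReward; fun_prop

/-- The updates that are sampled at the indices in `S` and those of the model elsewhere. -/
def mixReward (S : Finset (Fin H × X × A)) (D : Fin H × X × A → stdSimplex ℝ (Outcome X) × ℝ)
    (i : Fin H × X × A) : ℝ :=
  if i ∈ S then sampleReward p hist i (D i).2 else meanReward (D i).1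

/-- The weights of the next states for `mixReward`. -/
def mixNext (S : Finset (Fin H × X × A)) (D : Fin H × X × A → stdSimplex ℝ (Outcome X) × ℝ)
    (i : Fin H × X × A) : X → ℝ :=
  if i ∈ S then sampleNext p hist i else nextState (D i).1

omit [Nonempty A] in
omit [Fintype A] in
lemma mixReward_empty (D : Fin H × X × A → stdSimplex ℝ (Outcome X) × ℝ) :
    mixReward p hist ∅ D = fun i => meanReward (D i).1 := by
  ext i; simp [mixReward]

omit [Nonempty A] in
omit [Fintype A] in
lemma mixNext_empty (D : Fin H × X × A → stdSimplex ℝ (Outcome X) × ℝ) :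
    mixNext p hist ∅ D = fun i => nextState (D i).1 := by
  ext i; simp [mixNext]

omit [Nonempty A] in
lemma mixReward_univ (D : Fin H × X × A → stdSimplex ℝ (Outcome X) × ℝ) :
    mixReward p hist Finset.univ D = fun i => sampleReward p hist i (D i).2 := by
  ext i; simp [mixReward]

omit [Nonempty A] in
lemma mixNext_univ (D : Fin H × X × A → stdSimplex ℝ (Outcome X) × ℝ) :
    mixNext p hist Finset.univ D = sampleNext p hist := by
  ext i; simp [mixNext]

omit [Fintype A] [Nonempty A] in
lemma mixNext_nonneg (hw : 0 ≤ p.weight) (S : Finset (Fin H × X × A))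
    (D : Fin H × X × A → stdSimplex ℝ (Outcome X) × ℝ) (i : Fin H × X × A) (x : X) :
    0 ≤ mixNext p hist S D i x := by
  unfold mixNext
  split_ifs
  exacts [sampleNext_nonneg p hist hw i x, nextState_nonneg _ _]

omit [Fintype A] [Nonempty A] in
lemma sum_mixNext_le_one (hw : 0 < p.weight) (S : Finset (Fin H × X × A))
    (D : Fin H × X × A → stdSimplex ℝ (Outcome X) × ℝ) (i : Fin H × X × A) :
    ∑ x, mixNext p hist S D i x ≤ 1 := by
  unfold mixNext
  split_ifs
  exacts [sum_sampleNext_le_one p hist hw i, (sum_nextState _).le]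

lemma continuous_mixed (S : Finset (Fin H × X × A)) (t : Fin (H + 1)) (x : X) :
    Continuous fun D : Fin H × X × A → stdSimplex ℝ (Outcome X) × ℝ =>
      affineV (mixReward p hist S D) (mixNext p hist S D) t x := by
  refine continuous_affineV (fun i => ?_) (fun i x => ?_) t x
  · unfold mixReward
    split_ifs
    · unfold sampleReward; fun_prop
    · exact continuous_meanReward.comp (continuous_fst.comp (continuous_apply i))
  · unfold mixNext
    split_ifs
    · exact continuous_const
    · exact (continuous_nextState x).comp (continuous_fst.comp (continuous_apply i))

/-- The joint law of the posterior model and of the indices of the agent. -/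
abbrev jointLaw (α : Fin H × X × A → Outcome X → ℝ) :
    Measure (Fin H × X × A → stdSimplex ℝ (Outcome X) × ℝ) :=
  Measure.pi fun i => (dirichlet (α i)).prod (gaussianReal 0 1)

variable [Nonempty X]

lemma integrable_mixed (hw : 0 < p.weight) {α : Fin H × X × A → Outcome X → ℝ}
    (hα : ∀ i o, 0 < α i o) (S : Finset (Fin H × X × A)) (t : Fin (H + 1)) (x : X) :
    Integrable (fun D => affineV (mixReward p hist S D) (mixNext p hist S D) t x) (jointLaw α) := by
  have := fun i => isProbabilityMeasure_dirichlet (hα i)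
  have hi : ∀ i : Fin H × X × A, Integrable (fun D : Fin H × X × A → stdSimplex ℝ (Outcome X) × ℝ =>
      1 + |sampleReward p hist i (D i).2|) (jointLaw α) := by
    intro i
    have h1 : Integrable (fun ζ => 1 + |sampleReward p hist i ζ|) (gaussianReal 0 1) := by
      unfold sampleReward
      exact (integrable_const _).add
        ((integrable_const _).add (integrable_id_gaussian.const_mul _)).abs
    exact (measurePreserving_snd.comp (measurePreserving_eval
      (fun i => (dirichlet (α i)).prod (gaussianReal 0 1)) i)).integrable_comp_of_integrable h1
  have hI := (integrable_finsetSum Finset.univ fun i _ => hi i).const_mul (H : ℝ)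
  refine hI.mono' (continuous_mixed p hist S t x).aestronglyMeasurable
    (Filter.Eventually.of_forall fun D => ?_)
  refine abs_affineV_le (mixNext_nonneg p hist hw.le S D) (sum_mixNext_le_one p hist hw S D)
    (Finset.sum_nonneg fun i _ => by positivity) (fun i => ?_) t x
  have h1 : |mixReward p hist S D i| ≤ 1 + |sampleReward p hist i (D i).2| := by
    unfold mixReward
    split_ifs
    · linarith
    · rw [abs_of_nonneg (meanReward_nonneg _)]
      linarith [meanReward_le_one (D i).1, abs_nonneg (sampleReward p hist i (D i).2)]
  exact h1.trans (Finset.single_le_sum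
    (f := fun i => 1 + |sampleReward p hist i (D i).2|) (fun i _ => by positivity)
    (Finset.mem_univ i))

/-- One exchange of the hybrid argument. With everything outside index `i` fixed, the value at step
0 is an increasing convex 1-Lipschitz function `u` of the scalar update at `i`, so
`dirichlet_le_gaussian` applies to that update alone. As `S` contains no later step, the
continuation values come from the model and are bounded. -/
lemma mixed_le_mixed_insert (hw : 0 < p.weight) (hθ : p.θbar = H)
    {α₀ : Fin H × X × A → Outcome X → ℝ} (hα₀ : ∀ i o, 0 < α₀ i o)
    (hsum : ∀ i, ∑ o, α₀ i o = p.weight)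
    (hm : ∀ i : Fin H × X × A, Real.sqrt 3 * ((H : ℝ) / Real.sqrt (p.weight + visitCount hist i))
      ≤ m p hist i.1 i.2.1 i.2.2)
    (S : Finset (Fin H × X × A)) (i : Fin H × X × A) (hi : i ∉ S) (hS : ∀ j ∈ S, j.1 ≤ i.1) (x : X) :
    ∫ D, affineV (mixReward p hist S D) (mixNext p hist S D) 0 x ∂jointLaw (postParam α₀ hist)
      ≤ ∫ D, affineV (mixReward p hist (insert i S) D) (mixNext p hist (insert i S) D) 0 x
        ∂jointLaw (postParam α₀ hist) := by
  have hα := postParam_pos hα₀ hist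
  have := fun i => isProbabilityMeasure_dirichlet (hα i)
  refine integral_pi_le_of_update _ i (integrable_mixed p hist hw hα S 0 x)
    (integrable_mixed p hist hw hα (insert i S) 0 x) fun D => ?_
  set c := mixReward p hist S D with hc
  set w := mixNext p hist S D with hwdef
  set v := affineV c w i.1.succ with hv
  set u : ℝ → ℝ := fun y => affineV (Function.update c i y) (Function.update w i 0) 0 x with hu
  have hwn := mixNext_nonneg p hist hw.le S D
  have hw1 := sum_mixNext_le_one p hist hw S D
  -- Hence the continuation `v` involves no sampled update and does not change when the data at `i`
  -- are resampled.
  have hlater : ∀ j : Fin H × X × A, i.1.succ ≤ j.1.castSucc → j ≠ i ∧ j ∉ S := by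
    intro j hj
    have hlt : i.1 < j.1 := by
      rw [Fin.le_def] at hj; rw [Fin.lt_def]
      simp only [Fin.val_succ, Fin.val_castSucc] at hj
      omega
    exact ⟨fun h => by simp [h] at hlt, fun h => absurd (hS j h) (not_le.mpr hlt)⟩
  have hv0 : ∀ x', 0 ≤ v x' := by
    intro x'
    have : v = affineV (fun j => meanReward (D j).1) w i.1.succ :=
      affineV_congr _ (fun j hj => by rw [hc, mixReward, if_neg (hlater j hj).2]) fun _ _ => rfl
    rw [this]
    have := le_affineV hwn hw1 le_rfl (c := fun j => meanReward (D j).1)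
      (fun j => by simpa using meanReward_nonneg _) i.1.succ x'
    simpa using this
  -- After step `h` at most `H - h - 1` rewards remain, so `rew + v` stays in `[0, H]`, the range to
  -- which the noise is calibrated.
  have hvH : ∀ x', v x' + 1 ≤ H := by
    intro x'
    have : v = affineV (fun j => meanReward (D j).1) w i.1.succ :=
      affineV_congr _ (fun j hj => by rw [hc, mixReward, if_neg (hlater j hj).2]) fun _ _ => rfl
    rw [this]
    have := affineV_le hwn hw1 zero_le_one (c := fun j => meanReward (D j).1)
      (fun j => meanReward_le_one _) i.1.succ x'
    have h2 : ((i.1.succ : ℕ) : ℝ) = (i.1 : ℕ) + 1 := by simp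
    have h3 : (0 : ℝ) ≤ (i.1 : ℕ) := Nat.cast_nonneg _
    rw [h2] at this
    linarith
  -- The data at `i` act only through the scalar fed into `u`: the model's target here, the agent's
  -- update in `hG2`.
  have hG1 : ∀ d : stdSimplex ℝ (Outcome X) × ℝ,
      affineV (mixReward p hist S (Function.update D i d)) (mixNext p hist S (Function.update D i d)) 0 x
        = u (∑ o, d.1 o * (rew o.1 + v o.2)) := by
    intro d
    set c' := mixReward p hist S (Function.update D i d) with hc'
    set w' := mixNext p hist S (Function.update D i d) with hw'
    have hcj : ∀ j, j ≠ i → c' j = c j := fun j hj => by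
      simp only [hc', hc, mixReward, Function.update_of_ne hj]
    have hwj : ∀ j, j ≠ i → w' j = w j := fun j hj => by
      simp only [hw', hwdef, mixNext, Function.update_of_ne hj]
    have hci : c' i = meanReward d.1 := by simp [hc', mixReward, hi]
    have hwi : w' i = nextState d.1 := by simp [hw', mixNext, hi]
    have hv' : affineV c' w' i.1.succ = v :=
      affineV_congr _ (fun j hj => hcj j (hlater j hj).1) fun j hj => hwj j (hlater j hj).1
    have e1 : Function.update c' i (∑ o, d.1 o * (rew o.1 + v o.2))
        = Function.update c i (∑ o, d.1 o * (rew o.1 + v o.2)) := by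
      ext j
      by_cases hj : j = i
      · subst hj; simp
      · simp [hj, hcj]
    have e2 : Function.update w' i 0 = Function.update w i 0 := by
      ext j : 1
      by_cases hj : j = i
      · subst hj; simp
      · simp [hj, hwj]
    have h := affineQ_update c' w' i 0
    rw [hv', hci, hwi, ← sum_outcome_eq, e1, e2] at h
    simp only [hu, affineV, h]
  have hG2 : ∀ d : stdSimplex ℝ (Outcome X) × ℝ,
      affineV (mixReward p hist (insert i S) (Function.update D i d))
        (mixNext p hist (insert i S) (Function.update D i d)) 0 x
        = u (sampleReward p hist i d.2 + ∑ x', sampleNext p hist i x' * v x') := by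
    intro d
    set c' := mixReward p hist (insert i S) (Function.update D i d) with hc'
    set w' := mixNext p hist (insert i S) (Function.update D i d) with hw'
    have hcj : ∀ j, j ≠ i → c' j = c j := fun j hj => by
      simp only [hc', hc, mixReward, Function.update_of_ne hj, Finset.mem_insert, hj, false_or]
    have hwj : ∀ j, j ≠ i → w' j = w j := fun j hj => by
      simp only [hw', hwdef, mixNext, Function.update_of_ne hj, Finset.mem_insert, hj, false_or]
    have hci : c' i = sampleReward p hist i d.2 := by simp [hc', mixReward]
    have hwi : w' i = sampleNext p hist i := by simp [hw', mixNext]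
    have hv' : affineV c' w' i.1.succ = v :=
      affineV_congr _ (fun j hj => hcj j (hlater j hj).1) fun j hj => hwj j (hlater j hj).1
    have e1 : ∀ y, Function.update c' i y = Function.update c i y := by
      intro y
      ext j
      by_cases hj : j = i
      · subst hj; simp
      · simp [hj, hcj]
    have e2 : Function.update w' i 0 = Function.update w i 0 := by
      ext j : 1
      by_cases hj : j = i
      · subst hj; simp
      · simp [hj, hwj]
    have h := affineQ_update c' w' i 0
    rw [hv', hci, hwi, e1, e2] at h
    simp only [hu, affineV, h]
  simp_rw [hG1, hG2]
  -- One integrand uses only the Dirichlet component at `i`, the other only the Gaussian component.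
  rw [integral_fun_fst (f := fun q : stdSimplex ℝ (Outcome X) => u (∑ o, q o * (rew o.1 + v o.2))),
    integral_fun_snd (f := fun ζ : ℝ => u (sampleReward p hist i ζ + ∑ x', sampleNext p hist i x' * v x'))]
  simp only [probReal_univ, one_smul]
  have hN : 0 < (visitCount hist i : ℝ) + p.weight := by positivity
  have key := dirichlet_le_gaussian (u := u) (convexOn_affineV_update c i 0 x hwn)
    (lipschitz_affineV_update c i 0 x hwn hw1) (monotone_affineV_update c i 0 x hwn) (hα i)
    (V := fun o => rew o.1 + v o.2) (s := H)
    (fun o => ⟨add_nonneg (rew_nonneg _) (hv0 _), by linarith [rew_le_one o.1, hvH o.2]⟩)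
    (μ := sampleReward p hist i 0 + ∑ x', sampleNext p hist i x' * v x')
    (σ := m p hist i.1 i.2.1 i.2.2) ?_ ?_
  · refine key.trans (le_of_eq ?_)
    congr 1
    ext ζ
    congr 1
    simp only [sampleReward]
    ring
  · rw [normMean, sum_postParam, sum_postParam_mul, hsum, sum_sampleNext_mul, sampleReward,
      mul_zero, add_zero, ← add_div, add_comm p.weight]
    refine (div_le_div_iff_of_pos_right hN).mpr ?_
    -- Optimism of the prior target: the prior mean of `rew + v` is at most `H = θbar`, and the data
    -- terms agree on both sides.
    have h1 : ∑ o, α₀ i o * (rew o.1 + v o.2) ≤ p.weight * p.θbar := by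
      rw [← hsum i, Finset.sum_mul, hθ]
      refine Finset.sum_le_sum fun o _ => mul_le_mul_of_nonneg_left ?_ (hα₀ i o).le
      linarith [rew_le_one o.1, hvH o.2]
    rw [Finset.sum_add_distrib]
    linarith
  · rw [sum_postParam, hsum]
    exact hm i

/-- The sampled values are stochastically optimistic: their expectation is at least the posterior
expectation of the optimal value. -/
theorem integral_optValue_le (hw : 0 < p.weight) (hθ : p.θbar = H)
    {α₀ : Fin H × X × A → Outcome X → ℝ} (hα₀ : ∀ i o, 0 < α₀ i o)
    (hsum : ∀ i, ∑ o, α₀ i o = p.weight)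
    (hm : ∀ i : Fin H × X × A, Real.sqrt 3 * ((H : ℝ) / Real.sqrt (p.weight + visitCount hist i))
      ≤ m p hist i.1 i.2.1 i.2.2) (x : X) :
    ∫ M, optValue M x ∂prior (postParam α₀ hist)
      ≤ ∫ z, sampledV p hist z 0 x
        ∂noise H X A := by
  have hα := postParam_pos hα₀ hist
  have := fun i => isProbabilityMeasure_dirichlet (hα i)
  have hprior := isProbabilityMeasure_prior hα
  -- Dynamic programming is needed in this direction only: the maximum over actions makes every
  -- Bellman gap nonnegative.
  have hbound : ∀ M : Model H X A,
      optValue M x ≤ affineV (fun i => meanReward (M i)) (fun i => nextState (M i)) 0 x := by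
    intro M
    refine optValue_le_of_bellmanGap_nonneg M _ (affineV_last _ _) (fun h x a => ?_) x
    rw [bellmanGap, sum_outcome_eq, ← affineQ_castSucc (fun i => meanReward (M i))
      (fun i => nextState (M i)), sub_nonneg]
    exact affineQ_le_affineV _ _ _ _ _
  have hc : Continuous fun M : Model H X A =>
      affineV (fun i => meanReward (M i)) (fun i => nextState (M i)) 0 x :=
    continuous_affineV (fun i => continuous_meanReward.comp (continuous_apply i))
      (fun i x => (continuous_nextState x).comp (continuous_apply i)) 0 x
  have h1 : ∫ M, optValue M x ∂prior (postParam α₀ hist)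
      ≤ ∫ M : Model H X A, affineV (fun i => meanReward (M i)) (fun i => nextState (M i)) 0 x
        ∂prior (postParam α₀ hist) := by
    refine integral_mono ?_ (integrable_model hα hc) hbound
    refine Integrable.of_bound (C := H) (measurable_optValue x).aestronglyMeasurable
      (Filter.Eventually.of_forall fun M => ?_)
    rw [Real.norm_of_nonneg (optValue_nonneg M x)]
    exact optValue_le_card M x
  have h2 : ∫ M : Model H X A, affineV (fun i => meanReward (M i)) (fun i => nextState (M i)) 0 x
        ∂prior (postParam α₀ hist)
      = ∫ D, affineV (mixReward p hist ∅ D) (mixNext p hist ∅ D) 0 x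
        ∂jointLaw (postParam α₀ hist) := by
    have hmp := measurePreserving_pi (fun i : Fin H × X × A =>
      (dirichlet (postParam α₀ hist i)).prod (gaussianReal 0 1))
      (fun i => dirichlet (postParam α₀ hist i)) (f := fun _ => Prod.fst)
      fun i => measurePreserving_fst
    rw [prior, integral_eq_of_measurePreserving hmp hc.aestronglyMeasurable]
    simp only [mixReward_empty, mixNext_empty]
  have h3 : ∫ z, sampledV p hist z 0 x
        ∂noise H X A
      = ∫ D, affineV (mixReward p hist Finset.univ D) (mixNext p hist Finset.univ D) 0 x
        ∂jointLaw (postParam α₀ hist) := by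
    have hmp := measurePreserving_pi (fun i : Fin H × X × A =>
      (dirichlet (postParam α₀ hist i)).prod (gaussianReal 0 1))
      (fun _ => gaussianReal 0 1) (f := fun _ => Prod.snd)
      fun i => measurePreserving_snd
    rw [noise, integral_eq_of_measurePreserving hmp
      (continuous_sampledV p hist 0 x).aestronglyMeasurable]
    simp only [mixReward_univ, mixNext_univ]
    rfl
  rw [h2] at h1
  rw [h3]
  refine h1.trans ?_
  -- Indices enter by increasing step, so each exchange meets a set `S` without later steps.
  refine Finset.induction_on_max_value (fun i : Fin H × X × A => i.1)
    (motive := fun S => ∫ D, affineV (mixReward p hist ∅ D) (mixNext p hist ∅ D) 0 x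
        ∂jointLaw (postParam α₀ hist)
      ≤ ∫ D, affineV (mixReward p hist S D) (mixNext p hist S D) 0 x
        ∂jointLaw (postParam α₀ hist)) Finset.univ le_rfl fun i S hi hS ih => ?_
  exact ih.trans (mixed_le_mixed_insert p hist hw hθ hα₀ hsum hm S i hi hS x)

end Optimism

/-! ### The regret of one episode -/

section Scale

/-- The updated standard deviation after `k` visits. -/
def noiseScale (p : Params) (k : ℕ) : ℝ :=
  (Real.sqrt k * p.σ + p.weight * p.σ₀) / (k + p.weight)

lemma weight_mul_eq {p : Params} (hσ : 0 < p.σ) (hσ₀ : 0 < p.σ₀) :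
    p.weight * p.σ₀ = Real.sqrt p.weight * p.σ := by
  have : Real.sqrt p.weight = p.σ / p.σ₀ := by
    rw [Params.weight, ← div_pow, Real.sqrt_sq (div_pos hσ hσ₀).le]
  rw [this, Params.weight]
  field_simp

lemma sigma_eq_sqrt_weight_mul {p : Params} (hσ : 0 < p.σ) (hσ₀ : 0 < p.σ₀) :
    p.σ = Real.sqrt p.weight * p.σ₀ := by
  have : Real.sqrt p.weight = p.σ / p.σ₀ := by
    rw [Params.weight, ← div_pow, Real.sqrt_sq (div_pos hσ hσ₀).le]
  rw [this]
  field_simp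

lemma sigma_eq_sqrt_three_mul {p : Params} {H : ℕ} (hσ : 0 < p.σ)
    (hσH : p.σ ^ 2 = 3 * (H : ℝ) ^ 2) : p.σ = Real.sqrt 3 * H := by
  rw [← Real.sqrt_sq hσ.le, hσH, Real.sqrt_mul (by norm_num), Real.sqrt_sq (Nat.cast_nonneg H)]

lemma weight_pos {p : Params} (hσ : 0 < p.σ) (hσ₀ : 0 < p.σ₀) : 0 < p.weight := by
  unfold Params.weight; positivity

lemma noiseScale_nonneg {p : Params} (hσ : 0 < p.σ) (hσ₀ : 0 < p.σ₀) (k : ℕ) :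
    0 ≤ noiseScale p k := by
  have := weight_pos hσ hσ₀
  unfold noiseScale; positivity

/-- Since `β σ₀ = √β σ`, the scale is `(√k + √β) σ / (k + β)`, and `√k + √β ≥ √(k + β)`. The lower
bound is the standard deviation that optimism requires. -/
lemma le_noiseScale {p : Params} (hσ : 0 < p.σ) (hσ₀ : 0 < p.σ₀) (k : ℕ) :
    p.σ / Real.sqrt (p.weight + k) ≤ noiseScale p k := by
  have hw := weight_pos hσ hσ₀
  have hs : 0 < Real.sqrt (p.weight + k) := Real.sqrt_pos.mpr (by positivity)
  rw [noiseScale, weight_mul_eq hσ hσ₀, ← add_mul, div_le_div_iff₀ hs (by positivity)]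
  have h1 : Real.sqrt (p.weight + k) ≤ Real.sqrt k + Real.sqrt p.weight := by
    apply Real.sqrt_le_iff.mpr ⟨by positivity, ?_⟩
    rw [add_sq, Real.sq_sqrt (Nat.cast_nonneg k), Real.sq_sqrt hw.le]
    have := mul_nonneg (Real.sqrt_nonneg k) (Real.sqrt_nonneg p.weight)
    linarith
  have h2 : (k : ℝ) + p.weight = Real.sqrt (p.weight + k) * Real.sqrt (p.weight + k) := by
    rw [Real.mul_self_sqrt (by positivity), add_comm]
  rw [h2]
  nlinarith [mul_le_mul_of_nonneg_left h1 (mul_nonneg hσ.le hs.le)]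

/-- A bound uniform in `k`: `√k √β ≤ (k + β)/2` accounts for the `1/2`, the prior term for the `1`.
-/
lemma noiseScale_le {p : Params} (hσ : 0 < p.σ) (hσ₀ : 0 < p.σ₀) (k : ℕ) :
    noiseScale p k ≤ 3 / 2 * p.σ₀ := by
  have hw := weight_pos hσ hσ₀
  rw [noiseScale, div_le_iff₀ (by positivity), sigma_eq_sqrt_weight_mul hσ hσ₀]
  have h1 : Real.sqrt k * Real.sqrt p.weight ≤ (k + p.weight) / 2 := by
    have := sq_nonneg (Real.sqrt k - Real.sqrt p.weight)
    rw [sub_sq, Real.sq_sqrt (Nat.cast_nonneg k), Real.sq_sqrt hw.le] at this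
    linarith
  have h2 : (0 : ℝ) ≤ k := Nat.cast_nonneg k
  nlinarith [mul_le_mul_of_nonneg_right h1 hσ₀.le, mul_nonneg h2 hσ₀.le]

/-- `√k + √β ≤ √2 √(k + β)` shows that the scale required by optimism is exceeded by at most `√2`.
-/
lemma noiseScale_le_div_sqrt {p : Params} (hσ : 0 < p.σ) (hσ₀ : 0 < p.σ₀) (hw1 : 1 ≤ p.weight)
    (k : ℕ) : noiseScale p k ≤ Real.sqrt 2 * p.σ * (1 / Real.sqrt (k + 1)) := by
  have hw := weight_pos hσ hσ₀
  have hs : 0 < Real.sqrt (k + p.weight) := Real.sqrt_pos.mpr (by positivity)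
  have h1 : Real.sqrt k + Real.sqrt p.weight ≤ Real.sqrt 2 * Real.sqrt (k + p.weight) := by
    rw [← Real.sqrt_mul (by norm_num)]
    apply Real.le_sqrt_of_sq_le
    have := sq_nonneg (Real.sqrt k - Real.sqrt p.weight)
    rw [sub_sq, Real.sq_sqrt (Nat.cast_nonneg k), Real.sq_sqrt hw.le] at this
    rw [add_sq, Real.sq_sqrt (Nat.cast_nonneg k), Real.sq_sqrt hw.le]
    linarith
  calc noiseScale p k = (Real.sqrt k + Real.sqrt p.weight) * p.σ / (k + p.weight) := by
        rw [noiseScale, weight_mul_eq hσ hσ₀, ← add_mul]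
    _ ≤ Real.sqrt 2 * Real.sqrt (k + p.weight) * p.σ / (k + p.weight) := by gcongr
    _ = Real.sqrt 2 * p.σ * (1 / Real.sqrt (k + p.weight)) := by
        rw [div_eq_iff (by positivity)]
        have h2 : (k : ℝ) + p.weight = Real.sqrt (k + p.weight) * Real.sqrt (k + p.weight) := by
          rw [Real.mul_self_sqrt (by positivity)]
        conv_rhs => rw [h2]
        rw [Real.sqrt_mul_self hs.le]
        field_simp
    _ ≤ _ := by gcongr

/-- The exploration bonus after `k` visits, when the noise is at most `T`. -/
def bonus (p : Params) (H : ℕ) (T : ℝ) (k : ℕ) : ℝ :=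
  T * noiseScale p k + p.weight / (k + p.weight) * (H + H * (3 / 2 * p.σ₀ * T))

end Scale

/-! ### Bellman gaps of the sampled values and the resulting bound for one episode. -/

section Episode

variable {H n : ℕ} {X A : Type*} [Fintype X] [Fintype A] [DecidableEq X] [DecidableEq A]
  [Nonempty A] (p : Params) (hist : Fin n → Episode H X A)

lemma sampledV_eq_of_greedy {sel : (A → ℝ) → A} (hsel : ∀ (q : A → ℝ) (a : A), q a ≤ q (sel q))
    (z : Fin H × X × A → ℝ) (h : Fin H) (x : X) :
    sampledV p hist z h.castSucc x
      = affineQ (fun i => sampleReward p hist i (z i)) (sampleNext p hist) h.castSucc x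
        (greedy p sel hist z h x) := by
  rw [greedy, sampledQ_eq_affineQ]
  exact le_antisymm (ciSup_le fun a => hsel _ a) (affineQ_le_affineV _ _ _ _ _)

variable [Nonempty X] {p}

omit [Nonempty X] in
-- Rewards and the prior target are nonnegative, so only noise can push the values below zero, by at
-- most `3/2 σ₀ ‖z‖` per step.
lemma le_sampledV (hσ : 0 < p.σ) (hσ₀ : 0 < p.σ₀) (hθ : p.θbar = H) (z : Fin H × X × A → ℝ)
    (t : Fin (H + 1)) (x : X) : -(H * (3 / 2 * p.σ₀ * ‖z‖)) ≤ sampledV p hist z t x := by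
  have hw := weight_pos hσ hσ₀
  have hC : 0 ≤ 3 / 2 * p.σ₀ * ‖z‖ := by positivity
  have h1 : ∀ i, -(3 / 2 * p.σ₀ * ‖z‖) ≤ sampleReward p hist i (z i) := by
    intro i
    have h2 : 0 ≤ (∑ j ∈ visits hist i.1 i.2.1 i.2.2, rew ((hist j).outcome i.1).1
        + p.weight * p.θbar) / (visitCount hist i + p.weight) := by
      rw [hθ]
      have := Finset.sum_nonneg fun j (_ : j ∈ visits hist i.1 i.2.1 i.2.2) =>
        rew_nonneg ((hist j).outcome i.1).1
      positivity
    have h3 : |noiseScale p (visitCount hist i) * z i| ≤ 3 / 2 * p.σ₀ * ‖z‖ := by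
      rw [abs_mul, abs_of_nonneg (noiseScale_nonneg hσ hσ₀ _)]
      exact mul_le_mul (noiseScale_le hσ hσ₀ _) (norm_le_pi_norm z i) (abs_nonneg _) (by positivity)
    have h4 := (abs_le.mp h3).1
    have h5 : m p hist i.1 i.2.1 i.2.2 = noiseScale p (visitCount hist i) := rfl
    rw [sampleReward, h5]
    linarith
  refine le_trans ?_ (le_affineV (sampleNext_nonneg p hist hw.le) (sum_sampleNext_le_one p hist hw)
    hC h1 t x)
  have : (0 : ℝ) ≤ (t : ℕ) * (3 / 2 * p.σ₀ * ‖z‖) := by positivity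
  linarith

/-- The sampled update and the mean posterior model average the same observations with the same
denominator, so these cancel. The noise and the prior's share of the distance between `H` and the
prior mean target remain. The greedy policy depends on `z`, so the noise is controlled through `‖z‖`
and not through its zero mean. -/
lemma bellmanGap_sampledV_le (hσ : 0 < p.σ) (hσ₀ : 0 < p.σ₀) (hθ : p.θbar = H)
    {α : Fin H × X × A → Outcome X → ℝ} (hα : ∀ i o, 0 < α i o) (hsum : ∀ i, ∑ o, α i o = p.weight)
    {sel : (A → ℝ) → A} (hsel : ∀ (q : A → ℝ) (a : A), q a ≤ q (sel q)) {T : ℝ}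
    (z : Fin H × X × A → ℝ) (h : Fin H) (x : X) :
    bellmanGap (meanModel (postParam α hist) (postParam_pos hα hist)) (sampledV p hist z) h x
        (greedy p sel hist z h x)
      ≤ bonus p H T (visitCount hist (h, x, greedy p sel hist z h x))
        + 3 * p.σ₀ * H * max (‖z‖ - T) 0 := by
  have hw := weight_pos hσ hσ₀
  set i : Fin H × X × A := (h, x, greedy p sel hist z h x) with hi
  set E := max (‖z‖ - T) 0 with hE
  have hE0 : 0 ≤ E := le_max_right _ _
  -- The noise is split at `T`: the part below enters the bonus, and the excess `E` is charged at
  -- the crude scale `3/2 σ₀`.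
  have hz : ‖z‖ ≤ T + E := by linarith [le_max_left (‖z‖ - T) 0]
  have hH1 : (1 : ℝ) ≤ H := by exact_mod_cast (Nat.one_le_iff_ne_zero.mpr (by
    rintro rfl; exact h.elim0))
  have hN : 0 < (visitCount hist i : ℝ) + p.weight := by positivity
  set B := p.weight / (visitCount hist i + p.weight) with hB
  have hB0 : 0 ≤ B := by positivity
  have hB1 : B ≤ 1 := by
    rw [hB, div_le_one hN]
    linarith [Nat.cast_nonneg (α := ℝ) (visitCount hist i)]
  set s := noiseScale p (visitCount hist i) with hs
  have hs0 : 0 ≤ s := noiseScale_nonneg hσ hσ₀ _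
  have hs1 : s ≤ 3 / 2 * p.σ₀ := noiseScale_le hσ hσ₀ _
  have hmean : ∑ o, meanModel (postParam α hist) (postParam_pos hα hist) i o
        * (rew o.1 + sampledV p hist z h.succ o.2)
      = (∑ o, α i o * (rew o.1 + sampledV p hist z h.succ o.2)
        + ∑ j ∈ visits hist i.1 i.2.1 i.2.2, (rew ((hist j).outcome i.1).1
          + sampledV p hist z h.succ ((hist j).outcome i.1).2)) / (visitCount hist i + p.weight) := by
    simp_rw [meanModel_apply, sum_postParam, hsum, div_mul_eq_mul_div]
    rw [← Finset.sum_div, sum_postParam_mul α hist i fun o => rew o.1 + sampledV p hist z h.succ o.2,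
      add_comm p.weight]
  have hprior : -(p.weight * (H * (3 / 2 * p.σ₀ * ‖z‖)))
      ≤ ∑ o, α i o * (rew o.1 + sampledV p hist z h.succ o.2) := by
    rw [← hsum i, Finset.sum_mul, ← Finset.sum_neg_distrib]
    refine Finset.sum_le_sum fun o _ => ?_
    rw [← mul_neg]
    refine mul_le_mul_of_nonneg_left ?_ (hα i o).le
    linarith [rew_nonneg o.1, le_sampledV hist hσ hσ₀ hθ z h.succ o.2]
  have hgap : bellmanGap (meanModel (postParam α hist) (postParam_pos hα hist)) (sampledV p hist z) h x
        (greedy p sel hist z h x)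
      = s * z i + (p.weight * H - ∑ o, α i o * (rew o.1 + sampledV p hist z h.succ o.2))
        / (visitCount hist i + p.weight) := by
    rw [bellmanGap, sampledV_eq_of_greedy p hist hsel, affineQ_castSucc, ← hi, hmean,
      sum_sampleNext_mul, sampleReward, hθ, Finset.sum_add_distrib]
    change _ / _ + s * z i + _ - _ = _
    simp only [sampledV, hi]
    ring
  have h1 : s * z i ≤ s * ‖z‖ :=
    mul_le_mul_of_nonneg_left ((le_abs_self _).trans (norm_le_pi_norm z i)) hs0
  have h2 : (p.weight * H - ∑ o, α i o * (rew o.1 + sampledV p hist z h.succ o.2))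
        / (visitCount hist i + p.weight) ≤ B * (H + H * (3 / 2 * p.σ₀ * ‖z‖)) := by
    rw [hB, div_mul_eq_mul_div]
    refine (div_le_div_iff_of_pos_right hN).mpr ?_
    linarith
  rw [hgap, bonus, ← hs, ← hB]
  have h3 : s * ‖z‖ ≤ s * T + 3 / 2 * p.σ₀ * E := by
    nlinarith [mul_le_mul_of_nonneg_left hz hs0, mul_le_mul_of_nonneg_right hs1 hE0]
  have h4 : B * (H + H * (3 / 2 * p.σ₀ * ‖z‖))
      ≤ B * (H + H * (3 / 2 * p.σ₀ * T)) + H * (3 / 2 * p.σ₀) * E := by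
    have hK : 0 ≤ H * (3 / 2 * p.σ₀) := by positivity
    have h5 := mul_le_mul_of_nonneg_left hz (mul_nonneg hB0 hK)
    have h6 := mul_le_mul_of_nonneg_right hB1 (mul_nonneg hK hE0)
    nlinarith
  have h7 : 3 / 2 * p.σ₀ * E ≤ H * (3 / 2 * p.σ₀) * E := by
    have := mul_le_mul_of_nonneg_right hH1 (mul_nonneg (by positivity : 0 ≤ 3 / 2 * p.σ₀) hE0)
    linarith
  linarith

omit [Nonempty A] [Nonempty X] [DecidableEq X] in
lemma episodeProb_toPolicy_eq_zero (M : Model H X A) (π : DetPolicy H X A) (e : Episode H X A)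
    (he : ¬ ∀ h, e.action h = π h (e.state h)) : episodeProb M π.toPolicy e = 0 := by
  simp only [not_forall] at he
  obtain ⟨h, hh⟩ := he
  refine Finset.prod_eq_zero (Finset.mem_univ h) ?_
  simp [DetPolicy.toPolicy, hh]

/-- The performance difference identity in the mean posterior model, with the greedy gaps summed
along the trajectory. -/
lemma sampledV_sub_value_le (hσ : 0 < p.σ) (hσ₀ : 0 < p.σ₀) (hθ : p.θbar = H)
    {α : Fin H × X × A → Outcome X → ℝ} (hα : ∀ i o, 0 < α i o) (hsum : ∀ i, ∑ o, α i o = p.weight)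
    {sel : (A → ℝ) → A} (hsel : ∀ (q : A → ℝ) (a : A), q a ≤ q (sel q)) {T : ℝ}
    (z : Fin H × X × A → ℝ) (x : X) :
    sampledV p hist z 0 x
      ≤ value (meanModel (postParam α hist) (postParam_pos hα hist))
          (greedy p sel hist z).toPolicy x
        + ∑ τ : Trajectory H X A, episodeProb (meanModel (postParam α hist) (postParam_pos hα hist))
            (greedy p sel hist z).toPolicy (x, τ)
          * ∑ h, bonus p H T (visitCount hist
            (h, Episode.state (x, τ) h, Episode.action (x, τ) h))
        + 3 * p.σ₀ * (H : ℝ) ^ 2 * max (‖z‖ - T) 0 := by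
  set M := meanModel (postParam α hist) (postParam_pos hα hist)
  set π := greedy p sel hist z with hπ
  have h1 := sum_bellmanGap M π.toPolicy (sampledV p hist z) (affineV_last _ _) x
  have h2 : ∀ τ : Trajectory H X A, episodeProb M π.toPolicy (x, τ)
        * ∑ h, bellmanGap M (sampledV p hist z) h (Episode.state (x, τ) h) (Episode.action (x, τ) h)
      ≤ episodeProb M π.toPolicy (x, τ) * (∑ h, bonus p H T (visitCount hist
            (h, Episode.state (x, τ) h, Episode.action (x, τ) h))
          + 3 * p.σ₀ * (H : ℝ) ^ 2 * max (‖z‖ - T) 0) := by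
    intro τ
    -- Gaps are controlled only at greedy actions; a trajectory that deviates has probability zero.
    by_cases he : ∀ h, Episode.action (x, τ) h = π h (Episode.state (x, τ) h)
    · refine mul_le_mul_of_nonneg_left ?_ (episodeProb_nonneg _ _ _)
      have e : 3 * p.σ₀ * (H : ℝ) ^ 2 * max (‖z‖ - T) 0
          = ∑ _h : Fin H, 3 * p.σ₀ * H * max (‖z‖ - T) 0 := by
        simp only [Finset.sum_const, Finset.card_univ, Fintype.card_fin, nsmul_eq_mul]; ring
      rw [e, ← Finset.sum_add_distrib]
      refine Finset.sum_le_sum fun h _ => ?_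
      rw [he h]
      exact bellmanGap_sampledV_le hist hσ hσ₀ hθ hα hsum hsel z h _
    · rw [episodeProb_toPolicy_eq_zero M π _ he, zero_mul, zero_mul]
  have h3 := Finset.sum_le_sum fun τ (_ : τ ∈ Finset.univ) => h2 τ
  simp_rw [mul_add] at h3
  rw [h1, Finset.sum_add_distrib, ← Finset.sum_mul, sum_episodeProb, one_mul] at h3
  linarith

omit [Nonempty X] in
lemma measurableSet_greedy_eq {sel : (A → ℝ) → A}
    (hselm : ∀ a : A, MeasurableSet {q : A → ℝ | sel q = a}) (π : DetPolicy H X A) :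
    MeasurableSet {z | greedy p sel hist z = π} := by
  have : {z | greedy p sel hist z = π}
      = ⋂ h, ⋂ x, (fun z => sampledQ p hist z h.castSucc x) ⁻¹' {q | sel q = π h x} := by
    ext z
    simp only [Set.mem_ofPred_eq, Set.mem_iInter, Set.mem_preimage, funext_iff, greedy]
  rw [this]
  refine MeasurableSet.iInter fun h => MeasurableSet.iInter fun x => ?_
  exact (continuous_pi fun a => continuous_sampledQ p hist h.castSucc x a).measurable (hselm _)

omit [Nonempty X] in
/-- The greedy policy of the sampled values has the distribution `policyProb`. -/
lemma integral_greedy {sel : (A → ℝ) → A}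
    (hselm : ∀ a : A, MeasurableSet {q : A → ℝ | sel q = a}) (F : DetPolicy H X A → ℝ) :
    Integrable (fun z => F (greedy p sel hist z)) (noise H X A) ∧
    ∫ z, F (greedy p sel hist z) ∂noise H X A = ∑ π, policyProb p sel hist π * F π := by
  have hP : IsProbabilityMeasure (noise H X A) := by unfold noise; infer_instance
  have e : ∀ z, F (greedy p sel hist z)
      = ∑ π, {z | greedy p sel hist z = π}.indicator (fun _ => F π) z := by
    intro z
    rw [Finset.sum_eq_single (greedy p sel hist z)]
    · simp
    · intro π _ hπ; simp [hπ.symm]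
    · simp
  have hi : ∀ π : DetPolicy H X A, Integrable
      ({z | greedy p sel hist z = π}.indicator fun _ => F π) (noise H X A) := fun π =>
    (integrable_const _).indicator (measurableSet_greedy_eq hist hselm π)
  simp_rw [e]
  refine ⟨integrable_finsetSum _ fun π _ => hi π, ?_⟩
  rw [integral_finsetSum _ fun π _ => hi π]
  refine Finset.sum_congr rfl fun π _ => ?_
  rw [integral_indicator_const _ (measurableSet_greedy_eq hist hselm π), policyProb, smul_eq_mul]

omit [Nonempty X] in
lemma sum_policyProb {sel : (A → ℝ) → A}
    (hselm : ∀ a : A, MeasurableSet {q : A → ℝ | sel q = a}) :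
    ∑ π : DetPolicy H X A, policyProb p sel hist π = 1 := by
  have hP : IsProbabilityMeasure (noise H X A) := by unfold noise; infer_instance
  have := (integral_greedy (p := p) hist hselm fun _ => 1).2
  simpa using this.symm

omit [Nonempty X] in
lemma integrable_sampledV (hw : 0 < p.weight) (t : Fin (H + 1)) (x : X) :
    Integrable (fun z => sampledV p hist z t x) (noise H X A) := by
  have hi : ∀ i : Fin H × X × A, Integrable (fun z : Fin H × X × A → ℝ =>
      |sampleReward p hist i (z i)|) (noise H X A) := by
    intro i
    refine integrable_eval_gaussian i (f := fun ζ => |sampleReward p hist i ζ|) ?_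
    unfold sampleReward
    exact ((integrable_const _).add (integrable_id_gaussian.const_mul _)).abs
  refine ((integrable_finsetSum Finset.univ fun i _ => hi i).const_mul (H : ℝ)).mono'
    (continuous_sampledV p hist t x).aestronglyMeasurable (Filter.Eventually.of_forall fun z => ?_)
  exact abs_affineV_le (sampleNext_nonneg p hist hw.le) (sum_sampleNext_le_one p hist hw)
    (Finset.sum_nonneg fun i _ => abs_nonneg _)
    (fun i => Finset.single_le_sum (f := fun i => |sampleReward p hist i (z i)|)
      (fun i _ => abs_nonneg _) (Finset.mem_univ i)) t x

/-- The posterior expected regret of one episode is bounded by the expected bonuses. -/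
theorem episode_regret_le (hσ : 0 < p.σ) (hσ₀ : 0 < p.σ₀) (hσH : p.σ ^ 2 = 3 * (H : ℝ) ^ 2)
    (hθ : p.θbar = H) {α : Fin H × X × A → Outcome X → ℝ} (hα : ∀ i o, 0 < α i o)
    (hsum : ∀ i, ∑ o, α i o = p.weight)
    {sel : (A → ℝ) → A} (hsel : ∀ (q : A → ℝ) (a : A), q a ≤ q (sel q))
    (hselm : ∀ a : A, MeasurableSet {q : A → ℝ | sel q = a}) {T : ℝ} (hT : 1 ≤ T) (x : X) :
    ∫ M, optValue M x ∂prior (postParam α hist)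
      ≤ ∑ π, policyProb p sel hist π
          * (value (meanModel (postParam α hist) (postParam_pos hα hist)) π.toPolicy x
            + ∑ τ : Trajectory H X A,
              episodeProb (meanModel (postParam α hist) (postParam_pos hα hist)) π.toPolicy (x, τ)
              * ∑ h, bonus p H T (visitCount hist
                (h, Episode.state (x, τ) h, Episode.action (x, τ) h)))
        + 3 * p.σ₀ * (H : ℝ) ^ 2
          * (Fintype.card (Fin H × X × A) * Real.exp (-T ^ 2 / 2)) := by
  have hw := weight_pos hσ hσ₀
  have hm : ∀ i : Fin H × X × A, Real.sqrt 3 * ((H : ℝ) / Real.sqrt (p.weight + visitCount hist i))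
      ≤ m p hist i.1 i.2.1 i.2.2 := by
    intro i
    rw [← mul_div_assoc, ← sigma_eq_sqrt_three_mul hσ hσH]
    exact le_noiseScale hσ hσ₀ _
  refine (integral_optValue_le p hist hw hθ hα hsum hm x).trans ?_
  obtain ⟨hEi, hE⟩ := integral_norm_excess_le (ι := Fin H × X × A) hT
  obtain ⟨hGi, hG⟩ := integral_greedy (p := p) hist hselm fun π =>
    value (meanModel (postParam α hist) (postParam_pos hα hist)) π.toPolicy x
            + ∑ τ : Trajectory H X A,
              episodeProb (meanModel (postParam α hist) (postParam_pos hα hist)) π.toPolicy (x, τ)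
              * ∑ h, bonus p H T (visitCount hist
                (h, Episode.state (x, τ) h, Episode.action (x, τ) h))
  rw [← hG]
  refine (integral_mono (integrable_sampledV hist hw 0 x) (hGi.add (hEi.const_mul _)) fun z =>
    sampledV_sub_value_le hist hσ hσ₀ hθ hα hsum hsel (T := T) z x).trans ?_
  have := integral_add hGi (hEi.const_mul (3 * p.σ₀ * (H : ℝ) ^ 2))
  simp only [Pi.add_apply] at this ⊢
  rw [integral_const_mul] at this
  refine this.le.trans (add_le_add_right (mul_le_mul_of_nonneg_left hE (by positivity)) _)

end Episode

/-! ### The regret of a run -/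

section RunRegret

variable {H n : ℕ} {X A : Type*} [Fintype X] [Fintype A] [DecidableEq X] [DecidableEq A]

/-- The episodes of a run. -/
def Run.episodes (w : Run n H X A) : Fin n → Episode H X A := fun j => (w j).2

omit [Fintype X] [Fintype A] [DecidableEq X] [DecidableEq A] in
lemma past_snoc_castSucc (w : Run n H X A) (y : DetPolicy H X A × Episode H X A) (l : Fin n) :
    Run.past (Fin.snoc (α := fun _ => DetPolicy H X A × Episode H X A) w y : Run (n + 1) H X A)
      l.castSucc = w.past l := by
  funext j
  exact congrArg Prod.snd (Fin.snoc_castSucc (α := fun _ => DetPolicy H X A × Episode H X A) y w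
    (j.castLE l.isLt.le))

omit [Fintype X] [Fintype A] [DecidableEq X] [DecidableEq A] in
lemma past_snoc_last (w : Run n H X A) (y : DetPolicy H X A × Episode H X A) :
    Run.past (Fin.snoc (α := fun _ => DetPolicy H X A × Episode H X A) w y : Run (n + 1) H X A)
      (Fin.last n) = w.episodes := by
  funext j
  exact congrArg Prod.snd (Fin.snoc_castSucc (α := fun _ => DetPolicy H X A × Episode H X A) y w j)

variable (ρ : stdSimplex ℝ X) (p : Params) (sel : (A → ℝ) → A)

lemma runProb_snoc (M : Model H X A) (w : Run n H X A) (π : DetPolicy H X A) (e : Episode H X A) :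
    runProb ρ p sel M (Fin.snoc (α := fun _ => DetPolicy H X A × Episode H X A) w (π, e) :
        Run (n + 1) H X A)
      = runProb ρ p sel M w
        * (policyProb p sel w.episodes π * ρ e.1 * episodeProb M π.toPolicy e) := by
  rw [runProb, Fin.prod_univ_castSucc, past_snoc_last, Fin.snoc_last]
  congr 1
  refine Finset.prod_congr rfl fun l _ => ?_
  rw [past_snoc_castSucc, Fin.snoc_castSucc]

lemma policyProb_nonneg (hist : Fin n → Episode H X A) (π : DetPolicy H X A) :
    0 ≤ policyProb p sel hist π := measureReal_nonneg

lemma runProb_nonneg (M : Model H X A) (w : Run n H X A) : 0 ≤ runProb ρ p sel M w :=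
  Finset.prod_nonneg fun _ _ => mul_nonneg (mul_nonneg (policyProb_nonneg _ _ _ _)
    (stdSimplex.zero_le _ _)) (episodeProb_nonneg _ _ _)

@[fun_prop]
lemma continuous_runProb (w : Run n H X A) :
    Continuous fun M : Model H X A => runProb ρ p sel M w := by
  unfold runProb; fun_prop

/-- The expectation over the next episode of a function of the policy and of the episode. -/
def nextMean (hist : Fin n → Episode H X A) (M : Model H X A)
    (g : DetPolicy H X A → Episode H X A → ℝ) : ℝ :=
  ∑ π, policyProb p sel hist π * ∑ x, ρ x * ∑ τ : Trajectory H X A,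
    episodeProb M π.toPolicy (x, τ) * g π (x, τ)

variable {sel}

lemma nextMean_const [Nonempty A] (hselm : ∀ a : A, MeasurableSet {q : A → ℝ | sel q = a})
    (hist : Fin n → Episode H X A) (M : Model H X A) (c : ℝ) :
    nextMean ρ p sel hist M (fun _ _ => c) = c := by
  simp only [nextMean, ← Finset.sum_mul, sum_episodeProb, one_mul, stdSimplex.sum_eq_one,
    sum_policyProb hist hselm]

lemma nextMean_add (hist : Fin n → Episode H X A) (M : Model H X A)
    (g g' : DetPolicy H X A → Episode H X A → ℝ) :
    nextMean ρ p sel hist M (fun π e => g π e + g' π e)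
      = nextMean ρ p sel hist M g + nextMean ρ p sel hist M g' := by
  simp only [nextMean, mul_add, Finset.sum_add_distrib]

/-- The tower property for functionals to which the last episode adds a term: that term is averaged
given the past. -/
lemma sum_run_succ [Nonempty A] (hselm : ∀ a : A, MeasurableSet {q : A → ℝ | sel q = a})
    (M : Model H X A) (G : Run (n + 1) H X A → ℝ) (F : Run n H X A → ℝ)
    (g : Run n H X A → DetPolicy H X A → Episode H X A → ℝ)
    (hG : ∀ w π e, G (Fin.snoc (α := fun _ => DetPolicy H X A × Episode H X A) w (π, e))
      = F w + g w π e) :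
    ∑ w, runProb ρ p sel M w * G w
      = ∑ w, runProb ρ p sel M w * F w
        + ∑ w, runProb ρ p sel M w * nextMean ρ p sel (Run.episodes w) M (g w) := by
  rw [← (Fin.snocEquiv fun _ : Fin (n + 1) => DetPolicy H X A × Episode H X A).sum_comp,
    Fintype.sum_prod_type, Finset.sum_comm, ← Finset.sum_add_distrib]
  refine Finset.sum_congr rfl fun w _ => ?_
  have h1 : runProb ρ p sel M w * F w + runProb ρ p sel M w * nextMean ρ p sel (Run.episodes w) M (g w)
      = runProb ρ p sel M w * nextMean ρ p sel (Run.episodes w) M (fun π e => F w + g w π e) := by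
    rw [nextMean_add ρ p (Run.episodes w) M (fun _ _ => F w), nextMean_const ρ p hselm]; ring
  rw [h1, nextMean, Finset.mul_sum, Fintype.sum_prod_type]
  refine Finset.sum_congr rfl fun π _ => ?_
  rw [Finset.mul_sum, Finset.mul_sum, Fintype.sum_prod_type]
  refine Finset.sum_congr rfl fun x _ => ?_
  rw [Finset.mul_sum, Finset.mul_sum, Finset.mul_sum]
  refine Finset.sum_congr rfl fun τ _ => ?_
  change runProb ρ p sel M (Fin.snoc (α := fun _ => DetPolicy H X A × Episode H X A) w (π, (x, τ)))
    * G (Fin.snoc (α := fun _ => DetPolicy H X A × Episode H X A) w (π, (x, τ))) = _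
  rw [runProb_snoc, hG]
  ring

lemma sum_runProb [Nonempty A] (hselm : ∀ a : A, MeasurableSet {q : A → ℝ | sel q = a})
    (M : Model H X A) : ∑ w : Run n H X A, runProb ρ p sel M w = 1 := by
  induction n with
  | zero => simp [runProb]
  | succ n ih =>
    have h := sum_run_succ (n := n) ρ p hselm M (fun _ => 1) (fun _ => 1) (fun _ _ _ => 0)
      fun w π e => by simp
    simp_rw [nextMean_const ρ p hselm] at h
    simpa [ih] using h

omit [DecidableEq X] in
lemma runRegret_snoc (M : Model H X A) (w : Run n H X A) (π : DetPolicy H X A)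
    (e : Episode H X A) :
    runRegret M (Fin.snoc (α := fun _ => DetPolicy H X A × Episode H X A) w (π, e) :
        Run (n + 1) H X A)
      = runRegret M w + (optValue M e.1 - value M π.toPolicy e.1) := by
  rw [runRegret, Fin.sum_univ_castSucc, Fin.snoc_last]
  congr 1
  refine Finset.sum_congr rfl fun l _ => ?_
  rw [Fin.snoc_castSucc]

omit [DecidableEq X] in
lemma runRegret_nonneg (M : Model H X A) (w : Run n H X A) : 0 ≤ runRegret M w :=
  Finset.sum_nonneg fun _ _ => sub_nonneg.mpr (value_le_optValue _ _ _)

omit [DecidableEq X] in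
lemma runRegret_le (M : Model H X A) (w : Run n H X A) : runRegret M w ≤ n * H := by
  calc runRegret M w ≤ ∑ _l : Fin n, (H : ℝ) := Finset.sum_le_sum fun l _ => by
        linarith [optValue_le_card M (w l).2.1, value_nonneg M (w l).1.toPolicy (w l).2.1]
    _ = n * H := by simp

lemma expectedRegret_nonneg (M : Model H X A) : 0 ≤ expectedRegret ρ p sel n M :=
  Finset.sum_nonneg fun _ _ => mul_nonneg (runProb_nonneg _ _ _ _ _) (runRegret_nonneg _ _)

lemma expectedRegret_le [Nonempty A] (hselm : ∀ a : A, MeasurableSet {q : A → ℝ | sel q = a})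
    (M : Model H X A) : expectedRegret ρ p sel n M ≤ n * H := by
  calc expectedRegret ρ p sel n M ≤ ∑ w : Run n H X A, runProb ρ p sel M w * (n * H) :=
        Finset.sum_le_sum fun w _ =>
          mul_le_mul_of_nonneg_left (runRegret_le M w) (runProb_nonneg _ _ _ _ _)
    _ = n * H := by rw [← Finset.sum_mul, sum_runProb ρ p hselm, one_mul]

lemma measurable_expectedRegret :
    Measurable fun M : Model H X A => expectedRegret ρ p sel n M := by
  refine Finset.measurable_sum _ fun w _ => (continuous_runProb ρ p sel w).measurable.mul ?_
  exact Finset.measurable_sum _ fun l _ =>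
    (measurable_optValue _).sub (continuous_value _ _).measurable

variable [Nonempty X]

lemma integrable_expectedRegret [Nonempty A]
    (hselm : ∀ a : A, MeasurableSet {q : A → ℝ | sel q = a})
    {α : Fin H × X × A → Outcome X → ℝ} (hα : ∀ i o, 0 < α i o) :
    Integrable (expectedRegret ρ p sel n) (prior α) := by
  have := isProbabilityMeasure_prior hα
  refine Integrable.of_bound (C := n * H) (measurable_expectedRegret ρ p).aestronglyMeasurable
    (Filter.Eventually.of_forall fun M => ?_)
  rw [Real.norm_of_nonneg (expectedRegret_nonneg ρ p M)]
  exact expectedRegret_le ρ p hselm M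

omit [DecidableEq X] [DecidableEq A] in
lemma integrable_optValue {α : Fin H × X × A → Outcome X → ℝ} (hα : ∀ i o, 0 < α i o) (x : X) :
    Integrable (fun M : Model H X A => optValue M x) (prior α) := by
  have := isProbabilityMeasure_prior hα
  refine Integrable.of_bound (C := H) (measurable_optValue x).aestronglyMeasurable
    (Filter.Eventually.of_forall fun M => ?_)
  rw [Real.norm_of_nonneg (optValue_nonneg M x)]
  exact optValue_le_card M x

/-- Weighting the prior by the probability of a run gives a multiple of the posterior. -/
lemma exists_integral_runProb {α : Fin H × X × A → Outcome X → ℝ} (hα : ∀ i o, 0 < α i o)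
    (w : Run n H X A) :
    ∃ K : ℝ, 0 ≤ K ∧ ∀ f : Model H X A → ℝ, ∫ M, runProb ρ p sel M w * f M ∂prior α
      = K * ∫ M, f M ∂prior (postParam α w.episodes) := by
  obtain ⟨K, hK, h⟩ := exists_integral_posterior hα w.episodes fun l => (w l).1.toPolicy
  -- The agent's choices depend on the past alone, so their probabilities, like those of the initial
  -- states, leave the posterior unchanged.
  refine ⟨(∏ l, policyProb p sel (w.past l) (w l).1 * ρ (w l).2.1) * K, mul_nonneg
    (Finset.prod_nonneg fun l _ => mul_nonneg (policyProb_nonneg _ _ _ _)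
      (stdSimplex.zero_le _ _)) hK, fun f => ?_⟩
  rw [mul_assoc, ← h, ← integral_const_mul]
  congr 1
  ext M
  simp only [runProb, Finset.prod_mul_distrib, Run.episodes]
  ring

/-- The sum of the bonuses that were collected in a history. -/
def potential (g : ℕ → ℝ) (hist : Fin n → Episode H X A) : ℝ :=
  ∑ i : Fin H × X × A, ∑ k ∈ Finset.range (visitCount hist i), g k

omit [Fintype X] [Fintype A] [Nonempty X] in
lemma visitCount_snoc (w : Run n H X A) (π : DetPolicy H X A) (e : Episode H X A)
    (i : Fin H × X × A) :
    visitCount (Run.episodes (Fin.snoc (α := fun _ => DetPolicy H X A × Episode H X A) w (π, e) :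
        Run (n + 1) H X A)) i
      = visitCount w.episodes i + if (i.1, e.state i.1, e.action i.1) = i then 1 else 0 := by
  obtain ⟨h, x, a⟩ := i
  simp only [visitCount, visits]
  rw [Finset.card_filter, Finset.card_filter, Fin.sum_univ_castSucc]
  simp only [Run.episodes, Fin.snoc_castSucc, Fin.snoc_last, Prod.mk.injEq, true_and]
  congr!

omit [Nonempty X] in
-- An episode visits exactly one index per step, so it adds one term per step: the bonus at the
-- count before the visit.
lemma potential_snoc (g : ℕ → ℝ) (w : Run n H X A) (π : DetPolicy H X A) (e : Episode H X A) :
    potential g (Run.episodes (Fin.snoc (α := fun _ => DetPolicy H X A × Episode H X A) w (π, e) :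
        Run (n + 1) H X A))
      = potential g w.episodes + ∑ h, g (visitCount w.episodes (h, e.state h, e.action h)) := by
  have h1 : ∀ i : Fin H × X × A, ∑ k ∈ Finset.range (visitCount (Run.episodes
        (Fin.snoc (α := fun _ => DetPolicy H X A × Episode H X A) w (π, e) : Run (n + 1) H X A)) i), g k
      = ∑ k ∈ Finset.range (visitCount w.episodes i), g k
        + if (i.1, e.state i.1, e.action i.1) = i then g (visitCount w.episodes i) else 0 := by
    intro i
    rw [visitCount_snoc]
    split_ifs
    · rw [Finset.sum_range_succ]
    · simp
  rw [potential, Finset.sum_congr rfl fun i _ => h1 i, Finset.sum_add_distrib, potential]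
  congr 1
  rw [Fintype.sum_prod_type]
  refine Finset.sum_congr rfl fun h _ => ?_
  rw [Finset.sum_eq_single (e.state h, e.action h)]
  · simp
  · rintro ⟨x, a⟩ _ hne
    rw [if_neg]
    intro heq
    exact hne (Prod.mk.inj heq).2.symm
  · simp

lemma integral_nextMean {α : Fin H × X × A → Outcome X → ℝ} (hα : ∀ i o, 0 < α i o)
    (hist : Fin n → Episode H X A) (g : DetPolicy H X A → Episode H X A → ℝ) :
    ∫ M, nextMean ρ p sel hist M g ∂prior α = nextMean ρ p sel hist (meanModel α hα) g := by
  unfold nextMean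
  rw [integral_finsetSum _ fun π _ => integrable_model hα (by fun_prop)]
  refine Finset.sum_congr rfl fun π _ => ?_
  rw [integral_const_mul, integral_finsetSum _ fun x _ => integrable_model hα (by fun_prop)]
  congr 1
  refine Finset.sum_congr rfl fun x _ => ?_
  rw [integral_const_mul, integral_finsetSum _ fun τ _ => integrable_model hα (by fun_prop)]
  simp_rw [integral_mul_const, integral_episodeProb hα]

omit [Nonempty X] in
lemma nextMean_of_state (hist : Fin n → Episode H X A) (M : Model H X A)
    (g : DetPolicy H X A → X → ℝ) :
    nextMean ρ p sel hist M (fun π e => g π e.1)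
      = ∑ π, policyProb p sel hist π * ∑ x, ρ x * g π x := by
  simp_rw [nextMean, ← Finset.sum_mul, sum_episodeProb, one_mul]

variable {p}

/-- The posterior expected regret of the next episode. -/
lemma integral_next_regret_le [Nonempty A] (hσ : 0 < p.σ) (hσ₀ : 0 < p.σ₀)
    (hσH : p.σ ^ 2 = 3 * (H : ℝ) ^ 2)
    (hθ : p.θbar = H) {α : Fin H × X × A → Outcome X → ℝ} (hα : ∀ i o, 0 < α i o)
    (hsum : ∀ i, ∑ o, α i o = p.weight)
    (hsel : ∀ (q : A → ℝ) (a : A), q a ≤ q (sel q))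
    (hselm : ∀ a : A, MeasurableSet {q : A → ℝ | sel q = a}) {T : ℝ} (hT : 1 ≤ T)
    (hist : Fin n → Episode H X A) :
    ∫ M, nextMean ρ p sel hist M (fun π e => optValue M e.1 - value M π.toPolicy e.1)
        ∂prior (postParam α hist)
      ≤ ∫ M, nextMean ρ p sel hist M
          (fun _ e => ∑ h, bonus p H T (visitCount hist (h, e.state h, e.action h)))
          ∂prior (postParam α hist)
        + 3 * p.σ₀ * (H : ℝ) ^ 2 * (Fintype.card (Fin H × X × A) * Real.exp (-T ^ 2 / 2)) := by
  have hpost := postParam_pos hα hist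
  set ε := 3 * p.σ₀ * (H : ℝ) ^ 2 * (Fintype.card (Fin H × X × A) * Real.exp (-T ^ 2 / 2)) with hε
  set M' := meanModel (postParam α hist) hpost with hM'
  -- The optimal value does not depend on the policy drawn and leaves the average over policies.
  have h1 : ∀ M, nextMean ρ p sel hist M (fun π e => optValue M e.1 - value M π.toPolicy e.1)
      = ∑ x, ρ x * (optValue M x - ∑ π, policyProb p sel hist π * value M π.toPolicy x) := by
    intro M
    rw [nextMean_of_state ρ p hist M fun π x => optValue M x - value M π.toPolicy x]
    simp_rw [Finset.mul_sum]
    rw [Finset.sum_comm]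
    refine Finset.sum_congr rfl fun x _ => ?_
    have : ρ x * optValue M x = ∑ π, policyProb p sel hist π * (ρ x * optValue M x) := by
      rw [← Finset.sum_mul, sum_policyProb hist hselm, one_mul]
    rw [mul_sub, this, Finset.mul_sum, ← Finset.sum_sub_distrib]
    exact Finset.sum_congr rfl fun π _ => by ring
  simp_rw [h1]
  rw [integral_nextMean ρ p hpost]
  have hiv : ∀ x, Integrable (fun M : Model H X A =>
      ∑ π, policyProb p sel hist π * value M π.toPolicy x) (prior (postParam α hist)) :=
    fun x => integrable_model hpost (by fun_prop)
  have hi : ∀ x, Integrable (fun M : Model H X A => ρ x * (optValue M x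
      - ∑ π, policyProb p sel hist π * value M π.toPolicy x)) (prior (postParam α hist)) :=
    fun x => ((integrable_optValue hpost x).sub (hiv x)).const_mul _
  rw [integral_finsetSum _ fun x _ => hi x]
  have h2 : ∀ x, ∫ M, ρ x * (optValue M x - ∑ π, policyProb p sel hist π * value M π.toPolicy x)
        ∂prior (postParam α hist)
      ≤ ρ x * (∑ π, policyProb p sel hist π * (∑ τ : Trajectory H X A,
          episodeProb M' π.toPolicy (x, τ) * ∑ h, bonus p H T (visitCount hist
            (h, Episode.state (x, τ) h, Episode.action (x, τ) h))) + ε) := by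
    intro x
    rw [integral_const_mul]
    refine mul_le_mul_of_nonneg_left ?_ (stdSimplex.zero_le _ _)
    rw [integral_sub (integrable_optValue hpost x) (hiv x),
      integral_finsetSum _ fun π _ => integrable_model hpost (by fun_prop)]
    simp_rw [integral_const_mul, integral_value hpost]
    have := episode_regret_le hist hσ hσ₀ hσH hθ hα hsum hsel hselm hT x
    simp_rw [mul_add, Finset.sum_add_distrib] at this
    linarith
  refine (Finset.sum_le_sum fun x _ => h2 x).trans (le_of_eq ?_)
  simp_rw [mul_add, Finset.sum_add_distrib, ← Finset.sum_mul, stdSimplex.sum_eq_one, one_mul]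
  congr 1
  rw [nextMean]
  simp_rw [Finset.mul_sum]
  rw [Finset.sum_comm]
  refine Finset.sum_congr rfl fun π _ => Finset.sum_congr rfl fun x _ =>
    Finset.sum_congr rfl fun τ _ => Finset.sum_congr rfl fun h _ => ?_
  ring

/-- The Bayesian regret is bounded by the expected potential of the bonuses. -/
theorem bayesRegret_le_potential [Nonempty A] (hσ : 0 < p.σ) (hσ₀ : 0 < p.σ₀)
    (hσH : p.σ ^ 2 = 3 * (H : ℝ) ^ 2)
    (hθ : p.θbar = H) {α : Fin H × X × A → Outcome X → ℝ} (hα : ∀ i o, 0 < α i o)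
    (hsum : ∀ i, ∑ o, α i o = p.weight)
    (hsel : ∀ (q : A → ℝ) (a : A), q a ≤ q (sel q))
    (hselm : ∀ a : A, MeasurableSet {q : A → ℝ | sel q = a}) {T : ℝ} (hT : 1 ≤ T) (n : ℕ) :
    bayesRegret α ρ p sel n
      ≤ ∫ M, ∑ w : Run n H X A, runProb ρ p sel M w * potential (bonus p H T) w.episodes ∂prior α
        + n * (3 * p.σ₀ * (H : ℝ) ^ 2
          * (Fintype.card (Fin H × X × A) * Real.exp (-T ^ 2 / 2))) := by
  set ε := 3 * p.σ₀ * (H : ℝ) ^ 2 * (Fintype.card (Fin H × X × A) * Real.exp (-T ^ 2 / 2)) with hε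
  have := isProbabilityMeasure_prior hα
  induction n with
  | zero => simp [bayesRegret, expectedRegret, runRegret, potential, visitCount, visits]
  | succ n ih =>
    set R : Model H X A → ℝ := fun M => ∑ w : Run n H X A, runProb ρ p sel M w
      * nextMean ρ p sel w.episodes M (fun π e => optValue M e.1 - value M π.toPolicy e.1) with hR
    set B : Model H X A → ℝ := fun M => ∑ w : Run n H X A, runProb ρ p sel M w
      * nextMean ρ p sel w.episodes M
          (fun _ e => ∑ h, bonus p H T (visitCount w.episodes (h, e.state h, e.action h))) with hB
    have e1 : ∀ M, expectedRegret ρ p sel (n + 1) M = expectedRegret ρ p sel n M + R M := fun M =>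
      sum_run_succ ρ p hselm M (runRegret M) (runRegret M)
        (fun _ π e => optValue M e.1 - value M π.toPolicy e.1) (runRegret_snoc M)
    have e2 : ∀ M, ∑ w : Run (n + 1) H X A,
          runProb ρ p sel M w * potential (bonus p H T) w.episodes
        = ∑ w : Run n H X A, runProb ρ p sel M w * potential (bonus p H T) w.episodes + B M :=
      fun M => sum_run_succ ρ p hselm M _ (fun w => potential (bonus p H T) w.episodes)
        (fun w _ e => ∑ h, bonus p H T (visitCount w.episodes (h, e.state h, e.action h)))
        (potential_snoc _)
    have hBc : Continuous B := by
      simp only [hB, nextMean]; fun_prop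
    have hPc : Continuous fun M : Model H X A =>
        ∑ w : Run n H X A, runProb ρ p sel M w * potential (bonus p H T) w.episodes := by fun_prop
    have hRi : Integrable R (prior α) := by
      have : R = fun M => expectedRegret ρ p sel (n + 1) M - expectedRegret ρ p sel n M := by
        ext M; rw [e1]; ring
      rw [this]
      exact (integrable_expectedRegret ρ p hselm hα).sub (integrable_expectedRegret ρ p hselm hα)
    -- Run by run: weighting the prior by the run's probability gives `K` times the posterior, to
    -- which the bound for one episode applies.
    have hstep : ∫ M, R M ∂prior α ≤ ∫ M, B M ∂prior α + ε := by
      have hnm : ∀ hist : Fin n → Episode H X A, Measurable fun M : Model H X A =>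
          nextMean ρ p sel hist M (fun π e => optValue M e.1 - value M π.toPolicy e.1) := by
        intro hist
        unfold nextMean
        refine Finset.measurable_sum _ fun π _ => Measurable.const_mul
          (Finset.measurable_sum _ fun x _ => Measurable.const_mul
            (Finset.measurable_sum _ fun τ _ => ?_) _) _
        exact (continuous_episodeProb _ _).measurable.mul
          ((measurable_optValue _).sub (continuous_value _ _).measurable)
      have hnn : ∀ (hist : Fin n → Episode H X A) (M : Model H X A),
          0 ≤ nextMean ρ p sel hist M (fun π e => optValue M e.1 - value M π.toPolicy e.1) :=
        fun hist M => Finset.sum_nonneg fun π _ => mul_nonneg (policyProb_nonneg _ _ _ _)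
          (Finset.sum_nonneg fun x _ => mul_nonneg (stdSimplex.zero_le _ _)
            (Finset.sum_nonneg fun τ _ => mul_nonneg (episodeProb_nonneg _ _ _)
              (sub_nonneg.mpr (value_le_optValue _ _ _))))
      -- Each term is a nonnegative summand of the integrable `R`, which dominates it.
      have hRw : ∀ w : Run n H X A, Integrable (fun M => runProb ρ p sel M w
          * nextMean ρ p sel w.episodes M (fun π e => optValue M e.1 - value M π.toPolicy e.1))
          (prior α) := by
        intro w
        refine hRi.mono' ((continuous_runProb ρ p sel w).measurable.mul
          (hnm _)).aestronglyMeasurable (Filter.Eventually.of_forall fun M => ?_)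
        rw [Real.norm_of_nonneg (mul_nonneg (runProb_nonneg _ _ _ _ _) (hnn _ _))]
        exact Finset.single_le_sum (f := fun w : Run n H X A => runProb ρ p sel M w
          * nextMean ρ p sel w.episodes M (fun π e => optValue M e.1 - value M π.toPolicy e.1))
          (fun w _ => mul_nonneg (runProb_nonneg _ _ _ _ _) (hnn _ _)) (Finset.mem_univ w)
      have hBw : ∀ w : Run n H X A, Integrable (fun M => runProb ρ p sel M w
          * nextMean ρ p sel w.episodes M
          (fun _ e => ∑ h, bonus p H T (visitCount w.episodes (h, e.state h, e.action h))))
          (prior α) := by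
        intro w
        refine integrable_model hα ?_
        unfold nextMean; fun_prop
      -- Run probabilities sum to one in every model, so the error can be distributed over the runs.
      have hε1 : ε = ∑ w : Run n H X A, ∫ M, runProb ρ p sel M w * ε ∂prior α := by
        rw [← integral_finsetSum _ fun w _ => integrable_model hα (by fun_prop)]
        simp_rw [← Finset.sum_mul, sum_runProb ρ p hselm]
        simp
      rw [hR, hB, integral_finsetSum _ fun w _ => hRw w, integral_finsetSum _ fun w _ => hBw w, hε1,
        ← Finset.sum_add_distrib]
      refine Finset.sum_le_sum fun w _ => ?_
      obtain ⟨K, hK, h⟩ := exists_integral_runProb (n := n) ρ p (sel := sel) hα w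
      have := isProbabilityMeasure_prior (postParam_pos hα w.episodes)
      rw [h, h, h fun _ => ε, ← mul_add]
      refine mul_le_mul_of_nonneg_left ?_ hK
      have := integral_next_regret_le ρ hσ hσ₀ hσH hθ hα hsum hsel hselm hT w.episodes
      rw [integral_const, probReal_univ, one_smul]
      exact this
    have hB1 : bayesRegret α ρ p sel (n + 1) = bayesRegret α ρ p sel n + ∫ M, R M ∂prior α := by
      unfold bayesRegret
      simp_rw [e1]
      exact integral_add (integrable_expectedRegret ρ p hselm hα) hRi
    simp_rw [e2]
    rw [hB1, integral_add (integrable_model hα hPc) (integrable_model hα hBc)]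
    push_cast
    linarith

/-- A deterministic bound on the potential bounds the Bayesian regret. -/
theorem bayesRegret_le_of_potential_le [Nonempty A] (hσ : 0 < p.σ) (hσ₀ : 0 < p.σ₀)
    (hσH : p.σ ^ 2 = 3 * (H : ℝ) ^ 2)
    (hθ : p.θbar = H) {α : Fin H × X × A → Outcome X → ℝ} (hα : ∀ i o, 0 < α i o)
    (hsum : ∀ i, ∑ o, α i o = p.weight)
    (hsel : ∀ (q : A → ℝ) (a : A), q a ≤ q (sel q))
    (hselm : ∀ a : A, MeasurableSet {q : A → ℝ | sel q = a}) {T : ℝ} (hT : 1 ≤ T) {D : ℝ}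
    (hD : ∀ hist : Fin n → Episode H X A, potential (bonus p H T) hist ≤ D) :
    bayesRegret α ρ p sel n
      ≤ D + n * (3 * p.σ₀ * (H : ℝ) ^ 2
          * (Fintype.card (Fin H × X × A) * Real.exp (-T ^ 2 / 2))) := by
  have := isProbabilityMeasure_prior hα
  refine (bayesRegret_le_potential ρ hσ hσ₀ hσH hθ hα hsum hsel hselm hT n).trans ?_
  refine add_le_add_left ?_ _
  have h : ∫ M, ∑ w : Run n H X A, runProb ρ p sel M w * potential (bonus p H T) w.episodes ∂prior α
      ≤ ∫ _M : Model H X A, D ∂prior α := by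
    refine integral_mono (integrable_model hα (by fun_prop)) (integrable_const _) fun M => ?_
    calc ∑ w : Run n H X A, runProb ρ p sel M w * potential (bonus p H T) w.episodes
        ≤ ∑ w : Run n H X A, runProb ρ p sel M w * D := Finset.sum_le_sum fun w _ =>
          mul_le_mul_of_nonneg_left (hD _) (runProb_nonneg _ _ _ _ _)
      _ = D := by rw [← Finset.sum_mul, sum_runProb ρ p hselm, one_mul]
  simpa using h

/-- No episode loses more than `H`. This is enough when there are few episodes. -/
lemma bayesRegret_le_card [Nonempty A]
    (hselm : ∀ a : A, MeasurableSet {q : A → ℝ | sel q = a})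
    {α : Fin H × X × A → Outcome X → ℝ} (hα : ∀ i o, 0 < α i o) :
    bayesRegret α ρ p sel n ≤ n * H := by
  have := isProbabilityMeasure_prior hα
  have h : ∫ M, expectedRegret ρ p sel n M ∂prior α ≤ ∫ _M : Model H X A, (n * H : ℝ) ∂prior α :=
    integral_mono (integrable_expectedRegret ρ p hselm hα) (integrable_const _)
      fun M => expectedRegret_le ρ p hselm M
  simpa [bayesRegret] using h

end RunRegret

/-! ### The bound on the potential -/

section Potential

/-- Each term is at most `2(√(k+1) - √k)`, which telescopes. -/
lemma sum_inv_sqrt_le (N : ℕ) :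
    ∑ k ∈ Finset.range N, 1 / Real.sqrt ((k : ℝ) + 1) ≤ 2 * Real.sqrt N := by
  induction N with
  | zero => simp
  | succ N ih =>
    rw [Finset.sum_range_succ]
    have h0 := Real.sqrt_nonneg (N : ℝ)
    have h1 : 0 < Real.sqrt ((N : ℝ) + 1) := Real.sqrt_pos.mpr (by positivity)
    have h2 := Real.sq_sqrt (Nat.cast_nonneg (α := ℝ) N)
    have h3 := Real.sq_sqrt (show (0 : ℝ) ≤ (N : ℝ) + 1 by positivity)
    have h4 : 1 / Real.sqrt ((N : ℝ) + 1) ≤ 2 * (Real.sqrt ((N : ℝ) + 1) - Real.sqrt N) := by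
      rw [div_le_iff₀ h1]
      nlinarith [sq_nonneg (Real.sqrt ((N : ℝ) + 1) - Real.sqrt N)]
    push_cast
    linarith

/-- `β ≥ 2` gives `1/(k+β) ≤ 1/(k+2) ≤ log(k+2) - log(k+1)`, which telescopes. -/
lemma sum_div_add_le {β : ℝ} (hβ : 2 ≤ β) (N : ℕ) :
    ∑ k ∈ Finset.range N, β / ((k : ℝ) + β) ≤ β * Real.log (1 + N) := by
  induction N with
  | zero => simp
  | succ N ih =>
    rw [Finset.sum_range_succ]
    have hN : (0 : ℝ) ≤ N := Nat.cast_nonneg N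
    have h1 : β / ((N : ℝ) + β) ≤ β * (1 / (N + 2)) := by
      rw [mul_one_div]; gcongr
    have h2 : 1 / ((N : ℝ) + 2) ≤ Real.log (N + 2) - Real.log (N + 1) := by
      have := Real.one_sub_inv_le_log_of_pos (x := ((N : ℝ) + 2) / (N + 1)) (by positivity)
      rw [Real.log_div (by positivity) (by positivity), inv_div] at this
      refine le_trans (le_of_eq ?_) this
      field_simp
      ring
    have h3 := mul_le_mul_of_nonneg_left h2 (show (0 : ℝ) ≤ β by linarith)
    have e1 : (1 : ℝ) + ((N + 1 : ℕ) : ℝ) = N + 2 := by push_cast; ring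
    rw [e1]
    rw [add_comm (1 : ℝ)] at ih
    linarith

variable {ι : Type*} [Fintype ι]

lemma sum_sqrt_le (N : ι → ℕ) :
    ∑ i, Real.sqrt (N i) ≤ Real.sqrt (Fintype.card ι * (∑ i, N i : ℕ)) := by
  apply Real.le_sqrt_of_sq_le
  refine (sq_sum_le_card_mul_sum_sq (s := Finset.univ) (f := fun i => Real.sqrt (N i))).trans
    (le_of_eq ?_)
  push_cast
  rw [Finset.card_univ]
  congr 1
  exact Finset.sum_congr rfl fun i _ => Real.sq_sqrt (Nat.cast_nonneg _)

/-- Concavity of the logarithm: each term lies below the tangent at the average `a`, and the linear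
parts sum to zero. -/
lemma sum_log_one_add_le [Nonempty ι] (N : ι → ℕ) :
    ∑ i, Real.log (1 + N i)
      ≤ Fintype.card ι * Real.log (1 + (∑ i, N i : ℕ) / Fintype.card ι) := by
  have hc : (0 : ℝ) < Fintype.card ι := Nat.cast_pos.mpr Fintype.card_pos
  set a : ℝ := 1 + (∑ i, N i : ℕ) / Fintype.card ι with ha
  have ha0 : 0 < a := by positivity
  have h1 : ∀ i, Real.log (1 + N i) ≤ Real.log a + (1 + N i - a) / a := by
    intro i
    have := Real.log_le_sub_one_of_pos (x := (1 + N i) / a) (by positivity)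
    rw [Real.log_div (by positivity) ha0.ne'] at this
    have e : (1 + (N i : ℝ) - a) / a = (1 + N i) / a - 1 := by field_simp
    linarith
  calc ∑ i, Real.log (1 + N i) ≤ ∑ i, (Real.log a + (1 + N i - a) / a) :=
        Finset.sum_le_sum fun i _ => h1 i
    _ = Fintype.card ι * Real.log a + (∑ i, (1 + (N i : ℝ) - a)) / a := by
        rw [Finset.sum_add_distrib, ← Finset.sum_div]; simp
    _ = Fintype.card ι * Real.log a := by
        have : ∑ i, (1 + (N i : ℝ) - a) = 0 := by
          rw [Finset.sum_sub_distrib, Finset.sum_add_distrib]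
          simp only [Finset.sum_const, Finset.card_univ, nsmul_eq_mul, ha]
          push_cast
          field_simp
          ring
        rw [this]; simp

variable {H n : ℕ} {X A : Type*} [Fintype X] [Fintype A] [DecidableEq X] [DecidableEq A]

/-- Every episode passes through exactly one state-action pair at a given step. -/
lemma sum_visitCount (hist : Fin n → Episode H X A) (h : Fin H) :
    ∑ y : X × A, visitCount hist (h, y) = n := by
  have := Finset.card_eq_sum_card_fiberwise (s := (Finset.univ : Finset (Fin n)))
    (t := (Finset.univ : Finset (X × A)))
    (f := fun j => ((hist j).state h, (hist j).action h)) (fun _ _ => Finset.mem_univ _)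
  rw [Finset.card_univ, Fintype.card_fin] at this
  refine Eq.trans ?_ this.symm
  refine Finset.sum_congr rfl fun y _ => ?_
  simp only [visitCount, visits]
  congr 1
  ext j
  simp [Prod.ext_iff]

/-- At a fixed step the visits sum to `n`. The noise part sums to square roots of counts and the
prior part to logarithms; both are concave in the counts, so even spreading is the worst case. -/
lemma potential_bonus_le [Nonempty X] [Nonempty A] {p : Params} (hσ : 0 < p.σ) (hσ₀ : 0 < p.σ₀)
    (hw : 2 ≤ p.weight) {T : ℝ} (hT : 0 ≤ T) (hist : Fin n → Episode H X A) :
    potential (bonus p H T) hist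
      ≤ H * (T * (Real.sqrt 2 * p.σ) * (2 * Real.sqrt (Fintype.card (X × A) * n))
        + (H + H * (3 / 2 * p.σ₀ * T)) * (p.weight * (Fintype.card (X × A)
          * Real.log (1 + n / Fintype.card (X × A))))) := by
  have hg : ∀ N : ℕ, ∑ k ∈ Finset.range N, bonus p H T k
      ≤ T * (Real.sqrt 2 * p.σ) * (2 * Real.sqrt N)
        + (H + H * (3 / 2 * p.σ₀ * T)) * (p.weight * Real.log (1 + N)) := by
    intro N
    calc ∑ k ∈ Finset.range N, bonus p H T k
        ≤ ∑ k ∈ Finset.range N, (T * (Real.sqrt 2 * p.σ) * (1 / Real.sqrt ((k : ℝ) + 1))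
          + (H + H * (3 / 2 * p.σ₀ * T)) * (p.weight / (k + p.weight))) := by
          refine Finset.sum_le_sum fun k _ => ?_
          have := mul_le_mul_of_nonneg_left
            (noiseScale_le_div_sqrt hσ hσ₀ (by linarith) k) hT
          rw [bonus]
          linarith
      _ ≤ _ := by
          rw [Finset.sum_add_distrib, ← Finset.mul_sum, ← Finset.mul_sum]
          gcongr
          · exact sum_inv_sqrt_le N
          · exact sum_div_add_le hw N
  have hh : ∀ h : Fin H, ∑ y : X × A, ∑ k ∈ Finset.range (visitCount hist (h, y)), bonus p H T k
      ≤ T * (Real.sqrt 2 * p.σ) * (2 * Real.sqrt (Fintype.card (X × A) * n))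
        + (H + H * (3 / 2 * p.σ₀ * T)) * (p.weight * (Fintype.card (X × A)
          * Real.log (1 + n / Fintype.card (X × A)))) := by
    intro h
    refine (Finset.sum_le_sum fun y _ => hg _).trans ?_
    rw [Finset.sum_add_distrib, ← Finset.mul_sum, ← Finset.mul_sum, ← Finset.mul_sum,
      ← Finset.mul_sum]
    have h1 := sum_sqrt_le fun y : X × A => visitCount hist (h, y)
    have h2 := sum_log_one_add_le fun y : X × A => visitCount hist (h, y)
    rw [sum_visitCount] at h1 h2
    have := weight_pos hσ hσ₀
    gcongr
  rw [potential, Fintype.sum_prod_type]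
  refine (Finset.sum_le_sum fun h _ => hh h).trans (le_of_eq ?_)
  rw [Finset.sum_const, Finset.card_univ, Fintype.card_fin, nsmul_eq_mul]

end Potential

/-! ### The final arithmetic -/

section Arithmetic

lemma one_le_logPlus (x : ℝ) : 1 ≤ logPlus x := le_max_left _ _

lemma log_le_logPlus (x : ℝ) : Real.log x ≤ logPlus x := le_max_right _ _

lemma logPlus_le_logPlus {x y : ℝ} (hx : 0 < x) (h : x ≤ y) : logPlus x ≤ logPlus y :=
  max_le_max le_rfl (Real.log_le_log hx h)

lemma logPlus_two_mul_le {y : ℝ} (hy : 1 ≤ y) : logPlus (2 * y) ≤ 2 * logPlus y := by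
  have h1 := one_le_logPlus y
  refine max_le (by linarith) ?_
  rw [Real.log_mul (by norm_num) (by linarith)]
  linarith [Real.log_two_lt_d9, log_le_logPlus y]

lemma exp_neg_logPlus_le {x : ℝ} (hx : 0 < x) : Real.exp (-logPlus x) ≤ 1 / x := by
  rw [one_div, ← Real.exp_log hx, ← Real.exp_neg, Real.exp_log hx]
  exact Real.exp_le_exp.mpr (neg_le_neg (log_le_logPlus x))

lemma regretBound_eq (β : ℝ) (hβ : 0 ≤ β) (nX nA H L : ℕ) :
    regretBound β nX nA H L
      = 5 * (H : ℝ) ^ 2 * (Real.sqrt β * Real.sqrt ((nX : ℝ) * nA * L)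
        * Real.sqrt (logPlus (2 * ((nX : ℝ) * nA) * H * L))) * logPlus (1 + L / ((nX : ℝ) * nA)) := by
  have : β * nX * nA * L * logPlus (2 * nX * nA * H * L)
      = β * ((nX : ℝ) * nA * L) * logPlus (2 * ((nX : ℝ) * nA) * H * L) := by
    rw [← mul_assoc 2]; ring
  rw [regretBound, this, Real.sqrt_mul (by positivity), Real.sqrt_mul hβ]

/-- The regret bound is of order `H² √(|X||A|L)` up to logarithmic factors. -/
lemma regretBound_le {β : ℝ} (hβ : 0 ≤ β) (nX nA H L : ℕ) :
    regretBound β nX nA H L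
      ≤ 20 * Real.sqrt β * ((H : ℝ) ^ 2 * Real.sqrt ((nX : ℝ) * nA * L))
        * logPlus ((nX : ℝ) * nA * H * L) ^ 2 := by
  rw [regretBound_eq β hβ]
  -- If a size vanishes, the common factor `H² √(nX nA L)` is zero, or `H` or `L` is; both sides are
  -- then zero, whatever the quotient `L / (nX nA)` means.
  rcases Nat.eq_zero_or_pos (nX * nA * H * L) with h0 | h0
  · have : (H : ℝ) ^ 2 * Real.sqrt ((nX : ℝ) * nA * L) = 0 := by
      rcases Nat.mul_eq_zero.mp h0 with h0 | h0
      · rcases Nat.mul_eq_zero.mp h0 with h0 | h0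
        · have : (nX : ℝ) * nA = 0 := by exact_mod_cast h0
          simp [this]
        · simp [h0]
      · simp [h0]
    have e : ∀ a b c : ℝ, 5 * (H : ℝ) ^ 2 * (a * Real.sqrt ((nX : ℝ) * nA * L) * b) * c
      = 5 * ((H : ℝ) ^ 2 * Real.sqrt ((nX : ℝ) * nA * L)) * a * b * c := fun a b c => by ring
    rw [e, this]
    simp
  · obtain ⟨⟨⟨hX, hA⟩, hH⟩, hL⟩ : ((0 < nX ∧ 0 < nA) ∧ 0 < H) ∧ 0 < L := by
      simpa [Nat.pos_iff_ne_zero, Nat.mul_eq_zero, not_or] using h0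
    have hX' : (1 : ℝ) ≤ nX := by exact_mod_cast hX
    have hA' : (1 : ℝ) ≤ nA := by exact_mod_cast hA
    have hH' : (1 : ℝ) ≤ H := by exact_mod_cast hH
    have hL' : (1 : ℝ) ≤ L := by exact_mod_cast hL
    set y : ℝ := (nX : ℝ) * nA * H * L with hy
    have hXA : (1 : ℝ) ≤ (nX : ℝ) * nA := one_le_mul_of_one_le_of_one_le hX' hA'
    have hXAH : (1 : ℝ) ≤ (nX : ℝ) * nA * H := one_le_mul_of_one_le_of_one_le hXA hH'
    have hyL : (L : ℝ) ≤ y := le_mul_of_one_le_left (by linarith) hXAH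
    have hl := logPlus_two_mul_le (hL'.trans hyL)
    have h1 : Real.sqrt (logPlus (2 * ((nX : ℝ) * nA) * H * L)) ≤ 2 * logPlus y := by
      have e : 2 * ((nX : ℝ) * nA) * H * L = 2 * y := by rw [hy]; ring
      rw [e]
      refine le_trans ?_ hl
      have := one_le_logPlus (2 * y)
      rw [Real.sqrt_le_left (by linarith)]
      nlinarith
    have h2 : logPlus (1 + L / ((nX : ℝ) * nA)) ≤ 2 * logPlus y := by
      refine le_trans (logPlus_le_logPlus (by positivity) ?_) hl
      have : (L : ℝ) / ((nX : ℝ) * nA) ≤ L := div_le_self (by linarith) hXA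
      linarith
    have h3 := one_le_logPlus y
    have h4 := one_le_logPlus (1 + L / ((nX : ℝ) * nA))
    calc 5 * (H : ℝ) ^ 2 * (Real.sqrt β * Real.sqrt ((nX : ℝ) * nA * L)
          * Real.sqrt (logPlus (2 * ((nX : ℝ) * nA) * H * L))) * logPlus (1 + L / ((nX : ℝ) * nA))
        ≤ 5 * (H : ℝ) ^ 2 * (Real.sqrt β * Real.sqrt ((nX : ℝ) * nA * L)
          * (2 * logPlus y)) * (2 * logPlus y) := by gcongr
      _ = _ := by ring

/-- Here `c = |X||A|`, `b = √β`, `s = σ₀`, `S = √(cL)`, `r` is the root of the first logarithmic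
factor, and `E` is the Gaussian tail. The constant splits as `5 = 4 + 1/5 + 1/2 + 3/10` over the
noise, the prior target, the noise that enters through the prior term, and the tail. `√3 ≤ b` gives
`s ≤ H`, and the assumption on `S` absorbs the prior terms. -/
lemma regret_arith {c H b r Λ S s l L E : ℝ} (hc : 1 ≤ c) (hH : 1 ≤ H) (hr : 1 ≤ r) (hΛ : 1 ≤ Λ)
    (hb : Real.sqrt 3 ≤ b) (hs : 0 ≤ s) (hbs : b * s = Real.sqrt 3 * H) (hS : 5 * b * H * c ≤ S)
    (hl0 : 0 ≤ l) (hl : l ≤ Λ) (hE : L * (H * c * E) ≤ 1 / 2) :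
    H * (Real.sqrt 2 * r * (Real.sqrt 2 * (Real.sqrt 3 * H)) * (2 * S)
        + (H + H * (3 / 2 * s * (Real.sqrt 2 * r))) * (b ^ 2 * (c * l)))
      + L * (3 * s * H ^ 2 * (H * c * E)) ≤ 5 * H ^ 2 * (b * S * r) * Λ := by
  have h2 : Real.sqrt 2 * Real.sqrt 2 = 2 := Real.mul_self_sqrt (by norm_num)
  have h3 : Real.sqrt 3 * Real.sqrt 3 = 3 := Real.mul_self_sqrt (by norm_num)
  have h32 : 3 / 2 ≤ Real.sqrt 3 := Real.le_sqrt_of_sq_le (by norm_num)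
  have h23 : Real.sqrt 2 * Real.sqrt 3 ≤ 5 / 2 := by
    rw [← Real.sqrt_mul (by norm_num)]
    exact Real.sqrt_le_iff.mpr ⟨by norm_num, by norm_num⟩
  have hb0 : 0 < b := by linarith
  have hb32 : 3 / 2 ≤ b := h32.trans hb
  have hS0 : 0 ≤ S := le_trans (by positivity) hS
  have hsH : s ≤ H := by
    have : b * s ≤ b * H := by rw [hbs]; gcongr
    exact le_of_mul_le_mul_left this hb0
  have t1 : H * (Real.sqrt 2 * r * (Real.sqrt 2 * (Real.sqrt 3 * H)) * (2 * S))
      ≤ 4 * (H ^ 2 * (b * S * r) * Λ) := by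
    calc H * (Real.sqrt 2 * r * (Real.sqrt 2 * (Real.sqrt 3 * H)) * (2 * S))
        = 2 * (Real.sqrt 2 * Real.sqrt 2) * (H ^ 2 * (Real.sqrt 3 * S * r) * 1) := by ring
      _ ≤ 2 * (Real.sqrt 2 * Real.sqrt 2) * (H ^ 2 * (b * S * r) * Λ) := by gcongr
      _ = _ := by rw [h2]; ring
  have t2 : H * (H * (b ^ 2 * (c * l))) ≤ 1 / 5 * (H ^ 2 * (b * S * r) * Λ) := by
    calc H * (H * (b ^ 2 * (c * l))) = 1 / 5 * (H * (b * (5 * b * H * c) * 1) * l) := by ring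
      _ ≤ 1 / 5 * (H ^ 2 * (b * S * r) * Λ) := by
        gcongr
        exact le_self_pow₀ hH two_ne_zero
  have t3 : H * (H * (3 / 2 * s * (Real.sqrt 2 * r)) * (b ^ 2 * (c * l)))
      ≤ 1 / 2 * (H ^ 2 * (b * S * r) * Λ) := by
    calc H * (H * (3 / 2 * s * (Real.sqrt 2 * r)) * (b ^ 2 * (c * l)))
        = 3 / 10 * (H ^ 2 * (Real.sqrt 2 * r) * (b * s) * (5 * b * c) * l) := by ring
      _ = 3 / 10 * (Real.sqrt 2 * Real.sqrt 3) * (H ^ 2 * r * (5 * b * H * c) * l) := by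
        rw [hbs]; ring
      _ ≤ 3 / 10 * (5 / 2) * (H ^ 2 * r * S * Λ) := by gcongr
      _ = 1 / 2 * (H ^ 2 * (3 / 2 * S * r) * Λ) := by ring
      _ ≤ 1 / 2 * (H ^ 2 * (b * S * r) * Λ) := by gcongr
  have t4 : L * (3 * s * H ^ 2 * (H * c * E)) ≤ 3 / 10 * (H ^ 2 * (b * S * r) * Λ) := by
    calc L * (3 * s * H ^ 2 * (H * c * E)) = 3 * s * H ^ 2 * (L * (H * c * E)) := by ring
      _ ≤ 3 * s * H ^ 2 * (1 / 2) := mul_le_mul_of_nonneg_left hE (by positivity)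
      _ ≤ 3 * H * H ^ 2 * (1 / 2) := by gcongr
      _ = 3 / 10 * (H ^ 2 * (1 * (5 * 1 * H * 1) * 1) * 1) := by ring
      _ ≤ 3 / 10 * (H ^ 2 * (b * (5 * b * H * c) * r) * Λ) := by
        have : 1 ≤ b := by linarith
        gcongr
      _ ≤ 3 / 10 * (H ^ 2 * (b * S * r) * Λ) := by gcongr
  linarith

end Arithmetic

/-! ### Assembly of the bound: small and large numbers of episodes. -/

section Main

variable {H n : ℕ} {X A : Type*} [Fintype X] [Fintype A] [DecidableEq X] [DecidableEq A]
  [Nonempty X] [Nonempty A]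

/-- The Bayesian regret of tabular Wasserstein TD. -/
theorem bayesRegret_le_regretBound (ρ : stdSimplex ℝ X) {p : Params} {sel : (A → ℝ) → A}
    (hσ : 0 < p.σ) (hσ₀ : 0 < p.σ₀) (hσH : p.σ ^ 2 = 3 * (H : ℝ) ^ 2)
    (hθ : p.θbar = H) {α : Fin H × X × A → Outcome X → ℝ} (hα : ∀ i o, 0 < α i o)
    (hsum : ∀ i, ∑ o, α i o = p.weight) (hw : 3 ≤ p.weight)
    (hsel : ∀ (q : A → ℝ) (a : A), q a ≤ q (sel q))
    (hselm : ∀ a : A, MeasurableSet {q : A → ℝ | sel q = a}) (L : ℕ) :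
    bayesRegret α ρ p sel L ≤ regretBound p.weight (Fintype.card X) (Fintype.card A) H L := by
  have hβ0 := weight_pos hσ hσ₀
  rw [regretBound_eq _ hβ0.le]
  set c : ℝ := (Fintype.card X : ℝ) * Fintype.card A with hc
  have hcard : (Fintype.card (X × A) : ℝ) = c := by rw [Fintype.card_prod]; push_cast; rfl
  have hc1 : 1 ≤ c := by
    rw [← hcard]; exact_mod_cast Nat.one_le_iff_ne_zero.mpr Fintype.card_ne_zero
  have hH1 : (1 : ℝ) ≤ H := by
    -- `H = 0` would force `σ = 0`.
    rcases Nat.eq_zero_or_pos H with rfl | h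
    · norm_num at hσH
      exact absurd hσH hσ.ne'
    · exact_mod_cast h
  have hL0 : (0 : ℝ) ≤ L := Nat.cast_nonneg L
  set b := Real.sqrt p.weight with hb
  set S := Real.sqrt (c * L) with hS
  set ℓ := logPlus (2 * c * H * L) with hℓ
  set r := Real.sqrt ℓ with hr
  set Λ := logPlus (1 + L / c) with hΛ
  have hℓ1 : 1 ≤ ℓ := one_le_logPlus _
  have hΛ1 : 1 ≤ Λ := one_le_logPlus _
  have hr1 : 1 ≤ r := Real.one_le_sqrt.mpr hℓ1
  have hb2 : b ^ 2 = p.weight := Real.sq_sqrt hβ0.le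
  have hb0 : 0 < b := Real.sqrt_pos.mpr hβ0
  have hS2 : S ^ 2 = c * L := Real.sq_sqrt (by positivity)
  have hS0 : 0 ≤ S := Real.sqrt_nonneg _
  -- If `S` is small, `c L = S² ≤ 5 b H c S` gives `L ≤ 5 b H S`, and the trivial bound `L H`
  -- suffices.
  rcases le_or_gt S (5 * b * H * c) with hcase | hcase
  · refine (bayesRegret_le_card ρ hselm hα).trans ?_
    have h1 : (L : ℝ) ≤ 5 * b * H * S := by
      have : c * L ≤ c * (5 * b * H * S) := by
        rw [← hS2]; nlinarith
      exact le_of_mul_le_mul_left this (by linarith)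
    calc (L : ℝ) * H ≤ 5 * b * H * S * H := by gcongr
      _ = 5 * (H : ℝ) ^ 2 * (b * S * 1) * 1 := by ring
      _ ≤ 5 * (H : ℝ) ^ 2 * (b * S * r) * Λ := by gcongr
  · have hS1 : 0 < S := lt_of_le_of_lt (by positivity) hcase
    have hLpos : (0 : ℝ) < L := by
      rcases hL0.eq_or_lt with h | h
      · rw [hS, ← h] at hS1; simp at hS1
      · exact h
    -- The truncation `T = √(2ℓ)` makes `e^(-T²/2) = e^(-ℓ) ≤ 1/(2cHL)`, which offsets the union
    -- bound over `Hc` indices and `L` episodes.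
    have hT : 1 ≤ Real.sqrt (2 * ℓ) := Real.one_le_sqrt.mpr (by linarith)
    have hTr : Real.sqrt (2 * ℓ) = Real.sqrt 2 * r := Real.sqrt_mul (by norm_num) _
    have h := bayesRegret_le_of_potential_le ρ hσ hσ₀ hσH hθ hα hsum hsel hselm hT
      fun hist : Fin L → Episode H X A => potential_bonus_le hσ hσ₀ (by linarith)
        (zero_le_one.trans hT) hist
    refine h.trans ?_
    have hcard3 : (Fintype.card (Fin H × X × A) : ℝ) = H * c := by
      rw [Fintype.card_prod, Fintype.card_fin, Nat.cast_mul, hcard]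
    have hexp : (L : ℝ) * (H * c * Real.exp (-Real.sqrt (2 * ℓ) ^ 2 / 2)) ≤ 1 / 2 := by
      have e : -Real.sqrt (2 * ℓ) ^ 2 / 2 = -ℓ := by
        rw [Real.sq_sqrt (by linarith)]; ring
      rw [e]
      have hpos : 0 < 2 * c * H * L := by positivity
      calc (L : ℝ) * (H * c * Real.exp (-ℓ)) ≤ L * (H * c * (1 / (2 * c * H * L))) := by
            gcongr; exact exp_neg_logPlus_le hpos
        _ = 1 / 2 := by field_simp
    have hlog : Real.log (1 + L / c) ≤ Λ := log_le_logPlus _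
    have hb3 : Real.sqrt 3 ≤ b := Real.sqrt_le_sqrt hw
    have hσb : p.σ = b * p.σ₀ := sigma_eq_sqrt_weight_mul hσ hσ₀
    have hσ3 : p.σ = Real.sqrt 3 * H := sigma_eq_sqrt_three_mul hσ hσH
    rw [hcard3, hcard, hσ3, hTr, ← hb2]
    rw [hTr] at hexp
    exact regret_arith hc1 hH1 hr1 hΛ1 hb3 hσ₀.le (by rw [← hσb, hσ3]) hcase.le
      (Real.log_nonneg (le_add_of_nonneg_right (by positivity))) hlog hexp

end Main

end

end WTD

theorem theorem1 (β : ℝ) (hβ : 3 ≤ β) :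
    (∀ (X : Type*) (A : Type*) [Fintype X] [Fintype A] [DecidableEq X] [DecidableEq A]
        [Nonempty X] [Nonempty A] (H L : ℕ)
        -- the prior
        (α : Fin H × X × A → WTD.Outcome X → ℝ)
        (_hα : ∀ i o, 0 < α i o) (_hαβ : ∀ i, ∑ o, α i o = β)
        -- the distribution of the initial state
        (ρ : stdSimplex ℝ X)
        -- the parameters of the algorithm
        (p : WTD.Params) (_hσ : 0 < p.σ) (_hσ₀ : 0 < p.σ₀)
        (_hσH : p.σ ^ 2 = 3 * (H : ℝ) ^ 2) (_hθ : p.θbar = H) (_hw : p.σ ^ 2 / p.σ₀ ^ 2 = β)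
        -- the choice of a maximizing action
        (sel : (A → ℝ) → A) (_hsel : ∀ (q : A → ℝ) (a : A), q a ≤ q (sel q))
        (_hselm : ∀ a : A, MeasurableSet {q : A → ℝ | sel q = a}),
        MeasureTheory.Integrable (WTD.expectedRegret ρ p sel L) (WTD.prior α) ∧
        WTD.bayesRegret α ρ p sel L
          ≤ WTD.regretBound β (Fintype.card X) (Fintype.card A) H L) ∧
    (∃ (C : ℝ) (k : ℕ), ∀ nX nA H L : ℕ,
        WTD.regretBound β nX nA H L
          ≤ C * ((H : ℝ) ^ 2 * Real.sqrt ((nX : ℝ) * nA * L))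
              * WTD.logPlus ((nX : ℝ) * nA * H * L) ^ k) := by
  -- Each of the two logarithmic factors costs at most `2 log₊`, hence the exponent `2` and `20 = 5
  -- · 2 · 2`.
  refine ⟨?_, 20 * Real.sqrt β, 2, fun nX nA H L => WTD.regretBound_le (by linarith) nX nA H L⟩
  intro X A _ _ _ _ _ _ H L α hα hαβ ρ p hσ hσ₀ hσH hθ hw sel hsel hselm
  obtain rfl : p.weight = β := hw
  exact ⟨WTD.integrable_expectedRegret ρ p hselm hα,
    WTD.bayesRegret_le_regretBound ρ hσ hσ₀ hσH hθ hα hαβ hβ hsel hselm L⟩
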